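/- **Poincaré inequality.** Let $\mathcal S(n)$ be the normed space of self-adjoint endomorphisms of $\mathbb R^n$. Call $W\in\mathcal S(n)$ *cylindrical* if for some $m\in\{0,\dots,n-1\}$ it has a null eigenvalue of multiplicity $m$ and a positive eigenvalue of multiplicity $n-m$, and let $\mathrm{Cyl}$ be the set of cylindrical points. Let $\Gamma\subset\mathcal S(n)$ be open, invariant under conjugation by $O(n)$ and under multiplication by positive numbers, and suppose that $\overline\Gamma\setminus\{0\}\subset\{W:\operatorname{tr}W>0\}$ and $\overline\Gamma\cap\mathrm{Cyl}=\emptyset$. Then there is a constant $\gamma=\gamma(n,\Gamma)>0$ with the following property. Let $M^n$ be a smooth manifold without boundary, $X:M^n\to\mathbb R^{n+1}$ a smooth immersion with a smooth unit normal field $\nu$, with induced measure $\mu$, second fundamental form $A(v,w)=\langle d\nu(v),dX(w)\rangle$, mean curvature $H=\operatorname{tr}A$, and norms and covariant derivative $\nabla$ those of the induced metric. Let $u\in W^{1,1}(M^n)$ be a function with compact support (no condition if $M^n$ is compact) such that the set $\{A_x: x\in M^n,\ u(x)\neq0\}$ is precompact and contained in $\Gamma$, where $A_x$ is regarded as an element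 of $\mathcal S(n)$ through any orthonormal basis of $T_xM$. Then, for every $r>0$, $$\gamma\int u^2|A|^2\,d\mu\ \le\ r^{-1}\int|\nabla u|^2\,d\mu+(1+r)\int u^2\,\frac{|\nabla A|^2}{H^2}\,d\mu ,$$ where $\nabla u$ is the weak gradient, the integrals take values in $[0,\infty]$, and the last integrand is understood to be $0$ where $u=0$ (if $n\ge1$, then $H>0$ wherever $u\neq0$). -/

import Mathlib

open MeasureTheory
open scoped Manifold ContDiff

noncomputable section

namespace HypersurfacePoincare

/-! ### Symmetric matrices, invariant cones and cylindrical points -/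

/-- The space `𝒮(n)` of self-adjoint endomorphisms of `ℝⁿ`, as real symmetric matrices, with the
topology and the vector space structure it inherits from the space of all matrices. -/
abbrev SymMat (n : ℕ) : Type := selfAdjoint (Matrix (Fin n) (Fin n) ℝ)

/-- The conjugate `U W Uᵀ` of a symmetric matrix. -/
def conj {n : ℕ} (U : Matrix (Fin n) (Fin n) ℝ) (W : SymMat n) : SymMat n :=
  ⟨U * (W : Matrix (Fin n) (Fin n) ℝ) * star U, IsSelfAdjoint.conjugate W.2 U⟩

/-- Invariance under scaling by positive numbers. -/
def IsCone {n : ℕ} (Γ : Set (SymMat n)) : Prop :=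
  ∀ c : ℝ, 0 < c → ∀ W ∈ Γ, c • W ∈ Γ

/-- Invariance under the action of `O(n)` by conjugation. -/
def IsOrthogonallyInvariant {n : ℕ} (Γ : Set (SymMat n)) : Prop :=
  ∀ U ∈ Matrix.orthogonalGroup (Fin n) ℝ, ∀ W ∈ Γ, conj U W ∈ Γ

/-- The trace of a symmetric matrix. -/
def tr {n : ℕ} (W : SymMat n) : ℝ := (W : Matrix (Fin n) (Fin n) ℝ).trace

/-- The multiplicity of `a` as an eigenvalue of a symmetric matrix (`0` if it is not an
eigenvalue). -/
def eigenMult {n : ℕ} (W : SymMat n) (a : ℝ) : ℕ :=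
  Module.finrank ℝ (Module.End.eigenspace (Matrix.toLin' (W : Matrix (Fin n) (Fin n) ℝ)) a)

/-- The `m`-cylindrical points: a null eigenvalue of multiplicity `m` and a positive eigenvalue of
multiplicity `n - m`. -/
def CylOf (n m : ℕ) : Set (SymMat n) :=
  {W | eigenMult W 0 = m ∧ ∃ a : ℝ, 0 < a ∧ eigenMult W a = n - m}

/-- The set of cylindrical points, the union of the sets of `m`-cylindrical points over
`m = 0, …, n - 1`. -/
def Cyl (n : ℕ) : Set (SymMat n) := ⋃ m ∈ Finset.range n, CylOf n m

/-! ### Immersed hypersurfaces of `ℝⁿ⁺¹`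

Throughout, `X : M → ℝⁿ⁺¹` is an immersion of an `n`-dimensional manifold and `ν : M → ℝⁿ⁺¹` a
unit normal field along it. The tangent space `T_xM` is `ℝⁿ` as a vector space (Mathlib's
convention, through the preferred chart at `x`); its inner product is the induced one,
`(v, w) ↦ ⟨dX v, dX w⟩`. -/

/-- The domain model `ℝⁿ`. -/
abbrev E (n : ℕ) : Type := EuclideanSpace ℝ (Fin n)

section Geometry

variable {n : ℕ} {M : Type*} [TopologicalSpace M] [ChartedSpace (E n) M]

/-- The differential at `x` of a map `f : M → ℝⁿ⁺¹`. -/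
def diff (f : M → E (n + 1)) (x : M) : E n →L[ℝ] E (n + 1) :=
  mfderiv (𝓡 n) 𝓘(ℝ, E (n + 1)) f x

/-- `X` is a smooth immersion of `M` in `ℝⁿ⁺¹` and `ν` is a smooth unit normal field along `X`. -/
structure IsHypersurface (X ν : M → E (n + 1)) : Prop where
  smooth : ContMDiff (𝓡 n) 𝓘(ℝ, E (n + 1)) ∞ X
  immersion : ∀ x, Function.Injective (diff X x)
  smooth_normal : ContMDiff (𝓡 n) 𝓘(ℝ, E (n + 1)) ∞ ν
  unit : ∀ x, ‖ν x‖ = 1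
  normal : ∀ x v, inner ℝ (ν x) (diff X x v) = 0

/-- `b` is an orthonormal basis of `T_xM` with respect to the induced inner product. -/
def IsFrame (X : M → E (n + 1)) (x : M) (b : Fin n → E n) : Prop :=
  Orthonormal ℝ fun i => diff X x (b i)

/-- The tangent spaces of an immersed hypersurface have orthonormal bases. -/
theorem exists_isFrame (X : M → E (n + 1)) (x : M) (h : Function.Injective (diff X x)) :
    ∃ b, IsFrame X x b := by
  have hr : Module.finrank ℝ (LinearMap.range (diff X x).toLinearMap) = n := by
    rw [LinearMap.finrank_range_of_inj h]
    simp
  have hmem (i : Fin n) : ∃ v, diff X x v =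
      ((stdOrthonormalBasis ℝ (LinearMap.range (diff X x).toLinearMap)).reindex
        (finCongr hr) i : E (n + 1)) :=
    ((stdOrthonormalBasis ℝ (LinearMap.range (diff X x).toLinearMap)).reindex
        (finCongr hr) i).2
  choose b hb using hmem
  refine ⟨b, ?_⟩
  unfold IsFrame
  simp only [hb]
  exact (((stdOrthonormalBasis ℝ (LinearMap.range (diff X x).toLinearMap)).reindex
    (finCongr hr)).orthonormal).comp_linearIsometry (Submodule.subtypeₗᵢ _)

/-- A choice of orthonormal basis of `T_xM`. The quantities defined with it below do not depend on
the choice. -/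
def frame (X : M → E (n + 1)) (x : M) : Fin n → E n :=
  Classical.epsilon (IsFrame X x)

/-- The second fundamental form `A_x(v, w) = ⟨dν v, dX w⟩`. (With this sign the mean curvature
vector is `-H ν`, and the unit sphere with its outer normal has `A` equal to the metric.) -/
def secondForm (X ν : M → E (n + 1)) (x : M) (v w : E n) : ℝ :=
  inner ℝ (diff ν x v) (diff X x w)

/-- The matrix of `A_x` in the basis `b` of `T_xM`. -/
def curvatureMatrix (X ν : M → E (n + 1)) (x : M) (b : Fin n → E n) :
    Matrix (Fin n) (Fin n) ℝ :=
  Matrix.of fun i j => secondForm X ν x (b i) (b j)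

/-- The set `{A_x : x ∈ S}`, each `A_x` being identified with its matrices in the orthonormal bases
of `T_xM`. -/
def curvatureSet (X ν : M → E (n + 1)) (S : Set M) : Set (Matrix (Fin n) (Fin n) ℝ) :=
  {W | ∃ x ∈ S, ∃ b, IsFrame X x b ∧ W = curvatureMatrix X ν x b}

/-- The mean curvature `H`, the trace of `A`. -/
def meanCurvature (X ν : M → E (n + 1)) (x : M) : ℝ :=
  ∑ i, secondForm X ν x (frame X x i) (frame X x i)

/-- The squared norm `|A|²`. -/
def normSqA (X ν : M → E (n + 1)) (x : M) : ℝ :=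
  ∑ i, ∑ j, secondForm X ν x (frame X x i) (frame X x j) ^ 2

/-- The Weingarten map at `x`, as an endomorphism of the ambient space: it maps `dX v` to `dν v`
and the normal line to `0`. -/
def ambientWeingarten (X ν : M → E (n + 1)) (x : M) : E (n + 1) →L[ℝ] E (n + 1) :=
  ∑ k, (innerSL ℝ (diff X x (frame X x k))).smulRight (diff ν x (frame X x k))

/-- The covariant derivative `(∇_v A)(w, z)` at `x`, for the Levi-Civita connection of the induced
metric, that is `∇_v Y = (D_v Y)ᵀ`, the tangential part of the derivative in `ℝⁿ⁺¹`.

With `S` the ambient Weingarten map, `A(Y, Z) = ⟨S Y, Z⟩` for tangent fields `Y`, `Z`, viewed as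
maps to `ℝⁿ⁺¹`. As `S` kills normal vectors and has tangential values, the product rule gives
`⟨(D_v S) Y, Z⟩ = v(A(Y, Z)) - A(∇_v Y, Z) - A(Y, ∇_v Z)`. -/
def covDerivA (X ν : M → E (n + 1)) (x : M) (v w z : E n) : ℝ :=
  let DS : E n →L[ℝ] (E (n + 1) →L[ℝ] E (n + 1)) :=
    mfderiv (𝓡 n) 𝓘(ℝ, E (n + 1) →L[ℝ] E (n + 1)) (ambientWeingarten X ν) x
  inner ℝ (DS v (diff X x w)) (diff X x z)

/-- The squared norm `|∇A|²`. -/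
def normSqGradA (X ν : M → E (n + 1)) (x : M) : ℝ :=
  ∑ k, ∑ i, ∑ j, covDerivA X ν x (frame X x k) (frame X x i) (frame X x j) ^ 2

/-! ### The induced measure and weak gradients -/

/-- The immersion in the preferred chart at `p`, defined on the target of that chart. -/
def param (X : M → E (n + 1)) (p : M) (z : E n) : E (n + 1) :=
  X ((chartAt (E n) p).symm z)

/-- The Gram matrix `g_ij` of the induced metric in the chart at `p`. -/
def gram (X : M → E (n + 1)) (p : M) (z : E n) : Matrix (Fin n) (Fin n) ℝ :=
  Matrix.of fun i j =>
    inner ℝ (fderiv ℝ (param X p) z (EuclideanSpace.single i 1))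
      (fderiv ℝ (param X p) z (EuclideanSpace.single j 1))

variable [MeasurableSpace M]

/-- The Riemannian measure `√(det g) dz` on the domain of the chart at `p`, extended by zero. -/
def chartMeasure (X : M → E (n + 1)) (p : M) : Measure M :=
  Measure.map (chartAt (E n) p).symm
    ((volume.restrict (chartAt (E n) p).target).withDensity
      fun z => ENNReal.ofReal (Real.sqrt (gram X p z).det))

/-- The measure `μ` on `M` induced by `X`: the least measure that dominates all the
`chartMeasure X p`. These agree on the overlaps of the charts, so that `μ` restricts to
`chartMeasure X p` on the domain of the chart at `p`. -/
def inducedMeasure (X : M → E (n + 1)) : Measure M := ⨆ p : M, chartMeasure X p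

/-- `u ∈ W^{1,1}(M)`, with weak gradient `G`. The gradient is a tangent field, given as a map to
`ℝⁿ⁺¹`; in a chart, the weak derivative of `u` in the direction `v` is `⟨G, ∂_v X⟩`. -/
structure IsW11WithGradient (X : M → E (n + 1)) (u : M → ℝ) (G : M → E (n + 1)) : Prop where
  integrable : Integrable u (inducedMeasure X)
  integrable_grad : Integrable G (inducedMeasure X)
  tangential : ∀ᵐ x ∂(inducedMeasure X), ∃ v, G x = diff X x v
  weak_deriv : ∀ (p : M) (η : E n → ℝ), ContDiff ℝ ∞ η → HasCompactSupport η →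
    tsupport η ⊆ (chartAt (E n) p).target → ∀ v : E n,
      ∫ z, u ((chartAt (E n) p).symm z) * fderiv ℝ η z v
        = - ∫ z, inner ℝ (G ((chartAt (E n) p).symm z)) (fderiv ℝ (param X p) z v) * η z

end Geometry

end HypersurfacePoincare

end

/-!
Let `S` be the ambient Weingarten map, extended by zero to the normal line, let `D` be its tangential
derivative, and let `e` be an orthonormal basis of `ℝⁿ⁺¹`. The tangent field
`U = ∑ b, (S D_b S² - S² D_b S) e_b` is linear in `D`, so its divergence contains second derivatives
of `S`, but only antisymmetrised ones, and these cancel by the symmetry of the tangential Hessian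
(`sum_second_deriv_eq_zero`). The rest is quadratic in `D`. The normal components of `D` are
determined by `S`, and the curvature terms of Simons' identity appear through them:
`div U = tr S² tr S⁴ - (tr S³)² + O(|∇A|² |A|²)` (`IsCurvatureJet.divExpr_eq`,
`IsCurvatureJet.abs_covExpr_le`).

The discriminant `tr S² tr S⁴ - (tr S³)²` is the defect in a Cauchy-Schwarz inequality. It vanishes
only if `S² = a S`, which for matrices of positive trace means that the matrix is cylindrical. Since
the closure of the cone `Γ` contains no cylindrical points, compactness gives
`c |A|² H⁴ ≤ tr S² tr S⁴ - (tr S³)²` and `|A| ≤ C H` wherever `u ≠ 0` (`exists_cone_bounds`).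

Integrating `u² div (H⁻⁴ U)` by parts (`integral_mul_tdiv`) bounds `∫ u² |A|²` by a multiple of
`∫ u² |∇A|² / H² + ∫ |u| |∇u| |∇A| / H`, and Young's inequality gives the claim. To make this
rigorous, `H⁻⁴` is replaced by `(H² + ε)⁻²`, which is smooth on all of `M`, and `u²` by
`(u / (1 + ε u²))²`, to which the chain rule for weak derivatives applies (`weak_chain_rule`, by
mollification). The limit `ε → 0` is Fatou's lemma (`lintegral_sq_mul_normSqA_le`).

Derivatives along the hypersurface are expressed with the pseudoinverse of `dX`
(`tgrad X f = df ∘ (dX)⁺`), so that all tensors are functions with values in spaces of linear maps of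
`ℝⁿ⁺¹` and no choice of frames has to be differentiated.
-/

open MeasureTheory
open scoped Manifold ContDiff

noncomputable section

namespace HypersurfacePoincare

set_option linter.unusedSectionVars false

/-! ### Linear algebra of the Weingarten map at a point -/

section Jet

open scoped InnerProductSpace

variable {F ι : Type*} [NormedAddCommGroup F] [InnerProductSpace ℝ F] [Fintype ι]

/-- The pointwise relations between a unit normal `ν`, the ambient Weingarten map `S` and its
tangential derivative `D`, where `D a` is the derivative of `S` in the direction of the tangential
part of `a`. -/
structure IsCurvatureJet (ν : F) (S : F →L[ℝ] F) (D : F →L[ℝ] F →L[ℝ] F) : Prop where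
  unit : ‖ν‖ = 1
  symm : ∀ v w, ⟪S v, w⟫_ℝ = ⟪v, S w⟫_ℝ
  map_normal : S ν = 0
  deriv_symm : ∀ a v w, ⟪D a v, w⟫_ℝ = ⟪v, D a w⟫_ℝ
  deriv_map_normal : ∀ a, D a ν = -S (S a)
  deriv_normal : D ν = 0

/-- The tangential part of the derivative of the Weingarten map, that is the covariant derivative
of the second fundamental form with one index raised, extended by zero to normal vectors. -/
def covPart (ν : F) (S : F →L[ℝ] F) (D : F →L[ℝ] F →L[ℝ] F) (a v : F) : F :=
  D a v + ⟪ν, v⟫_ℝ • S (S a) + ⟪S (S a), v⟫_ℝ • ν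

namespace IsCurvatureJet

variable {ν : F} {S : F →L[ℝ] F} {D : F →L[ℝ] F →L[ℝ] F}

lemma deriv_eq (ν : F) (S : F →L[ℝ] F) (D : F →L[ℝ] F →L[ℝ] F) (a v : F) :
    D a v = covPart ν S D a v - ⟪ν, v⟫_ℝ • S (S a) - ⟪S (S a), v⟫_ℝ • ν := by
  simp only [covPart]; abel

lemma inner_normal_map (h : IsCurvatureJet ν S D) (v : F) : ⟪ν, S v⟫_ℝ = 0 := by
  rw [← h.symm, h.map_normal, inner_zero_left]

lemma inner_map_normal (h : IsCurvatureJet ν S D) (v : F) : ⟪S v, ν⟫_ℝ = 0 := by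
  rw [h.symm, h.map_normal, inner_zero_right]

lemma inner_normal_self (h : IsCurvatureJet ν S D) : ⟪ν, ν⟫_ℝ = 1 := by
  rw [real_inner_self_eq_norm_sq, h.unit]; norm_num

lemma covPart_normal (h : IsCurvatureJet ν S D) (a : F) : covPart ν S D a ν = 0 := by
  simp [covPart, h.deriv_map_normal, h.inner_map_normal, h.unit]

lemma covPart_normal_left (h : IsCurvatureJet ν S D) (v : F) : covPart ν S D ν v = 0 := by
  simp [covPart, h.deriv_normal, h.map_normal]

lemma covPart_symm (h : IsCurvatureJet ν S D) (a v w : F) :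
    ⟪covPart ν S D a v, w⟫_ℝ = ⟪v, covPart ν S D a w⟫_ℝ := by
  simp only [covPart, inner_add_left, inner_add_right, inner_smul_left, inner_smul_right,
    h.deriv_symm, real_inner_comm v]
  simp
  ring

lemma inner_normal_covPart (h : IsCurvatureJet ν S D) (a v : F) :
    ⟪ν, covPart ν S D a v⟫_ℝ = 0 := by
  rw [← h.covPart_symm, h.covPart_normal, inner_zero_left]

/-- The contraction of `covPart` with `ν` in the direction of differentiation vanishes. -/
lemma sum_inner_covPart (h : IsCurvatureJet ν S D) (E : OrthonormalBasis ι ℝ F) (v : F) :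
    ∑ b, ⟪ν, E b⟫_ℝ • covPart ν S D (E b) v = 0 := by
  have h1 : covPart ν S D (∑ b, ⟪ν, E b⟫_ℝ • E b) v =
      ∑ b, ⟪ν, E b⟫_ℝ • covPart ν S D (E b) v := by
    simp only [covPart, map_sum, map_smul, smul_add, Finset.sum_add_distrib, sum_inner,
      inner_smul_left, Finset.smul_sum, Finset.sum_smul, sum_apply,
      smul_apply, smul_smul]
    simp [mul_comm]
  have h2 : ∑ b, ⟪ν, E b⟫_ℝ • E b = ν := by
    conv_rhs => rw [← E.sum_repr' ν]
    simp [real_inner_comm]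
  rw [← h1, h2, h.covPart_normal_left]

lemma sum_inner_smul_basis (E : OrthonormalBasis ι ℝ F) (T : F →L[ℝ] F) (v : F) :
    ∑ b, ⟪v, E b⟫_ℝ • T (E b) = T v := by
  conv_rhs => rw [← E.sum_repr' v]
  simp [real_inner_comm]

lemma sum_deriv_basis (h : IsCurvatureJet ν S D) (E : OrthonormalBasis ι ℝ F) :
    ∑ a, D (E a) (E a) =
      ∑ a, covPart ν S D (E a) (E a) - (∑ a, ⟪S (E a), S (E a)⟫_ℝ) • ν := by
  simp only [deriv_eq ν S D, Finset.sum_sub_distrib, Finset.sum_smul, h.symm (S _)]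
  have := sum_inner_smul_basis E (S ∘L S) ν
  simp only [ContinuousLinearMap.comp_apply, h.map_normal, map_zero] at this
  rw [this]; simp

lemma deriv_map (h : IsCurvatureJet ν S D) (a v : F) :
    D a (S v) = covPart ν S D a (S v) - ⟪S (S a), S v⟫_ℝ • ν := by
  rw [deriv_eq ν S D, h.inner_normal_map]; simp

lemma map_deriv (h : IsCurvatureJet ν S D) (a v : F) :
    S (D a v) = S (covPart ν S D a v) - ⟪ν, v⟫_ℝ • S (S (S a)) := by
  rw [deriv_eq ν S D]; simp [h.map_normal]

/-- The quadratic expression in the first derivatives of the Weingarten map to which the divergence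
of the field `∑ b, (S D_b S² - S² D_b S) e_b` reduces when the second derivatives cancel. -/
def divExpr (E : OrthonormalBasis ι ℝ F) (S : F →L[ℝ] F) (D : F →L[ℝ] F →L[ℝ] F) : ℝ :=
  ∑ a, ∑ b, ⟪E a, D (E a) (D (E b) (S (S (E b))))
      + S (D (E b) (D (E a) (S (E b)) + S (D (E a) (E b))))
      - (D (E a) (S (D (E b) (S (E b)))) + S (D (E a) (D (E b) (S (E b)))))
      - S (S (D (E b) (D (E a) (E b))))⟫_ℝ

/-- The part of `divExpr` that is quadratic in the covariant derivative. -/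
def covExpr (E : OrthonormalBasis ι ℝ F) (S : F →L[ℝ] F) (w : F → F → F) : ℝ :=
  ⟪∑ a, w (E a) (E a), ∑ b, w (E b) (S (S (E b)))⟫_ℝ
    + ∑ a, ∑ b, ⟪w (E b) (S (E a)), w (E a) (S (E b)) + S (w (E a) (E b))⟫_ℝ
    - ⟪∑ a, (w (E a) (S (E a)) + S (w (E a) (E a))), ∑ b, w (E b) (S (E b))⟫_ℝ
    - ∑ a, ∑ b, ⟪w (E b) (S (S (E a))), w (E a) (E b)⟫_ℝ

/-- The normal components of the derivative of the Weingarten map are determined by the Weingarten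
map itself, and their contribution to `divExpr` is `tr S² tr S⁴ - (tr S³)²`. -/
lemma divExpr_eq (h : IsCurvatureJet ν S D) (E : OrthonormalBasis ι ℝ F) :
    divExpr E S D =
      (∑ a, ⟪S (E a), S (E a)⟫_ℝ) * (∑ a, ⟪S (S (E a)), S (S (E a))⟫_ℝ)
        - (∑ a, ⟪S (S (E a)), S (E a)⟫_ℝ) ^ 2 + covExpr E S (covPart ν S D) := by
  set w := covPart ν S D with hw
  have hsplit : divExpr E S D = ⟪∑ a, D (E a) (E a), ∑ b, D (E b) (S (S (E b)))⟫_ℝ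
      + ∑ a, ∑ b, ⟪D (E b) (S (E a)), D (E a) (S (E b)) + S (D (E a) (E b))⟫_ℝ
      - ⟪∑ a, (D (E a) (S (E a)) + S (D (E a) (E a))), ∑ b, D (E b) (S (E b))⟫_ℝ
      - ∑ a, ∑ b, ⟪D (E b) (S (S (E a))), D (E a) (E b)⟫_ℝ := by
    have e (a b : ι) : ⟪E a, D (E a) (D (E b) (S (S (E b))))
        + S (D (E b) (D (E a) (S (E b)) + S (D (E a) (E b))))
        - (D (E a) (S (D (E b) (S (E b)))) + S (D (E a) (D (E b) (S (E b)))))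
        - S (S (D (E b) (D (E a) (E b))))⟫_ℝ =
        ⟪D (E a) (E a), D (E b) (S (S (E b)))⟫_ℝ
        + ⟪D (E b) (S (E a)), D (E a) (S (E b)) + S (D (E a) (E b))⟫_ℝ
        - ⟪D (E a) (S (E a)) + S (D (E a) (E a)), D (E b) (S (E b))⟫_ℝ
        - ⟪D (E b) (S (S (E a))), D (E a) (E b)⟫_ℝ := by
      simp only [inner_sub_right, inner_add_right, inner_add_left, map_add, h.deriv_symm, h.symm]
      ring
    simp only [divExpr, e, Finset.sum_sub_distrib, Finset.sum_add_distrib, ← inner_sum, ← sum_inner]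
  rw [hsplit]
  have t1 : ⟪∑ a, D (E a) (E a), ∑ b, D (E b) (S (S (E b)))⟫_ℝ =
      (∑ a, ⟪S (E a), S (E a)⟫_ℝ) * (∑ a, ⟪S (S (E a)), S (S (E a))⟫_ℝ)
      + ⟪∑ a, w (E a) (E a), ∑ b, w (E b) (S (S (E b)))⟫_ℝ := by
    rw [h.sum_deriv_basis]
    simp only [h.deriv_map, Finset.sum_sub_distrib, ← Finset.sum_smul, ← hw]
    rw [inner_sub_left, inner_sub_right, inner_sub_right, inner_smul_left, inner_smul_right,
      inner_smul_left, inner_smul_right, h.inner_normal_self]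
    have e1 : ⟪ν, ∑ b, w (E b) (S (S (E b)))⟫_ℝ = 0 := by
      simp [inner_sum, hw, h.inner_normal_covPart]
    have e2 : ⟪∑ a, w (E a) (E a), ν⟫_ℝ = 0 := by
      rw [real_inner_comm]; simp [inner_sum, hw, h.inner_normal_covPart]
    rw [e1, e2]; simp; ring
  have t2 : ∑ a, ∑ b, ⟪D (E b) (S (E a)), D (E a) (S (E b)) + S (D (E a) (E b))⟫_ℝ =
      (∑ a, ⟪S (S (S (E a))), S (S (S (E a)))⟫_ℝ)
      + ∑ a, ∑ b, ⟪w (E b) (S (E a)), w (E a) (S (E b)) + S (w (E a) (E b))⟫_ℝ := by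
    rw [← Finset.sum_add_distrib]
    refine Finset.sum_congr rfl fun a _ => ?_
    have e0 : ∑ b, ⟪ν, E b⟫_ℝ * ⟪w (E b) (S (E a)), S (S (S (E a)))⟫_ℝ = 0 := by
      have := congrArg (fun z => ⟪z, S (S (S (E a)))⟫_ℝ) (h.sum_inner_covPart E (S (E a)))
      simpa [sum_inner, inner_smul_left] using this
    have e1 : ∑ b, ⟪S (S (E b)), S (E a)⟫_ℝ * ⟪S (S (E a)), S (E b)⟫_ℝ =
        ⟪S (S (S (E a))), S (S (S (E a)))⟫_ℝ := by
      rw [← E.sum_inner_mul_inner (S (S (S (E a)))) (S (S (S (E a))))]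
      refine Finset.sum_congr rfl fun b _ => ?_
      rw [h.symm (S (E b)), h.symm (E b), ← h.symm (S (S (E a))) (E b), mul_comm]
    rw [← e1, ← sub_eq_zero, ← Finset.sum_add_distrib, ← Finset.sum_sub_distrib, ← neg_zero, ← e0,
      ← Finset.sum_neg_distrib]
    refine Finset.sum_congr rfl fun b _ => ?_
    rw [h.deriv_map, h.deriv_map, h.map_deriv, ← hw]
    simp only [inner_sub_left, inner_sub_right, inner_add_right, inner_smul_left,
      inner_smul_right, h.inner_normal_self, h.inner_normal_map]
    have e3 : ⟪ν, w (E a) (S (E b))⟫_ℝ = 0 := h.inner_normal_covPart _ _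
    have e4 : ⟪w (E b) (S (E a)), ν⟫_ℝ = 0 := by
      rw [real_inner_comm]; exact h.inner_normal_covPart _ _
    rw [e3, e4]; simp; ring
  have t3 : ⟪∑ a, (D (E a) (S (E a)) + S (D (E a) (E a))), ∑ b, D (E b) (S (E b))⟫_ℝ =
      (∑ a, ⟪S (S (E a)), S (E a)⟫_ℝ) ^ 2
      + ⟪∑ a, (w (E a) (S (E a)) + S (w (E a) (E a))), ∑ b, w (E b) (S (E b))⟫_ℝ := by
    have e0 : ∑ a, ⟪ν, E a⟫_ℝ • S (S (S (E a))) = 0 := by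
      have := sum_inner_smul_basis E (S ∘L S ∘L S) ν
      simpa [h.map_normal] using this
    have e2 : ∑ a, (D (E a) (S (E a)) + S (D (E a) (E a))) =
        ∑ a, (w (E a) (S (E a)) + S (w (E a) (E a))) -
          (∑ a, ⟪S (S (E a)), S (E a)⟫_ℝ) • ν := by
      simp only [h.deriv_map, h.map_deriv, Finset.sum_add_distrib, Finset.sum_sub_distrib, e0,
        ← Finset.sum_smul, ← hw]
      abel
    rw [e2]
    simp only [h.deriv_map, Finset.sum_sub_distrib, ← Finset.sum_smul, ← hw]
    rw [inner_sub_left, inner_sub_right, inner_sub_right, inner_smul_left, inner_smul_right,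
      inner_smul_left, inner_smul_right, h.inner_normal_self]
    have e1 : ⟪ν, ∑ b, w (E b) (S (E b))⟫_ℝ = 0 := by
      simp [inner_sum, hw, h.inner_normal_covPart]
    have e2 : ⟪∑ a, (w (E a) (S (E a)) + S (w (E a) (E a))), ν⟫_ℝ = 0 := by
      rw [real_inner_comm]
      simp [inner_sum, inner_add_right, hw, h.inner_normal_covPart, h.inner_normal_map]
    rw [e1, e2]; simp; ring
  have t4 : ∑ a, ∑ b, ⟪D (E b) (S (S (E a))), D (E a) (E b)⟫_ℝ =
      (∑ a, ⟪S (S (S (E a))), S (S (S (E a)))⟫_ℝ)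
      + ∑ a, ∑ b, ⟪w (E b) (S (S (E a))), w (E a) (E b)⟫_ℝ := by
    rw [← Finset.sum_add_distrib]
    refine Finset.sum_congr rfl fun a _ => ?_
    have e0 : ∑ b, ⟪ν, E b⟫_ℝ * ⟪w (E b) (S (S (E a))), S (S (E a))⟫_ℝ = 0 := by
      have := congrArg (fun z => ⟪z, S (S (E a))⟫_ℝ) (h.sum_inner_covPart E (S (S (E a))))
      simpa [sum_inner, inner_smul_left] using this
    have e1 : ∑ b, ⟪S (S (E b)), S (S (E a))⟫_ℝ * ⟪S (S (E a)), E b⟫_ℝ =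
        ⟪S (S (S (E a))), S (S (S (E a)))⟫_ℝ := by
      rw [← h.symm (S (S (S (E a)))) (S (S (E a))),
        ← E.sum_inner_mul_inner (S (S (S (S (E a))))) (S (S (E a)))]
      refine Finset.sum_congr rfl fun b _ => ?_
      rw [h.symm (S (E b)), h.symm (E b), real_inner_comm (E b), real_inner_comm (E b)]
    rw [← e1, ← sub_eq_zero, ← Finset.sum_add_distrib, ← Finset.sum_sub_distrib, ← neg_zero, ← e0,
      ← Finset.sum_neg_distrib]
    refine Finset.sum_congr rfl fun b _ => ?_
    rw [h.deriv_map, deriv_eq ν S D (E a), ← hw]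
    simp only [inner_sub_left, inner_sub_right, inner_smul_left,
      inner_smul_right, h.inner_normal_self, h.inner_normal_map]
    have e3 : ⟪ν, w (E a) (E b)⟫_ℝ = 0 := h.inner_normal_covPart _ _
    have e4 : ⟪w (E b) (S (S (E a))), ν⟫_ℝ = 0 := by
      rw [real_inner_comm]; exact h.inner_normal_covPart _ _
    rw [e3, e4]; simp; ring
  rw [t1, t2, t3, t4, covExpr]
  ring

lemma norm_sum_basis_le (E : OrthonormalBasis ι ℝ F) {f : F → F} {c : ℝ}
    (hf : ∀ a, ‖a‖ = 1 → ‖f a‖ ≤ c) : ‖∑ a, f (E a)‖ ≤ Fintype.card ι * c := by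
  refine (norm_sum_le _ _).trans ((Finset.sum_le_card_nsmul _ _ c fun a _ => hf _ (by simp)).trans ?_)
  simp

/-- The bound of `covExpr` by `|S|² |∇A|²`. -/
lemma abs_covExpr_le (E : OrthonormalBasis ι ℝ F) (S : F →L[ℝ] F) (w : F → F → F) {c s : ℝ}
    (hc : 0 ≤ c) (hs : 0 ≤ s) (hw : ∀ a v, ‖a‖ = 1 → ‖w a v‖ ≤ c * ‖v‖)
    (hS : ∀ v, ‖S v‖ ≤ s * ‖v‖) :
    |covExpr E S w| ≤ 6 * (Fintype.card ι : ℝ) ^ 2 * (c ^ 2 * s ^ 2) := by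
  set N := (Fintype.card ι : ℝ)
  have hN : 0 ≤ N := by positivity
  have b1 (a v : F) (ha : ‖a‖ = 1) (hv : ‖v‖ = 1) : ‖w a v‖ ≤ c := by
    simpa [hv] using hw a v ha
  have b2 (v : F) (hv : ‖v‖ = 1) : ‖S v‖ ≤ s := by simpa [hv] using hS v
  have b3 (v : F) (hv : ‖v‖ = 1) : ‖S (S v)‖ ≤ s * s :=
    (hS _).trans (by gcongr; exact b2 v hv)
  have b4 (a v : F) (ha : ‖a‖ = 1) (hv : ‖v‖ = 1) : ‖w a (S v)‖ ≤ c * s :=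
    (hw _ _ ha).trans (by gcongr; exact b2 v hv)
  have b5 (a v : F) (ha : ‖a‖ = 1) (hv : ‖v‖ = 1) : ‖w a (S (S v))‖ ≤ c * (s * s) :=
    (hw _ _ ha).trans (by gcongr; exact b3 v hv)
  have b6 (a v : F) (ha : ‖a‖ = 1) (hv : ‖v‖ = 1) : ‖S (w a v)‖ ≤ s * c :=
    (hS _).trans (by gcongr; exact b1 a v ha hv)
  have hE (a : ι) : ‖E a‖ = 1 := by simp
  have dsum (f : ι → ι → ℝ) (k : ℝ) (hf : ∀ a b, |f a b| ≤ k) :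
      |∑ a, ∑ b, f a b| ≤ N ^ 2 * k := by
    calc |∑ a, ∑ b, f a b| ≤ ∑ a, ∑ b, |f a b| :=
          (Finset.abs_sum_le_sum_abs _ _).trans
            (Finset.sum_le_sum fun a _ => Finset.abs_sum_le_sum_abs _ _)
      _ ≤ ∑ _a : ι, ∑ _b : ι, k := Finset.sum_le_sum fun a _ => Finset.sum_le_sum fun b _ => hf a b
      _ = N ^ 2 * k := by simp [N]; ring
  have k1 : |⟪∑ a, w (E a) (E a), ∑ b, w (E b) (S (S (E b)))⟫_ℝ| ≤ N ^ 2 * (c ^ 2 * s ^ 2) := by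
    refine (abs_real_inner_le_norm _ _).trans ?_
    calc _ ≤ (N * c) * (N * (c * (s * s))) := by
          gcongr
          · exact norm_sum_basis_le E (f := fun a => w a a) fun a ha => b1 a a ha ha
          · exact norm_sum_basis_le E (f := fun a => w a (S (S a))) fun a ha => b5 a a ha ha
      _ = _ := by ring
  have k2 : |∑ a, ∑ b, ⟪w (E b) (S (E a)), w (E a) (S (E b)) + S (w (E a) (E b))⟫_ℝ| ≤
      N ^ 2 * (2 * (c ^ 2 * s ^ 2)) := by
    refine dsum _ _ fun a b => (abs_real_inner_le_norm _ _).trans ?_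
    calc _ ≤ (c * s) * (c * s + s * c) := by
          gcongr
          · exact b4 _ _ (hE _) (hE _)
          · exact (norm_add_le _ _).trans (add_le_add (b4 _ _ (hE _) (hE _))
              (b6 _ _ (hE _) (hE _)))
      _ = _ := by ring
  have k3 : |⟪∑ a, (w (E a) (S (E a)) + S (w (E a) (E a))), ∑ b, w (E b) (S (E b))⟫_ℝ| ≤
      N ^ 2 * (2 * (c ^ 2 * s ^ 2)) := by
    refine (abs_real_inner_le_norm _ _).trans ?_
    calc _ ≤ (N * (c * s + s * c)) * (N * (c * s)) := by
          gcongr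
          · exact norm_sum_basis_le E (f := fun a => w a (S a) + S (w a a)) fun a ha =>
              (norm_add_le _ _).trans (add_le_add (b4 _ _ ha ha) (b6 _ _ ha ha))
          · exact norm_sum_basis_le E (f := fun a => w a (S a)) fun a ha => b4 a a ha ha
      _ = _ := by ring
  have k4 : |∑ a, ∑ b, ⟪w (E b) (S (S (E a))), w (E a) (E b)⟫_ℝ| ≤ N ^ 2 * (c ^ 2 * s ^ 2) := by
    refine dsum _ _ fun a b => (abs_real_inner_le_norm _ _).trans ?_
    calc _ ≤ (c * (s * s)) * c := by
          gcongr
          · exact b5 _ _ (hE _) (hE _)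
          · exact b1 _ _ (hE _) (hE _)
      _ = _ := by ring
  rw [covExpr]
  rw [abs_le] at *
  constructor <;> linarith [k1.1, k1.2, k2.1, k2.2, k3.1, k3.2, k4.1, k4.2]

/-- The field `∑ b, (S D_b S² - S² D_b S) e_b`, which does not depend on the orthonormal basis. Its
divergence is computed in `divExpr_eq`. -/
def testField (E : OrthonormalBasis ι ℝ F) (S : F →L[ℝ] F) (D : F →L[ℝ] F →L[ℝ] F) : F :=
  ∑ b, (S (D (E b) (S (S (E b)))) - S (S (D (E b) (S (E b)))))

lemma inner_normal_testField (h : IsCurvatureJet ν S D) (E : OrthonormalBasis ι ℝ F) :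
    ⟪ν, testField E S D⟫_ℝ = 0 := by
  simp [testField, inner_sum, inner_sub_right, h.inner_normal_map]

/-- The normal components of `D` cancel in the test field, which is therefore bounded by the
covariant derivative. -/
lemma norm_testField_le (h : IsCurvatureJet ν S D) (E : OrthonormalBasis ι ℝ F) {c s : ℝ}
    (hc : 0 ≤ c) (hs : 0 ≤ s) (hw : ∀ a v, ‖a‖ = 1 → ‖covPart ν S D a v‖ ≤ c * ‖v‖)
    (hS : ∀ v, ‖S v‖ ≤ s * ‖v‖) :
    ‖testField E S D‖ ≤ Fintype.card ι * (2 * (c * s ^ 3)) := by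
  have e (b : F) : S (D b (S (S b))) - S (S (D b (S b))) =
      S (covPart ν S D b (S (S b))) - S (S (covPart ν S D b (S b))) := by
    rw [h.map_deriv, h.map_deriv, h.inner_normal_map, h.inner_normal_map]; simp
  refine norm_sum_basis_le E (f := fun b => S (D b (S (S b))) - S (S (D b (S b)))) fun b hb => ?_
  have b2 (v : F) (hv : ‖v‖ = 1) : ‖S v‖ ≤ s := by simpa [hv] using hS v
  have b3 (v : F) (hv : ‖v‖ = 1) : ‖S (S v)‖ ≤ s * s :=
    (hS _).trans (by gcongr; exact b2 v hv)
  simp only [e]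
  refine (norm_sub_le _ _).trans ?_
  have k1 : ‖S (covPart ν S D b (S (S b)))‖ ≤ s * (c * (s * s)) :=
    (hS _).trans (by gcongr; exact (hw _ _ hb).trans (by gcongr; exact b3 b hb))
  have k2 : ‖S (S (covPart ν S D b (S b)))‖ ≤ s * (s * (c * s)) :=
    (hS _).trans (by
      gcongr; exact (hS _).trans (by gcongr; exact (hw _ _ hb).trans (by gcongr; exact b2 b hb)))
  linarith

/-- The derivative of the trace of the Weingarten map only involves the covariant derivative. -/
lemma sum_inner_deriv (h : IsCurvatureJet ν S D) (E : OrthonormalBasis ι ℝ F) (a : F) :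
    ∑ b, ⟪E b, D a (E b)⟫_ℝ = ∑ b, ⟪E b, covPart ν S D a (E b)⟫_ℝ := by
  have e : ∑ b, ⟪ν, E b⟫_ℝ * ⟪S (S a), E b⟫_ℝ = 0 := by
    have := E.sum_inner_mul_inner ν (S (S a))
    rw [h.inner_normal_map] at this
    simpa [real_inner_comm] using this
  rw [← sub_eq_zero, ← Finset.sum_sub_distrib, ← neg_zero, ← mul_zero 2, ← e, Finset.mul_sum,
    ← Finset.sum_neg_distrib]
  refine Finset.sum_congr rfl fun b _ => ?_
  rw [covPart, inner_add_right, inner_add_right, inner_smul_right, inner_smul_right,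
    real_inner_comm ν, real_inner_comm (S (S a)) (E b)]
  ring

lemma abs_sum_inner_deriv_le (h : IsCurvatureJet ν S D) (E : OrthonormalBasis ι ℝ F) {c : ℝ}
    (hw : ∀ a v, ‖covPart ν S D a v‖ ≤ c * ‖a‖ * ‖v‖) (a : F) :
    |∑ b, ⟪E b, D a (E b)⟫_ℝ| ≤ Fintype.card ι * (c * ‖a‖) := by
  rw [h.sum_inner_deriv]
  refine (Finset.abs_sum_le_sum_abs _ _).trans
    ((Finset.sum_le_card_nsmul _ _ (c * ‖a‖) fun b _ => ?_).trans (by simp))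
  refine (abs_real_inner_le_norm _ _).trans ?_
  simpa using hw a (E b)

end IsCurvatureJet

end Jet

/-! ### The cone of curvatures -/

section Cone

variable {n : ℕ}

/-- The discriminant `tr W² tr W⁴ - (tr W³)²` of a symmetric matrix, half of
`∑ (λᵢ λⱼ (λᵢ - λⱼ))²` in terms of the eigenvalues. -/
def discr (W : Matrix (Fin n) (Fin n) ℝ) : ℝ :=
  (∑ i, ∑ j, W i j ^ 2) * (∑ i, ∑ j, (W * W) i j ^ 2) - (∑ i, ∑ j, (W * W) i j * W i j) ^ 2

/-- The discriminant is `|W|²` times the squared distance of `W²` to the multiples of `W`. -/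
lemma discr_eq_mul (W : Matrix (Fin n) (Fin n) ℝ) (h : ∑ i, ∑ j, W i j ^ 2 ≠ 0) :
    discr W = (∑ i, ∑ j, W i j ^ 2) * ∑ i, ∑ j, ((W * W) i j -
      (∑ i, ∑ j, (W * W) i j * W i j) / (∑ i, ∑ j, W i j ^ 2) * W i j) ^ 2 := by
  set a := (∑ i, ∑ j, (W * W) i j * W i j) / (∑ i, ∑ j, W i j ^ 2) with ha
  have e : ∑ i, ∑ j, ((W * W) i j - a * W i j) ^ 2 =
      (∑ i, ∑ j, (W * W) i j ^ 2) - 2 * a * (∑ i, ∑ j, (W * W) i j * W i j)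
        + a ^ 2 * ∑ i, ∑ j, W i j ^ 2 := by
    simp only [Finset.mul_sum, ← Finset.sum_sub_distrib, ← Finset.sum_add_distrib]
    refine Finset.sum_congr rfl fun i _ => Finset.sum_congr rfl fun j _ => ?_
    ring
  rw [e, discr, ha]
  field_simp
  ring

lemma isSymm_coe (W : SymMat n) (i j : Fin n) :
    (W : Matrix (Fin n) (Fin n) ℝ) i j = (W : Matrix (Fin n) (Fin n) ℝ) j i := by
  have h : star (W : Matrix (Fin n) (Fin n) ℝ) = W := W.2
  conv_lhs => rw [← h]
  simp [Matrix.star_apply]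

lemma sq_sum_pos {W : SymMat n} (hW : W ≠ 0) :
    0 < ∑ i, ∑ j, (W : Matrix (Fin n) (Fin n) ℝ) i j ^ 2 := by
  refine lt_of_le_of_ne (by positivity) fun h => hW ?_
  rw [eq_comm, Finset.sum_eq_zero_iff_of_nonneg (fun i _ => by positivity)] at h
  ext i j
  have := (Finset.sum_eq_zero_iff_of_nonneg (fun j _ => by positivity)).1 (h i (by simp)) j (by simp)
  simpa using this

/-- A nonzero symmetric matrix of positive trace with `W² = a W` is cylindrical. -/
lemma mem_Cyl_of_mul_self {W : SymMat n} (hW : W ≠ 0) (htr : 0 < tr W) {a : ℝ}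
    (h : (W : Matrix (Fin n) (Fin n) ℝ) * W = a • (W : Matrix (Fin n) (Fin n) ℝ)) : W ∈ Cyl n := by
  set A := (W : Matrix (Fin n) (Fin n) ℝ) with hA
  have ha : 0 < a := by
    have h1 : (A * A).trace = a * A.trace := by rw [h]; simp
    have h2 : (A * A).trace = ∑ i, ∑ j, A i j ^ 2 := by
      simp only [Matrix.trace, Matrix.diag, Matrix.mul_apply]
      refine Finset.sum_congr rfl fun i _ => Finset.sum_congr rfl fun j _ => ?_
      rw [hA, isSymm_coe W j i]; ring
    have h3 := sq_sum_pos hW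
    rw [← hA, ← h2, h1] at h3
    exact (mul_pos_iff_of_pos_right htr).1 h3
  set T := Matrix.toLin' A with hT
  have hTT (v) : T (T v) = a • T v := by
    have : T ∘ₗ T = a • T := by rw [hT, ← Matrix.toLin'_mul, h]; simp
    exact congrArg (fun f => f v) this
  have e0 : Module.End.eigenspace T 0 = LinearMap.ker T := by
    ext v; simp
  have e1 : Module.End.eigenspace T a = LinearMap.range T := by
    ext v
    rw [Module.End.mem_eigenspace_iff]
    constructor
    · intro hv
      refine ⟨a⁻¹ • v, ?_⟩
      rw [map_smul, hv, smul_smul, inv_mul_cancel₀ ha.ne', one_smul]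
    · rintro ⟨w, rfl⟩
      exact hTT w
  have hr := LinearMap.finrank_range_add_finrank_ker T
  have hn : Module.finrank ℝ (Fin n → ℝ) = n := by simp
  have hpos : 0 < Module.finrank ℝ (LinearMap.range T) := by
    rw [Module.finrank_pos_iff, ← not_subsingleton_iff_nontrivial,
      Submodule.subsingleton_iff_eq_bot, LinearMap.range_eq_bot]
    intro h0
    have : A = 0 := by simpa [hT] using h0
    exact hW (Subtype.ext this)
  rw [hn] at hr
  simp only [Cyl, Set.mem_iUnion, Finset.mem_range, exists_prop]
  refine ⟨Module.finrank ℝ (LinearMap.ker T), by omega, ?_, a, ha, ?_⟩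
  · rw [eigenMult, ← e0]
  · rw [eigenMult, ← hA, ← hT, e1]; omega

lemma discr_pos {W : SymMat n} (hW : W ≠ 0) (htr : 0 < tr W) (hc : W ∉ Cyl n) :
    0 < discr (W : Matrix (Fin n) (Fin n) ℝ) := by
  have h2 := sq_sum_pos hW
  rw [discr_eq_mul _ h2.ne']
  refine mul_pos h2 (lt_of_le_of_ne (by positivity) fun h => hc ?_)
  refine mem_Cyl_of_mul_self (a := (∑ i, ∑ j, ((W : Matrix (Fin n) (Fin n) ℝ) *
    (W : Matrix (Fin n) (Fin n) ℝ)) i j * (W : Matrix (Fin n) (Fin n) ℝ) i j) /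
      (∑ i, ∑ j, (W : Matrix (Fin n) (Fin n) ℝ) i j ^ 2)) hW htr ?_
  rw [eq_comm, Finset.sum_eq_zero_iff_of_nonneg (fun i _ => by positivity)] at h
  ext i j
  have := (Finset.sum_eq_zero_iff_of_nonneg (fun j _ => by positivity)).1 (h i (by simp)) j (by simp)
  rw [Matrix.smul_apply, smul_eq_mul]
  exact sub_eq_zero.1 (pow_eq_zero_iff two_ne_zero |>.1 this)

lemma isCompact_symMat_sphere :
    IsCompact {W : SymMat n | ∑ i, ∑ j, (W : Matrix (Fin n) (Fin n) ℝ) i j ^ 2 = 1} := by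
  have hK : IsCompact {A : Matrix (Fin n) (Fin n) ℝ | ∀ i j, A i j ∈ Set.Icc (-1 : ℝ) 1} := by
    have h1 : {A : Matrix (Fin n) (Fin n) ℝ | ∀ i j, A i j ∈ Set.Icc (-1 : ℝ) 1} =
        (Set.univ.pi fun _ => Set.univ.pi fun _ => Set.Icc (-1 : ℝ) 1 :) := by
      ext A
      exact ⟨fun h i _ j _ => h i j, fun h i j => h i trivial j trivial⟩
    rw [h1]
    exact isCompact_univ_pi fun _ => isCompact_univ_pi fun _ => isCompact_Icc
  have hcl : IsClosed {A : Matrix (Fin n) (Fin n) ℝ | IsSelfAdjoint A} :=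
    isClosed_eq continuous_star continuous_id
  have hemb : Topology.IsClosedEmbedding (Subtype.val : SymMat n → Matrix (Fin n) (Fin n) ℝ) :=
    hcl.isClosedEmbedding_subtypeVal
  refine (hemb.isCompact_preimage hK).of_isClosed_subset ?_ ?_
  · refine isClosed_eq ?_ continuous_const
    exact continuous_finsetSum _ fun i _ => continuous_finsetSum _ fun j _ =>
      ((continuous_subtype_val.matrix_elem i j).pow 2)
  · intro W hW i j
    have : (W : Matrix (Fin n) (Fin n) ℝ) i j ^ 2 ≤ 1 := ?_
    · exact abs_le.1 (sq_le_one_iff_abs_le_one _ |>.1 this)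
    rw [← hW.out]
    exact (Finset.single_le_sum (f := fun j => (W : Matrix (Fin n) (Fin n) ℝ) i j ^ 2)
      (fun j _ => by positivity) (Finset.mem_univ j)).trans
      (Finset.single_le_sum (f := fun i => ∑ j, (W : Matrix (Fin n) (Fin n) ℝ) i j ^ 2)
      (fun i _ => by positivity) (Finset.mem_univ i))

lemma discr_smul (c : ℝ) (W : Matrix (Fin n) (Fin n) ℝ) : discr (c • W) = c ^ 6 * discr W := by
  simp only [discr, Matrix.smul_mul, Matrix.mul_smul, Matrix.smul_apply, smul_eq_mul, mul_pow]
  have (x y : ℝ) : c * (c * x) * (c * y) = c ^ 3 * (x * y) := by ring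
  simp only [this, ← Finset.mul_sum]
  ring

/-- Compactness and homogeneity turn the hypotheses on `Γ` into uniform bounds. -/
lemma exists_cone_bounds (Γ : Set (SymMat n)) (hcone : IsCone Γ)
    (htr : closure Γ \ {0} ⊆ {W | 0 < tr W}) (hcyl : closure Γ ∩ Cyl n = ∅) :
    ∃ c C : ℝ, 0 < c ∧ 0 < C ∧ ∀ W ∈ Γ, 0 ≤ tr W ∧
      ∑ i, ∑ j, (W : Matrix (Fin n) (Fin n) ℝ) i j ^ 2 ≤ (C * tr W) ^ 2 ∧
      c * (∑ i, ∑ j, (W : Matrix (Fin n) (Fin n) ℝ) i j ^ 2) * tr W ^ 4 ≤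
        discr (W : Matrix (Fin n) (Fin n) ℝ) := by
  set K : Set (SymMat n) := {W : SymMat n | ∑ i, ∑ j, (W : Matrix (Fin n) (Fin n) ℝ) i j ^ 2 = 1}
    ∩ closure Γ with hKdef
  have hcomp : IsCompact K := isCompact_symMat_sphere.inter_right isClosed_closure
  have hne {W : SymMat n} (hW : W ∈ K) : W ≠ 0 := by
    rintro rfl
    have := hW.1.out
    simp at this
  have hpos {W : SymMat n} (hW : W ∈ K) : 0 < tr W := htr ⟨hW.2, hne hW⟩
  have ctr : Continuous (tr : SymMat n → ℝ) := continuous_subtype_val.matrix_trace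
  have cel (i j : Fin n) : Continuous fun W : SymMat n => (W : Matrix (Fin n) (Fin n) ℝ) i j :=
    continuous_subtype_val.matrix_elem i j
  have cel2 (i j : Fin n) : Continuous fun W : SymMat n =>
      ((W : Matrix (Fin n) (Fin n) ℝ) * (W : Matrix (Fin n) (Fin n) ℝ)) i j :=
    (continuous_subtype_val.matrix_mul continuous_subtype_val).matrix_elem i j
  have cd : Continuous fun W : SymMat n => discr (W : Matrix (Fin n) (Fin n) ℝ) := by
    exact ((continuous_finsetSum _ fun i _ => continuous_finsetSum _ fun j _ => (cel i j).pow 2).mul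
      (continuous_finsetSum _ fun i _ => continuous_finsetSum _ fun j _ => (cel2 i j).pow 2)).sub
      ((continuous_finsetSum _ fun i _ => continuous_finsetSum _ fun j _ =>
        (cel2 i j).mul (cel i j)).pow 2)
  obtain ⟨t, ht, htb⟩ := hcomp.exists_forall_le' ctr.continuousOn (a := 0) fun W hW => hpos hW
  -- The division by `1 + (tr W)⁴` puts the bound for `discr` in a form in which `(tr W)⁴` appears.
  obtain ⟨c, hc, hcb⟩ := hcomp.exists_forall_le'
    (f := fun W : SymMat n => discr (W : Matrix (Fin n) (Fin n) ℝ) / (1 + tr W ^ 4))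
    (Continuous.continuousOn (cd.div (by fun_prop) fun W => by positivity)) (a := 0)
    fun W hW => div_pos (discr_pos (hne hW) (hpos hW) fun h => by
      have : W ∈ closure Γ ∩ Cyl n := ⟨hW.2, h⟩
      rw [hcyl] at this; exact this) (by positivity)
  refine ⟨c, t⁻¹, hc, inv_pos.2 ht, fun W hW => ?_⟩
  rcases eq_or_ne W 0 with rfl | h0
  · simp [tr, discr]
  have hs := sq_sum_pos h0
  set s := ∑ i, ∑ j, (W : Matrix (Fin n) (Fin n) ℝ) i j ^ 2 with hsdef
  set l := (Real.sqrt s)⁻¹ with hl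
  have hlpos : 0 < l := by positivity
  have hl2 : l ^ 2 * s = 1 := by
    rw [hl, inv_pow, Real.sq_sqrt hs.le, inv_mul_cancel₀ hs.ne']
  have hmem : l • W ∈ K := by
    refine ⟨?_, subset_closure (hcone l hlpos W hW)⟩
    simp only [Set.mem_ofPred_eq]
    rw [← hl2, hsdef, Finset.mul_sum]
    refine Finset.sum_congr rfl fun i _ => ?_
    rw [Finset.mul_sum]
    refine Finset.sum_congr rfl fun j _ => ?_
    rw [← mul_pow]; simp
  have htrl : tr (l • W) = l * tr W := by simp [tr]
  have hdl : discr ((l • W : SymMat n) : Matrix (Fin n) (Fin n) ℝ) =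
      l ^ 6 * discr (W : Matrix (Fin n) (Fin n) ℝ) := by
    rw [← discr_smul]; rfl
  have k1 := htb _ hmem
  have k2 := hcb _ hmem
  rw [le_div_iff₀ (by positivity), hdl, htrl] at k2
  rw [htrl] at k1
  have htW : 0 < tr W := (mul_pos_iff_of_pos_left hlpos).1 (ht.trans_le k1)
  refine ⟨htW.le, ?_, ?_⟩
  · have : t ^ 2 ≤ (l * tr W) ^ 2 := by gcongr
    rw [mul_pow, inv_pow, ← div_eq_inv_mul, le_div_iff₀ (by positivity)]
    calc s * t ^ 2 ≤ s * (l * tr W) ^ 2 := by gcongr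
      _ = (l ^ 2 * s) * tr W ^ 2 := by ring
      _ = tr W ^ 2 := by rw [hl2, one_mul]
  · have k3 : c * (l * tr W) ^ 4 ≤ l ^ 6 * discr (W : Matrix (Fin n) (Fin n) ℝ) := by
      linarith
    have : l ^ 6 * (c * s * tr W ^ 4) ≤ l ^ 6 * discr (W : Matrix (Fin n) (Fin n) ℝ) := by
      calc l ^ 6 * (c * s * tr W ^ 4) = (l ^ 2 * s) * (c * (l * tr W) ^ 4) := by ring
        _ ≤ _ := by rw [hl2, one_mul]; exact k3
    exact le_of_mul_le_mul_left this (by positivity)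

end Cone

/-! ### Weak derivatives and the chain rule -/

section WeakDeriv

open Filter Topology ContinuousLinearMap
open scoped Convolution

variable {G : Type*} [NormedAddCommGroup G] [NormedSpace ℝ G] [FiniteDimensional ℝ G]
  [MeasurableSpace G] [BorelSpace G] {μ : Measure G} [μ.IsAddHaarMeasure]

variable (G) in
/-- A sequence of bump functions shrinking to the origin. -/
def shrinkingBump (i : ℕ) : ContDiffBump (0 : G) where
  rIn := 1 / ((i : ℝ) + 1)
  rOut := 2 * (1 / ((i : ℝ) + 1))
  rIn_pos := by positivity
  rIn_lt_rOut := by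
    have : 0 < 1 / ((i : ℝ) + 1) := by positivity
    linarith

variable (μ) in
/-- The regularisation of a function by convolution with the `i`-th normalised bump function. -/
def mollify (h : G → ℝ) (i : ℕ) : G → ℝ :=
  (shrinkingBump G i).normed μ ⋆[lsmul ℝ ℝ, μ] h

lemma tendsto_mollify_ae {h : G → ℝ} (hh : LocallyIntegrable h μ) :
    ∀ᵐ x ∂μ, Tendsto (fun i => mollify μ h i x) atTop (𝓝 (h x)) := by
  refine ContDiffBump.ae_convolution_tendsto_right_of_locallyIntegrable (K := 2) ?_
    (Eventually.of_forall fun i => le_rfl) hh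
  simpa [shrinkingBump] using (tendsto_one_div_add_atTop_nhds_zero_nat (𝕜 := ℝ)).const_mul 2

lemma integrable_normed_bump (i : ℕ) : Integrable ((shrinkingBump G i).normed μ) μ :=
  (shrinkingBump G i).integrable_normed

lemma integrable_mollify {h : G → ℝ} (hh : Integrable h μ) (i : ℕ) :
    Integrable (mollify μ h i) μ :=
  (integrable_normed_bump i).integrable_convolution (lsmul ℝ ℝ) hh

lemma integral_mollify {h : G → ℝ} (hh : Integrable h μ) (i : ℕ) :
    ∫ x, mollify μ h i x ∂μ = ∫ x, h x ∂μ := by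
  unfold mollify
  rw [integral_convolution _ (integrable_normed_bump i) hh, ContDiffBump.integral_normed]
  simp

lemma abs_mollify_le (h : G → ℝ) (i : ℕ) (x : G) :
    |mollify μ h i x| ≤ mollify μ (fun y => |h y|) i x := by
  simp only [mollify, convolution_def, lsmul_apply, smul_eq_mul]
  refine (abs_integral_le_integral_abs).trans (le_of_eq (integral_congr_ae (ae_of_all _ fun t => ?_)))
  simp only [abs_mul, abs_of_nonneg ((shrinkingBump G i).nonneg_normed t)]

/-- Mollifications converge in mean. Since `|h_i - h|` is dominated by `(|h|)_i + |h|`, whose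
integrals are constant, almost everywhere convergence and Fatou's lemma suffice. -/
lemma tendsto_integral_abs_mollify_sub {h : G → ℝ} (hh : Integrable h μ) :
    Tendsto (fun i => ∫ x, |mollify μ h i x - h x| ∂μ) atTop (𝓝 0) := by
  set m : G → ℝ := fun y => |h y| with hm
  have im : Integrable m μ := hh.abs
  set I := ∫ x, m x ∂μ with hI
  set a : ℕ → ℝ := fun i => ∫ x, |mollify μ h i x - h x| ∂μ with ha
  have ha0 (i) : 0 ≤ a i := integral_nonneg fun x => abs_nonneg _
  set q : ℕ → G → ℝ := fun i x => mollify μ m i x + m x - |mollify μ h i x - h x| with hq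
  have q0 (i x) : 0 ≤ q i x := by
    have := abs_mollify_le (μ := μ) h i x
    have h2 := abs_sub (mollify μ h i x) (h x)
    simp only [hq, hm]; linarith
  have iq (i) : Integrable (q i) μ :=
    ((integrable_mollify im i).add im).sub ((integrable_mollify hh i).sub hh).abs
  have Iq (i) : ∫ x, q i x ∂μ = 2 * I - a i := by
    have h1 : ∫ x, q i x ∂μ = ∫ x, (mollify μ m i x + m x) ∂μ - a i :=
      integral_sub ((integrable_mollify im i).add im) ((integrable_mollify hh i).sub hh).abs
    have h2 : ∫ x, (mollify μ m i x + m x) ∂μ = ∫ x, mollify μ m i x ∂μ + ∫ x, m x ∂μ :=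
      integral_add (integrable_mollify im i) im
    rw [h1, h2, integral_mollify im]
    ring
  have key : ENNReal.ofReal (2 * I) ≤ liminf (fun i => ENNReal.ofReal (2 * I - a i)) atTop := by
    have h1 : ENNReal.ofReal (2 * I) = ∫⁻ x, liminf (fun i => ENNReal.ofReal (q i x)) atTop ∂μ := by
      rw [hI, ← integral_const_mul, ofReal_integral_eq_lintegral_ofReal (im.const_mul 2)
        (ae_of_all _ fun x => by simp only [hm, Pi.zero_apply]; positivity)]
      refine lintegral_congr_ae ?_
      filter_upwards [tendsto_mollify_ae hh.locallyIntegrable, tendsto_mollify_ae im.locallyIntegrable]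
        with x h1 h2
      have : Tendsto (fun i => q i x) atTop (𝓝 (2 * m x)) := by
        have := (h2.add_const (m x)).sub (h1.sub_const (h x)).abs
        simpa [two_mul] using this
      exact ((ENNReal.continuous_ofReal.tendsto _).comp this).liminf_eq.symm
    rw [h1]
    refine (lintegral_liminf_le' fun i => (iq i).aemeasurable.ennreal_ofReal).trans (le_of_eq ?_)
    congr 1
    ext i
    rw [← ofReal_integral_eq_lintegral_ofReal (iq i) (ae_of_all _ (q0 i)), Iq]
  have ha2 (i) : a i ≤ 2 * I := by
    have : 0 ≤ ∫ x, q i x ∂μ := integral_nonneg fun x => q0 i x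
    rw [Iq] at this; linarith
  refine tendsto_order.2 ⟨fun b hb => Eventually.of_forall fun i => hb.trans_le (ha0 i), ?_⟩
  intro ε hε
  rcases le_or_gt I 0 with h0 | h0
  · exact Eventually.of_forall fun i => by linarith [ha2 i]
  have hlt : ENNReal.ofReal (2 * I - ε) < ENNReal.ofReal (2 * I) :=
    (ENNReal.ofReal_lt_ofReal_iff (by linarith)).2 (by linarith)
  filter_upwards [eventually_lt_of_lt_liminf (hlt.trans_le key)] with i hi
  have := (ENNReal.ofReal_lt_ofReal_iff').1 hi
  linarith [this.1]

lemma contDiff_mollify {h : G → ℝ} (hh : LocallyIntegrable h μ) (i : ℕ) :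
    ContDiff ℝ ∞ (mollify μ h i) :=
  (shrinkingBump G i).hasCompactSupport_normed.contDiff_convolution_left _
    (shrinkingBump G i).contDiff_normed hh

/-- Mollification commutes with weak differentiation. -/
lemma fderiv_mollify {h k : G → ℝ} {v : G} (hh : LocallyIntegrable h μ)
    (hw : ∀ η : G → ℝ, ContDiff ℝ ∞ η → HasCompactSupport η →
      ∫ z, h z * fderiv ℝ η z v ∂μ = - ∫ z, k z * η z ∂μ) (i : ℕ) (x : G) :
    fderiv ℝ (mollify μ h i) x v = mollify μ k i x := by
  set ρ := (shrinkingBump G i).normed μ with hρ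
  have hρc : HasCompactSupport ρ := (shrinkingBump G i).hasCompactSupport_normed
  have hρs : ContDiff ℝ ∞ ρ := (shrinkingBump G i).contDiff_normed
  have h1 := hρc.hasFDerivAt_convolution_left (lsmul ℝ ℝ) (hρs.of_le (by simp)) hh x
  have hfd : ∀ t, fderiv ℝ (fun t => ρ (x - t)) t v = - fderiv ℝ ρ (x - t) v := by
    intro t
    have hd : HasFDerivAt (fun t => ρ (x - t)) ((fderiv ℝ ρ (x - t)).comp
        (-ContinuousLinearMap.id ℝ G)) t :=
      ((hρs.differentiable (by simp)) (x - t)).hasFDerivAt.comp t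
        ((hasFDerivAt_id t).const_sub x)
    rw [hd.fderiv]; simp
  have hη := hw (fun t => ρ (x - t)) (hρs.comp (contDiff_const.sub contDiff_id))
    (hρc.comp_homeomorph (Homeomorph.subLeft x))
  simp only [hfd] at hη
  unfold mollify
  rw [h1.fderiv, convolution_eq_swap, convolution_eq_swap, integral_apply]
  · simp only [precompL_apply, lsmul_apply, smul_eq_mul]
    have e1 : ∫ z, h z * -fderiv ℝ ρ (x - z) v ∂μ = - ∫ t, fderiv ℝ ρ (x - t) v * h t ∂μ := by
      rw [← integral_neg]; congr 1; ext z; ring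
    rw [e1, neg_inj] at hη
    rw [hη]; congr 1; ext z; ring
  · have hex := ((hρc.fderiv ℝ).convolutionExists_left ((lsmul ℝ ℝ).precompL G)
      (hρs.continuous_fderiv (by simp)) hh x)
    have := hex.integrable_swap
    exact this

/-- The chain rule for a function on the whole space that is integrable together with its weak
derivative. -/
lemma weak_chain_rule_global {h k : G → ℝ} {v : G} (hh : Integrable h μ) (hk : Integrable k μ)
    (hw : ∀ η : G → ℝ, ContDiff ℝ ∞ η → HasCompactSupport η →
      ∫ z, h z * fderiv ℝ η z v ∂μ = - ∫ z, k z * η z ∂μ)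
    {ψ : ℝ → ℝ} (hψ : ContDiff ℝ 1 ψ) {L : ℝ} (hL : ∀ t, |deriv ψ t| ≤ L)
    {η : G → ℝ} (hη : ContDiff ℝ ∞ η) (hηc : HasCompactSupport η) :
    ∫ z, ψ (h z) * fderiv ℝ η z v ∂μ = - ∫ z, deriv ψ (h z) * k z * η z ∂μ := by
  have hL0 : 0 ≤ L := (abs_nonneg _).trans (hL 0)
  have hψd : Differentiable ℝ ψ := hψ.differentiable (by simp)
  have hψ' : Continuous (deriv ψ) := hψ.continuous_deriv (by simp)
  have hlip (s t : ℝ) : |ψ s - ψ t| ≤ L * |s - t| := by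
    have := Convex.norm_image_sub_le_of_norm_deriv_le (f := ψ) (C := L) (s := Set.univ)
      (fun x _ => hψd x) (fun x _ => hL x) convex_univ (Set.mem_univ t) (Set.mem_univ s)
    simpa using this
  have hηcont : Continuous η := hη.continuous
  have hηv : Continuous fun z => fderiv ℝ η z v :=
    (hη.continuous_fderiv (by simp)).clm_apply continuous_const
  have hηvc : HasCompactSupport fun z => fderiv ℝ η z v := hηc.fderiv_apply ℝ v
  obtain ⟨A, hA⟩ := hηcont.bounded_above_of_compact_support hηc
  obtain ⟨B, hB⟩ := hηv.bounded_above_of_compact_support hηvc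
  have hA0 : 0 ≤ A := (norm_nonneg _).trans (hA 0)
  have hB0 : 0 ≤ B := (norm_nonneg _).trans (hB 0)
  set f : ℕ → G → ℝ := mollify μ h with hf
  have hfs (i) : ContDiff ℝ ∞ (f i) := contDiff_mollify hh.locallyIntegrable i
  have hfd (i x) : fderiv ℝ (f i) x v = mollify μ k i x := fderiv_mollify hh.locallyIntegrable hw i x
  have hkc (i) : Continuous (mollify μ k i) := (contDiff_mollify hk.locallyIntegrable i).continuous
  have hcomp (i) : ContDiff ℝ 1 (fun z => ψ (f i z)) := hψ.comp ((hfs i).of_le (by simp))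
  have hcd (i x) : fderiv ℝ (fun z => ψ (f i z)) x v = deriv ψ (f i x) * mollify μ k i x := by
    have h1 := (hψd (f i x)).hasDerivAt.comp_hasFDerivAt x
      ((hfs i).differentiable (by simp) x).hasFDerivAt
    have h2 : fderiv ℝ (fun z => ψ (f i z)) x = deriv ψ (f i x) • fderiv ℝ (f i) x := h1.fderiv
    rw [h2, smul_apply, hfd, smul_eq_mul]
  have ibp (i) : ∫ z, ψ (f i z) * fderiv ℝ η z v ∂μ =
      - ∫ z, deriv ψ (f i z) * mollify μ k i z * η z ∂μ := by
    have := integral_mul_fderiv_eq_neg_fderiv_mul_of_integrable (𝕜 := ℝ) (μ := μ)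
      (f := fun z => ψ (f i z)) (g := η) (v := v) ?_ ?_ ?_
      (fun x _ => (hcomp i).differentiable (by simp) x)
      (fun x _ => hη.differentiable (by simp) x)
    · simpa only [hcd] using this
    · simp only [hcd]
      exact (((hψ'.comp (hfs i).continuous).mul (hkc i)).mul hηcont).integrable_of_hasCompactSupport
        hηc.mul_left
    · exact ((hcomp i).continuous.mul hηv).integrable_of_hasCompactSupport hηvc.mul_left
    · exact ((hcomp i).continuous.mul hηcont).integrable_of_hasCompactSupport hηc.mul_left
  -- the left-hand sides converge because `ψ` is Lipschitz and the mollifications converge in mean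
  have iψ : Integrable (fun z => ψ (h z) * fderiv ℝ η z v) μ := by
    have e : (fun z => ψ (h z) * fderiv ℝ η z v) =
        fun z => (ψ (h z) - ψ 0) * fderiv ℝ η z v + ψ 0 * fderiv ℝ η z v := by ext z; ring
    rw [e]
    refine Integrable.add ?_ ((hηv.integrable_of_hasCompactSupport hηvc).const_mul _)
    refine Integrable.mono' (hh.abs.const_mul (L * B)) ?_ (ae_of_all _ fun z => ?_)
    · exact ((hψ.continuous.comp_aestronglyMeasurable hh.1).sub aestronglyMeasurable_const).mul
        hηv.aestronglyMeasurable
    · rw [norm_mul]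
      calc _ ≤ (L * |h z - 0|) * B := by
            gcongr
            · exact hlip _ _
            · exact hB z
        _ = _ := by rw [sub_zero]; ring
  have lim1 : Tendsto (fun i => ∫ z, ψ (f i z) * fderiv ℝ η z v ∂μ) atTop
      (𝓝 (∫ z, ψ (h z) * fderiv ℝ η z v ∂μ)) := by
    rw [tendsto_iff_dist_tendsto_zero]
    have h0 : Tendsto (fun i => L * B * ∫ x, |f i x - h x| ∂μ) atTop (𝓝 0) := by
      simpa using (tendsto_integral_abs_mollify_sub hh).const_mul (L * B)
    refine squeeze_zero (fun _ => dist_nonneg) (fun i => ?_) h0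
    have ii : Integrable (fun z => ψ (f i z) * fderiv ℝ η z v) μ :=
      ((hcomp i).continuous.mul hηv).integrable_of_hasCompactSupport hηvc.mul_left
    rw [dist_eq_norm, ← integral_sub ii iψ, ← integral_const_mul]
    refine norm_integral_le_of_norm_le (((integrable_mollify hh i).sub hh).abs.const_mul _)
      (ae_of_all _ fun z => ?_)
    rw [← sub_mul, norm_mul]
    calc _ ≤ (L * |f i z - h z|) * B := by
          gcongr
          · exact hlip _ _
          · exact hB z
      _ = _ := by ring
  have ik : Integrable (fun z => k z * η z) μ :=
    hk.mul_bdd (c := A) hηcont.aestronglyMeasurable (ae_of_all _ hA)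
  have mψ' : AEStronglyMeasurable (fun z => deriv ψ (h z)) μ :=
    hψ'.comp_aestronglyMeasurable hh.1
  have lim2 : Tendsto (fun i => ∫ z, deriv ψ (f i z) * k z * η z ∂μ) atTop
      (𝓝 (∫ z, deriv ψ (h z) * k z * η z ∂μ)) := by
    refine tendsto_integral_of_dominated_convergence (fun z => L * |k z * η z|) (fun i => ?_)
      (ik.abs.const_mul L) (fun i => ae_of_all _ fun z => ?_) ?_
    · exact ((hψ'.comp (hfs i).continuous).aestronglyMeasurable.mul hk.1).mul
        hηcont.aestronglyMeasurable
    · rw [mul_assoc, norm_mul]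
      exact mul_le_mul_of_nonneg_right (hL _) (norm_nonneg _)
    · filter_upwards [tendsto_mollify_ae hh.locallyIntegrable] with z hz
      exact (((hψ'.tendsto _).comp hz).mul_const _).mul_const _
  have lim3 : Tendsto (fun i => ∫ z, deriv ψ (f i z) * mollify μ k i z * η z ∂μ) atTop
      (𝓝 (∫ z, deriv ψ (h z) * k z * η z ∂μ)) := by
    have h0 : Tendsto (fun i => ∫ z, deriv ψ (f i z) * (mollify μ k i z - k z) * η z ∂μ) atTop
        (𝓝 0) := by
      have h1 : Tendsto (fun i => L * A * ∫ x, |mollify μ k i x - k x| ∂μ) atTop (𝓝 0) := by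
        simpa using (tendsto_integral_abs_mollify_sub hk).const_mul (L * A)
      refine squeeze_zero_norm (fun i => ?_) h1
      rw [← integral_const_mul]
      refine norm_integral_le_of_norm_le (((integrable_mollify hk i).sub hk).abs.const_mul _)
        (ae_of_all _ fun z => ?_)
      rw [norm_mul, norm_mul]
      calc _ ≤ L * |mollify μ k i z - k z| * A := by
            gcongr
            · exact hL _
            · exact le_of_eq (Real.norm_eq_abs _)
            · exact hA z
        _ = _ := by ring
    have := lim2.add h0
    rw [add_zero] at this
    refine this.congr fun i => ?_
    have i1 : Integrable (fun z => deriv ψ (f i z) * k z * η z) μ := by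
      have := ik.bdd_mul (c := L) (hψ'.comp (hfs i).continuous).aestronglyMeasurable
        (ae_of_all _ fun z => hL (f i z))
      simpa only [mul_assoc, Function.comp_apply] using this
    have i2 : Integrable (fun z => deriv ψ (f i z) * mollify μ k i z * η z) μ :=
      (((hψ'.comp (hfs i).continuous).mul (hkc i)).mul hηcont).integrable_of_hasCompactSupport
        hηc.mul_left
    have i3 : (fun z => deriv ψ (f i z) * (mollify μ k i z - k z) * η z) =
        fun z => deriv ψ (f i z) * mollify μ k i z * η z - deriv ψ (f i z) * k z * η z := by
      ext z; ring
    rw [i3, integral_sub i2 i1]; ring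
  exact tendsto_nhds_unique lim1 (by simpa only [ibp] using lim3.neg)

lemma integrable_mul_of_tsupport_subset {Ω : Set G} {w ξ : G → ℝ} (hw : LocallyIntegrableOn w Ω μ)
    (hξ : Continuous ξ) (hξc : HasCompactSupport ξ) (hξΩ : tsupport ξ ⊆ Ω) :
    Integrable (fun z => w z * ξ z) μ := by
  obtain ⟨C, hC⟩ := hξ.bounded_above_of_compact_support hξc
  have h1 : IntegrableOn w (tsupport ξ) μ := hw.integrableOn_compact_subset hξΩ hξc
  have h2 : IntegrableOn (fun z => w z * ξ z) (tsupport ξ) μ :=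
    h1.mul_bdd (c := C) hξ.aestronglyMeasurable (ae_of_all _ hC)
  refine (integrableOn_iff_integrable_of_support_subset fun z hz => subset_tsupport _ ?_).1 h2
  exact right_ne_zero_of_mul hz

/-- A cut-off function for a compact subset of an open set. -/
lemma exists_cutoff {K Ω : Set G} (hK : IsCompact K) (hΩ : IsOpen Ω) (hKΩ : K ⊆ Ω) :
    ∃ χ : G → ℝ, ContDiff ℝ ∞ χ ∧ HasCompactSupport χ ∧ tsupport χ ⊆ Ω ∧
      ∀ x ∈ K, ∀ᶠ y in 𝓝 x, χ y = 1 := by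
  obtain ⟨K', hK', h1, h2⟩ := exists_compact_between hK hΩ hKΩ
  obtain ⟨f, hf1, hf2, -⟩ := exists_contMDiffMap_one_nhds_of_subset_interior (n := ⊤) 𝓘(ℝ, G)
    hK.isClosed h1
  have hsup : Function.support f ⊆ K' := fun x hx => by
    by_contra hx'; exact hx (hf2 x hx')
  have hts : tsupport f ⊆ K' := closure_minimal hsup hK'.isClosed
  refine ⟨f, f.contMDiff.contDiff, hK'.of_isClosed_subset (isClosed_tsupport _) hts, hts.trans h2,
    fun x hx => ?_⟩
  exact (eventually_nhdsSet_iff_forall.1 hf1) x hx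

/-- The chain rule for weak derivatives on an open set. -/
theorem weak_chain_rule {Ω : Set G} (hΩ : IsOpen Ω) {u g : G → ℝ} {v : G}
    (hu : LocallyIntegrableOn u Ω μ) (hg : LocallyIntegrableOn g Ω μ)
    (hw : ∀ η : G → ℝ, ContDiff ℝ ∞ η → HasCompactSupport η → tsupport η ⊆ Ω →
      ∫ z, u z * fderiv ℝ η z v ∂μ = - ∫ z, g z * η z ∂μ)
    {ψ : ℝ → ℝ} (hψ : ContDiff ℝ 1 ψ) {L : ℝ} (hL : ∀ t, |deriv ψ t| ≤ L)
    {η : G → ℝ} (hη : ContDiff ℝ ∞ η) (hηc : HasCompactSupport η) (hηΩ : tsupport η ⊆ Ω) :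
    ∫ z, ψ (u z) * fderiv ℝ η z v ∂μ = - ∫ z, deriv ψ (u z) * g z * η z ∂μ := by
  obtain ⟨χ, hχ, hχc, hχΩ, hχ1⟩ := exists_cutoff hηc hΩ hηΩ
  have hfχ : Continuous fun z => fderiv ℝ χ z v :=
    (hχ.continuous_fderiv (by simp)).clm_apply continuous_const
  have tsub {ξ : G → ℝ} : tsupport (fun z => fderiv ℝ ξ z v) ⊆ tsupport ξ :=
    tsupport_fderiv_apply_subset ℝ v
  have hfχc : HasCompactSupport fun z => fderiv ℝ χ z v := hχc.fderiv_apply ℝ v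
  set h : G → ℝ := fun z => u z * χ z with hh
  set k : G → ℝ := fun z => g z * χ z + u z * fderiv ℝ χ z v with hk
  have ih : Integrable h μ := integrable_mul_of_tsupport_subset hu hχ.continuous hχc hχΩ
  have ik : Integrable k μ := (integrable_mul_of_tsupport_subset hg hχ.continuous hχc hχΩ).add
    (integrable_mul_of_tsupport_subset hu hfχ hfχc (tsub.trans hχΩ))
  have hglob : ∀ ζ : G → ℝ, ContDiff ℝ ∞ ζ → HasCompactSupport ζ →
      ∫ z, h z * fderiv ℝ ζ z v ∂μ = - ∫ z, k z * ζ z ∂μ := by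
    intro ζ hζ hζc
    have hp : ∀ z, fderiv ℝ (fun z => χ z * ζ z) z v =
        χ z * fderiv ℝ ζ z v + ζ z * fderiv ℝ χ z v := by
      intro z
      rw [fderiv_fun_mul (hχ.differentiable (by simp) z) (hζ.differentiable (by simp) z)]
      simp
    have hts : tsupport (fun z => χ z * ζ z) ⊆ tsupport χ := tsupport_mul_subset_left
    have h1 := hw (fun z => χ z * ζ z) (hχ.mul hζ) hχc.mul_right (hts.trans hχΩ)
    simp only [hp] at h1
    have hζv : Continuous fun z => fderiv ℝ ζ z v :=
      (hζ.continuous_fderiv (by simp)).clm_apply continuous_const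
    have j1 : Integrable (fun z => u z * (χ z * fderiv ℝ ζ z v)) μ :=
      integrable_mul_of_tsupport_subset hu (hχ.continuous.mul hζv) hχc.mul_right (tsupport_mul_subset_left.trans hχΩ)
    have j2 : Integrable (fun z => u z * (ζ z * fderiv ℝ χ z v)) μ :=
      integrable_mul_of_tsupport_subset hu (hζ.continuous.mul hfχ) hfχc.mul_left
        ((tsupport_mul_subset_right.trans tsub).trans hχΩ)
    have j3 : Integrable (fun z => g z * (χ z * ζ z)) μ :=
      integrable_mul_of_tsupport_subset hg (hχ.continuous.mul hζ.continuous) hχc.mul_right (hts.trans hχΩ)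
    have e1 : (fun z => u z * (χ z * fderiv ℝ ζ z v + ζ z * fderiv ℝ χ z v)) =
        fun z => u z * (χ z * fderiv ℝ ζ z v) + u z * (ζ z * fderiv ℝ χ z v) := by ext z; ring
    rw [e1, integral_add j1 j2] at h1
    have e2 : (fun z => k z * ζ z) =
        fun z => g z * (χ z * ζ z) + u z * (ζ z * fderiv ℝ χ z v) := by
      ext z; simp only [hk]; ring
    rw [e2, integral_add j3 j2]
    have e3 : (fun z => h z * fderiv ℝ ζ z v) = fun z => u z * (χ z * fderiv ℝ ζ z v) := by
      ext z; simp only [hh]; ring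
    rw [e3]; linarith
  have main := weak_chain_rule_global ih ik hglob hψ hL hη hηc
  have e1 : ∀ z, ψ (u z) * fderiv ℝ η z v = ψ (h z) * fderiv ℝ η z v := by
    intro z
    by_cases hz : z ∈ tsupport η
    · rw [hh]; simp only [(hχ1 z hz).self_of_nhds, mul_one]
    · have : fderiv ℝ η z v = 0 := image_eq_zero_of_notMem_tsupport (f := fun z => fderiv ℝ η z v)
        fun hz' => hz (tsub hz')
      rw [this]; simp
  have e2 : ∀ z, deriv ψ (u z) * g z * η z = deriv ψ (h z) * k z * η z := by
    intro z
    by_cases hz : z ∈ tsupport η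
    · have hc := hχ1 z hz
      have : fderiv ℝ χ z = 0 := by
        rw [Filter.EventuallyEq.fderiv_eq (f := fun _ => (1 : ℝ)) hc]; simp
      rw [hh, hk]; simp only [hc.self_of_nhds, mul_one, this]; simp
    · rw [image_eq_zero_of_notMem_tsupport hz]; simp
  simp only [e1, e2, main]

end WeakDeriv

/-! ### The pseudoinverse and the volume factor of an injective linear map -/

section Pinv

open ContinuousLinearMap
open scoped InnerProductSpace

variable {V W : Type*} [NormedAddCommGroup V] [InnerProductSpace ℝ V] [FiniteDimensional ℝ V]
  [CompleteSpace V] [NormedAddCommGroup W] [InnerProductSpace ℝ W] [FiniteDimensional ℝ W]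
  [CompleteSpace W]

/-- The Moore-Penrose inverse `(A†A)⁻¹A†` of an injective linear map `A`: it is a left inverse of
`A` and vanishes on the orthogonal complement of the range. -/
def pinv (A : V →L[ℝ] W) : W →L[ℝ] V := (adjoint A ∘L A).inverse ∘L adjoint A

lemma isInvertible_of_injective {G : V →L[ℝ] V} (hG : Function.Injective G) : G.IsInvertible :=
  ⟨(LinearEquiv.ofInjectiveEndo G.toLinearMap hG).toContinuousLinearEquiv, by ext; rfl⟩

lemma isInvertible_adjoint_comp {A : V →L[ℝ] W} (hA : Function.Injective A) :
    (adjoint A ∘L A).IsInvertible :=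
  isInvertible_of_injective ((adjoint_comp_self_injective_iff A).2 hA)

lemma pinv_apply_apply {A : V →L[ℝ] W} (hA : Function.Injective A) (v : V) : pinv A (A v) = v :=
  (isInvertible_adjoint_comp hA).inverse_apply_self v

lemma pinv_apply_of_orthogonal {A : V →L[ℝ] W} {a : W} (ha : ∀ v, ⟪a, A v⟫_ℝ = 0) :
    pinv A a = 0 := by
  have : adjoint A a = 0 := ext_inner_right ℝ fun v => by
    rw [adjoint_inner_left, ha, inner_zero_left]
  simp [pinv, this]

lemma inner_sub_apply_pinv {A : V →L[ℝ] W} (hA : Function.Injective A) (a : W) (v : V) :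
    ⟪a - A (pinv A a), A v⟫_ℝ = 0 := by
  have h := (isInvertible_adjoint_comp hA).self_apply_inverse (adjoint A a)
  have h2 : adjoint A (A (pinv A a)) = adjoint A a := h
  rw [← adjoint_inner_left, map_sub, h2, sub_self, inner_zero_left]

/-- The pseudoinverse is characterised by being a left inverse that kills the orthogonal
complement of the range. -/
lemma eq_pinv {A : V →L[ℝ] W} (hA : Function.Injective A) {L : W →L[ℝ] V}
    (h1 : ∀ v, L (A v) = v) (h2 : ∀ a, (∀ v, ⟪a, A v⟫_ℝ = 0) → L a = 0) : L = pinv A := by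
  ext1 a
  have h := h2 _ (inner_sub_apply_pinv hA a)
  rw [map_sub, h1, sub_eq_zero] at h
  exact h

lemma comp_pinv_comp {A : V →L[ℝ] W} (hA : Function.Injective A) (T : V →L[ℝ] V)
    (hT : Function.Bijective T) : T ∘L pinv (A ∘L T) = pinv A := by
  have hAT : Function.Injective (A ∘L T) := hA.comp hT.1
  refine eq_pinv hA (fun v => ?_) fun a ha => ?_
  · obtain ⟨w, rfl⟩ := hT.2 v
    have := pinv_apply_apply hAT w
    rw [comp_apply] at this
    rw [comp_apply, this]
  · rw [comp_apply, pinv_apply_of_orthogonal (fun v => ha (T v)), map_zero]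

lemma inner_inverse_adjoint_comp {A : V →L[ℝ] W} (hA : Function.Injective A) (v w : V) :
    ⟪(adjoint A ∘L A).inverse v, w⟫_ℝ = ⟪v, (adjoint A ∘L A).inverse w⟫_ℝ := by
  have h := isInvertible_adjoint_comp hA
  have e (x y : V) : ⟪(adjoint A ∘L A) x, y⟫_ℝ = ⟪x, (adjoint A ∘L A) y⟫_ℝ := by
    simp only [comp_apply, adjoint_inner_left, adjoint_inner_right]
  have h1 := e ((adjoint A ∘L A).inverse v) ((adjoint A ∘L A).inverse w)
  rw [h.self_apply_inverse, h.self_apply_inverse] at h1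
  exact h1.symm

variable (V W) in
/-- The adjoint as a real continuous linear map. -/
def adjointCLM : (V →L[ℝ] W) →L[ℝ] (W →L[ℝ] V) :=
  LinearMap.toContinuousLinearMap
    { toFun := fun A => adjoint A
      map_add' := fun A B => map_add _ A B
      map_smul' := fun c A => by simp }

@[simp] lemma adjointCLM_apply (A : V →L[ℝ] W) : adjointCLM V W A = adjoint A := rfl

lemma contDiffAt_pinv {A : V →L[ℝ] W} (hA : Function.Injective A) {k : WithTop ℕ∞} :
    ContDiffAt ℝ k (pinv : (V →L[ℝ] W) → _) A := by
  obtain ⟨e, he⟩ := isInvertible_adjoint_comp hA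
  have h1 : ContDiff ℝ k fun A : V →L[ℝ] W => adjointCLM V W A := (adjointCLM V W).contDiff
  have h2 : ContDiffAt ℝ k (fun A : V →L[ℝ] W => adjointCLM V W A ∘L A) A :=
    (h1.clm_comp contDiff_id).contDiffAt
  have h3 : ContDiffAt ℝ k (fun A : V →L[ℝ] W => (adjointCLM V W A ∘L A).inverse) A := by
    refine ContDiffAt.comp A (g := ContinuousLinearMap.inverse) ?_ h2
    simp only [adjointCLM_apply]
    rw [← he]
    exact contDiffAt_map_inverse e
  exact h3.clm_comp h1.contDiffAt

/-! #### The determinant -/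

lemma contDiff_det {k : WithTop ℕ∞} : ContDiff ℝ k (fun G : V →L[ℝ] V => G.det) := by
  set b := stdOrthonormalBasis ℝ V
  have h : (fun G : V →L[ℝ] V => G.det) = fun G : V →L[ℝ] V =>
      ∑ σ : Equiv.Perm (Fin (Module.finrank ℝ V)), ((Equiv.Perm.sign σ : ℤ) : ℝ) *
        ∏ i, ⟪b (σ i), G (b i)⟫_ℝ := by
    ext G
    rw [ContinuousLinearMap.det, ← LinearMap.det_toMatrix b.toBasis, Matrix.det_apply']
    simp [LinearMap.toMatrix_apply, b.repr_apply_apply]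
  rw [h]
  refine ContDiff.sum fun σ _ => contDiff_const.mul (contDiff_prod fun i _ => ?_)
  exact contDiff_const.inner ℝ (contDiff_id.clm_apply contDiff_const)

/-- Jacobi's formula for the derivative of the determinant. -/
lemma fderiv_det {G : V →L[ℝ] V} (hG : G.IsInvertible) (N : V →L[ℝ] V) :
    fderiv ℝ (fun G : V →L[ℝ] V => G.det) G N =
      G.det * LinearMap.trace ℝ V (G.inverse ∘L N).toLinearMap := by
  set T := G.inverse ∘L N with hT
  have hN : N = G ∘L T := by
    rw [hT, ← comp_assoc, hG.self_comp_inverse]; ext; simp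
  have h1 : HasDerivAt (fun t : ℝ => (G + t • N).det)
      (fderiv ℝ (fun G : V →L[ℝ] V => G.det) G N) 0 := by
    have hd : HasFDerivAt (fun G : V →L[ℝ] V => G.det) (fderiv ℝ (fun G : V →L[ℝ] V => G.det) G)
        (G + (0 : ℝ) • N) := by
      rw [zero_smul, add_zero]
      exact ((contDiff_det (V := V) (k := 1)).differentiable (by simp) G).hasFDerivAt
    have hl : HasDerivAt (fun t : ℝ => G + t • N) N 0 := by
      simpa using ((hasDerivAt_id (0 : ℝ)).smul_const N).const_add G
    exact hd.comp_hasDerivAt 0 hl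
  set b := (stdOrthonormalBasis ℝ V).toBasis
  set m := LinearMap.toMatrix b b T.toLinearMap with hm
  -- `det (1 + t m)` is a polynomial in `t` whose linear coefficient is the trace of `m`.
  have h2 : (fun t : ℝ => (G + t • N).det) = fun t => G.det * (1 + LinearMap.trace ℝ V T.toLinearMap * t
      + Polynomial.eval t (1 + (Polynomial.X : Polynomial ℝ) • m.map Polynomial.C).det.divX.divX * t ^ 2) := by
    ext t
    have e : G + t • N = G ∘L (ContinuousLinearMap.id ℝ V + t • T) := by
      rw [hN]; ext v; simp
    have e3 : LinearMap.toMatrix b b ((ContinuousLinearMap.id ℝ V + t • T).toLinearMap) = 1 + t • m := by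
      simp [hm]
    rw [e, ContinuousLinearMap.det, ContinuousLinearMap.toLinearMap_comp, LinearMap.det_comp,
      ← LinearMap.det_toMatrix b (ContinuousLinearMap.id ℝ V + t • T).toLinearMap, e3,
      Matrix.det_one_add_smul, LinearMap.trace_eq_matrix_trace ℝ b]
  have h3 : HasDerivAt (fun t : ℝ => (G + t • N).det)
      (G.det * LinearMap.trace ℝ V T.toLinearMap) 0 := by
    rw [h2]
    set q := (1 + (Polynomial.X : Polynomial ℝ) • m.map Polynomial.C).det.divX.divX
    have := ((((hasDerivAt_id (0 : ℝ)).const_mul (LinearMap.trace ℝ V T.toLinearMap)).const_add 1).add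
      ((q.hasDerivAt 0).mul ((hasDerivAt_id (0 : ℝ)).pow 2))).const_mul G.det
    refine (this.congr_deriv ?_)
    simp
  exact h1.unique h3

/-! #### The volume factor -/

lemma normDet_pos {A : V →L[ℝ] W} (hA : Function.Injective A) : 0 < A.toLinearMap.normDet :=
  lt_of_le_of_ne (LinearMap.normDet_nonneg _) fun h =>
    LinearMap.normDet_eq_zero_iff_ker_ne_bot.1 h.symm (LinearMap.ker_eq_bot.2 hA)

lemma normDet_eq_sqrt (A : V →L[ℝ] W) :
    A.toLinearMap.normDet = Real.sqrt (adjoint A ∘L A).det := by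
  have h := A.normDet_sq
  simp only [RCLike.ofReal_real_eq_id, id_eq] at h
  rw [← h, Real.sqrt_sq (LinearMap.normDet_nonneg _)]

lemma contDiffAt_normDet {A : V →L[ℝ] W} (hA : Function.Injective A) {k : WithTop ℕ∞} :
    ContDiffAt ℝ k (fun A : V →L[ℝ] W => A.toLinearMap.normDet) A := by
  simp only [normDet_eq_sqrt]
  refine ContDiffAt.sqrt ?_ ?_
  · have h1 : ContDiff ℝ k fun A : V →L[ℝ] W => adjointCLM V W A ∘L A :=
      (adjointCLM V W).contDiff.clm_comp contDiff_id
    exact (contDiff_det.comp h1).contDiffAt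
  · intro h0
    have := normDet_pos hA
    rw [normDet_eq_sqrt, h0, Real.sqrt_zero] at this
    exact this.false

lemma trace_eq_of_inner {T T' : V →L[ℝ] V} (h : ∀ v w, ⟪T v, w⟫_ℝ = ⟪v, T' w⟫_ℝ) :
    LinearMap.trace ℝ V T.toLinearMap = LinearMap.trace ℝ V T'.toLinearMap := by
  rw [LinearMap.trace_eq_sum_inner _ (stdOrthonormalBasis ℝ V),
    LinearMap.trace_eq_sum_inner _ (stdOrthonormalBasis ℝ V)]
  refine Finset.sum_congr rfl fun i _ => ?_
  rw [real_inner_comm]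
  exact h _ _

/-- The logarithmic derivative of the volume factor `√(det A†A)` in the direction `B` is the trace
of `A⁺B`. -/
lemma fderiv_normDet {A : V →L[ℝ] W} (hA : Function.Injective A) (B : V →L[ℝ] W) :
    fderiv ℝ (fun A : V →L[ℝ] W => A.toLinearMap.normDet) A B =
      A.toLinearMap.normDet * LinearMap.trace ℝ V (pinv A ∘L B).toLinearMap := by
  set J : (V →L[ℝ] W) → ℝ := fun A => A.toLinearMap.normDet with hJ
  have hinv := isInvertible_adjoint_comp hA
  have hJA : 0 < J A := normDet_pos hA
  have hsq : (fun A : V →L[ℝ] W => J A ^ 2) = fun A => (adjointCLM V W A ∘L A).det := by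
    ext A
    have h := A.normDet_sq
    simpa using h
  have hJd : DifferentiableAt ℝ J A := (contDiffAt_normDet hA (k := 1)).differentiableAt (by simp)
  have h1 : fderiv ℝ (fun A : V →L[ℝ] W => J A ^ 2) A B = 2 * J A * fderiv ℝ J A B := by
    rw [fderiv_fun_pow _ hJd]; simp
  have hG : HasFDerivAt (fun A : V →L[ℝ] W => adjointCLM V W A ∘L A)
      (((compL ℝ V W V) (adjointCLM V W A)) +
        ((compL ℝ V W V).flip A).comp (adjointCLM V W)) A := by
    have := (adjointCLM V W).hasFDerivAt (x := A)
    have h := this.clm_comp (hasFDerivAt_id A)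
    simpa using h
  have h2 : fderiv ℝ (fun A : V →L[ℝ] W => J A ^ 2) A B =
      (J A ^ 2) * LinearMap.trace ℝ V
        ((adjoint A ∘L A).inverse ∘L (adjoint A ∘L B + adjoint B ∘L A)).toLinearMap := by
    rw [hsq]
    have hd := ((contDiff_det (V := V) (k := 1)).differentiable (by simp)
      (adjointCLM V W A ∘L A)).hasFDerivAt
    have h := (HasFDerivAt.comp (f := fun A : V →L[ℝ] W => adjointCLM V W A ∘L A) A hd hG).fderiv
    rw [show ((fun G : V →L[ℝ] V => G.det) ∘ fun A : V →L[ℝ] W => adjointCLM V W A ∘L A) =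
      fun A : V →L[ℝ] W => (adjointCLM V W A ∘L A).det from rfl] at h
    rw [h, comp_apply, adjointCLM_apply, fderiv_det hinv]
    congr 1
    exact (congrFun hsq A).symm
  have h3 : LinearMap.trace ℝ V
      ((adjoint A ∘L A).inverse ∘L (adjoint A ∘L B + adjoint B ∘L A)).toLinearMap =
      2 * LinearMap.trace ℝ V (pinv A ∘L B).toLinearMap := by
    have e1 : LinearMap.trace ℝ V ((adjoint A ∘L A).inverse ∘L (adjoint B ∘L A)).toLinearMap =
        LinearMap.trace ℝ V ((adjoint A ∘L B) ∘L (adjoint A ∘L A).inverse).toLinearMap :=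
      trace_eq_of_inner fun v w => by
        simp only [comp_apply (adjoint A ∘L A).inverse]
        rw [inner_inverse_adjoint_comp hA]
        simp only [comp_apply, adjoint_inner_left, adjoint_inner_right]
    have e2 : LinearMap.trace ℝ V ((adjoint A ∘L B) ∘L (adjoint A ∘L A).inverse).toLinearMap =
        LinearMap.trace ℝ V (pinv A ∘L B).toLinearMap := by
      rw [toLinearMap_comp, ← Module.End.mul_eq_comp, LinearMap.trace_mul_comm]
      rfl
    rw [comp_add, toLinearMap_add, map_add, e1, e2, two_mul]
    rfl
  rw [h1, h3] at h2
  have : 2 * J A * (fderiv ℝ J A B - J A * LinearMap.trace ℝ V (pinv A ∘L B).toLinearMap) = 0 := by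
    linarith
  rcases mul_eq_zero.1 this with h | h
  · linarith
  · exact sub_eq_zero.1 h

end Pinv

/-! ### Parametrised hypersurfaces -/

section Local

open ContinuousLinearMap Topology Filter
open scoped InnerProductSpace

variable {V W Y : Type*} [NormedAddCommGroup V] [InnerProductSpace ℝ V] [FiniteDimensional ℝ V]
  [CompleteSpace V] [NormedAddCommGroup W] [InnerProductSpace ℝ W] [FiniteDimensional ℝ W]
  [CompleteSpace W] [NormedAddCommGroup Y] [NormedSpace ℝ Y]

/-- The tangential derivative of `f` along the parametrised surface `X`, as a linear map on the
ambient space: it is the derivative of `f` on tangent vectors and zero on normal vectors. -/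
def grad (X : V → W) (f : V → Y) (z : V) : W →L[ℝ] Y := fderiv ℝ f z ∘L pinv (fderiv ℝ X z)

/-- `X` is a smooth parametrisation on `Ω` of a hypersurface with smooth unit normal `ν`. -/
structure IsLocalHypersurface (Ω : Set V) (X ν : V → W) : Prop where
  isOpen : IsOpen Ω
  smooth : ContDiffOn ℝ ∞ X Ω
  injective : ∀ z ∈ Ω, Function.Injective (fderiv ℝ X z)
  smooth_normal : ContDiffOn ℝ ∞ ν Ω
  unit : ∀ z ∈ Ω, ‖ν z‖ = 1
  normal : ∀ z ∈ Ω, ∀ v, ⟪ν z, fderiv ℝ X z v⟫_ℝ = 0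
  finrank : Module.finrank ℝ W = Module.finrank ℝ V + 1

lemma minSmoothness_two_le : minSmoothness ℝ 2 ≤ (∞ : WithTop ℕ∞) := by
  rw [minSmoothness_of_isRCLikeNormedField]
  exact WithTop.coe_le_coe.2 le_top

lemma contDiffAt_fderiv_of_isOpen {Z : Type*} [NormedAddCommGroup Z] [NormedSpace ℝ Z]
    {Ω : Set Z} (hΩ : IsOpen Ω) {f : Z → Y} (hf : ContDiffOn ℝ ∞ f Ω)
    {z : Z} (hz : z ∈ Ω) : ContDiffAt ℝ ∞ (fderiv ℝ f) z :=
  ((hf.contDiffAt (hΩ.mem_nhds hz)).fderiv_right (by simp))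

namespace IsLocalHypersurface

variable {Ω : Set V} {X ν : V → W} {z : V} {f : V → Y}

lemma contDiffAt (h : IsLocalHypersurface Ω X ν) (hz : z ∈ Ω) : ContDiffAt ℝ ∞ X z :=
  h.smooth.contDiffAt (h.isOpen.mem_nhds hz)

lemma contDiffAt_pinv (h : IsLocalHypersurface Ω X ν) (hz : z ∈ Ω) :
    ContDiffAt ℝ ∞ (fun z => pinv (fderiv ℝ X z)) z :=
  ContDiffAt.comp z (g := pinv) (HypersurfacePoincare.contDiffAt_pinv (h.injective z hz))
    (contDiffAt_fderiv_of_isOpen h.isOpen h.smooth hz)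

lemma contDiffOn_grad (h : IsLocalHypersurface Ω X ν) (hf : ContDiffOn ℝ ∞ f Ω) :
    ContDiffOn ℝ ∞ (grad X f) Ω := fun _ hz =>
  ((contDiffAt_fderiv_of_isOpen h.isOpen hf hz).clm_comp (h.contDiffAt_pinv hz)).contDiffWithinAt

lemma grad_apply (h : IsLocalHypersurface Ω X ν) (hz : z ∈ Ω) (v : V) :
    grad X f z (fderiv ℝ X z v) = fderiv ℝ f z v := by
  rw [grad, comp_apply, pinv_apply_apply (h.injective z hz)]

lemma pinv_normal (h : IsLocalHypersurface Ω X ν) (hz : z ∈ Ω) :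
    pinv (fderiv ℝ X z) (ν z) = 0 :=
  pinv_apply_of_orthogonal (h.normal z hz)

lemma grad_normal (h : IsLocalHypersurface Ω X ν) (hz : z ∈ Ω) : grad X f z (ν z) = 0 := by
  rw [grad, comp_apply, h.pinv_normal hz, map_zero]

/-- The decomposition of an ambient vector into its tangential and normal parts. -/
lemma apply_pinv (h : IsLocalHypersurface Ω X ν) (hz : z ∈ Ω) (a : W) :
    fderiv ℝ X z (pinv (fderiv ℝ X z) a) = a - ⟪ν z, a⟫_ℝ • ν z := by
  set A := fderiv ℝ X z with hA
  have hinj := h.injective z hz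
  have hr : Module.finrank ℝ A.toLinearMap.range = Module.finrank ℝ V :=
    LinearMap.finrank_range_of_inj hinj
  have ho : Module.finrank ℝ A.toLinearMap.rangeᗮ = 1 := by
    have := A.toLinearMap.range.finrank_add_finrank_orthogonal
    have := h.finrank
    omega
  have hν : ν z ∈ A.toLinearMap.rangeᗮ := by
    rintro _ ⟨v, rfl⟩
    rw [real_inner_comm]; exact h.normal z hz v
  have hν0 : ν z ≠ 0 := fun h0 => by simpa [h0] using h.unit z hz
  have hm : a - A (pinv A a) ∈ A.toLinearMap.rangeᗮ := by
    rintro _ ⟨v, rfl⟩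
    rw [real_inner_comm]; exact inner_sub_apply_pinv hinj a v
  obtain ⟨c, hc⟩ := (finrank_eq_one_iff_of_nonzero' (⟨ν z, hν⟩ : A.toLinearMap.rangeᗮ)
    (by simpa using hν0)).1 ho ⟨_, hm⟩
  have hc' : c • ν z = a - A (pinv A a) := congrArg Subtype.val hc
  have hcc : c = ⟪ν z, a⟫_ℝ := by
    have h1 : ⟪ν z, c • ν z⟫_ℝ = ⟪ν z, a⟫_ℝ := by
      rw [hc', inner_sub_right, h.normal z hz, sub_zero]
    rw [inner_smul_right, real_inner_self_eq_norm_sq, h.unit z hz] at h1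
    simpa using h1
  rw [← hcc, hc']; abel

lemma exists_tangent (h : IsLocalHypersurface Ω X ν) (hz : z ∈ Ω) {a : W}
    (ha : ⟪ν z, a⟫_ℝ = 0) : ∃ v, fderiv ℝ X z v = a :=
  ⟨pinv (fderiv ℝ X z) a, by rw [h.apply_pinv hz, ha, zero_smul, sub_zero]⟩

/-- The product rule behind the symmetry of the tangential Hessian. -/
lemma fderiv_grad_apply (h : IsLocalHypersurface Ω X ν) (hf : ContDiffOn ℝ ∞ f Ω) (hz : z ∈ Ω)
    (v w : V) : fderiv ℝ (grad X f) z v (fderiv ℝ X z w) =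
      fderiv ℝ (fderiv ℝ f) z v w - grad X f z (fderiv ℝ (fderiv ℝ X) z v w) := by
  have hd1 : DifferentiableAt ℝ (grad X f) z :=
    ((h.contDiffOn_grad hf).contDiffAt (h.isOpen.mem_nhds hz)).differentiableAt (by simp)
  have hd2 : DifferentiableAt ℝ (fderiv ℝ X) z :=
    (contDiffAt_fderiv_of_isOpen h.isOpen h.smooth hz).differentiableAt (by simp)
  have he : (fun y => grad X f y ∘L fderiv ℝ X y) =ᶠ[𝓝 z] fderiv ℝ f := by
    filter_upwards [h.isOpen.mem_nhds hz] with y hy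
    ext w
    exact h.grad_apply hy w
  have h1 := (hd1.hasFDerivAt.clm_comp hd2.hasFDerivAt).fderiv
  rw [he.fderiv_eq] at h1
  have h2 := congrArg (fun T => T v w) h1
  simp only [add_apply, comp_apply, compL_apply, flip_apply] at h2
  rw [h2]; abel

/-- The tangential Hessian is symmetric on tangent vectors. -/
lemma grad_grad_symm (h : IsLocalHypersurface Ω X ν) (hf : ContDiffOn ℝ ∞ f Ω) (hz : z ∈ Ω)
    {a b : W} (ha : ⟪ν z, a⟫_ℝ = 0) (hb : ⟪ν z, b⟫_ℝ = 0) :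
    grad X (grad X f) z a b = grad X (grad X f) z b a := by
  obtain ⟨v, rfl⟩ := h.exists_tangent hz ha
  obtain ⟨w, rfl⟩ := h.exists_tangent hz hb
  have s1 : IsSymmSndFDerivAt ℝ f z := (hf.contDiffAt (h.isOpen.mem_nhds hz)).isSymmSndFDerivAt
    minSmoothness_two_le
  have s2 : IsSymmSndFDerivAt ℝ X z := (h.contDiffAt hz).isSymmSndFDerivAt
    minSmoothness_two_le
  rw [h.grad_apply hz, h.grad_apply hz, h.fderiv_grad_apply hf hz, h.fderiv_grad_apply hf hz,
    s1.eq v w, s2.eq v w]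

lemma differentiableAt_of_contDiffOn (h : IsLocalHypersurface Ω X ν) (hf : ContDiffOn ℝ ∞ f Ω)
    (hz : z ∈ Ω) : DifferentiableAt ℝ f z :=
  (hf.contDiffAt (h.isOpen.mem_nhds hz)).differentiableAt (by simp)

lemma inner_normal_fderiv_normal (h : IsLocalHypersurface Ω X ν) (hz : z ∈ Ω) (v : V) :
    ⟪ν z, fderiv ℝ ν z v⟫_ℝ = 0 := by
  have hd := h.differentiableAt_of_contDiffOn h.smooth_normal hz
  have he : (fun y => ⟪ν y, ν y⟫_ℝ) =ᶠ[𝓝 z] fun _ => (1 : ℝ) := by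
    filter_upwards [h.isOpen.mem_nhds hz] with y hy
    rw [real_inner_self_eq_norm_sq, h.unit y hy]; norm_num
  have h1 := fderiv_inner_apply ℝ hd hd v
  rw [he.fderiv_eq] at h1
  simp only [fderiv_fun_const, Pi.zero_apply, zero_apply] at h1
  rw [real_inner_comm (ν z)] at h1
  linarith

lemma inner_fderiv_normal_symm (h : IsLocalHypersurface Ω X ν) (hz : z ∈ Ω) (v w : V) :
    ⟪fderiv ℝ ν z v, fderiv ℝ X z w⟫_ℝ = ⟪fderiv ℝ X z v, fderiv ℝ ν z w⟫_ℝ := by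
  have hd := h.differentiableAt_of_contDiffOn h.smooth_normal hz
  have hd2 : DifferentiableAt ℝ (fderiv ℝ X) z :=
    (contDiffAt_fderiv_of_isOpen h.isOpen h.smooth hz).differentiableAt (by simp)
  have s2 : IsSymmSndFDerivAt ℝ X z := (h.contDiffAt hz).isSymmSndFDerivAt
    minSmoothness_two_le
  have key (v w : V) : ⟪ν z, fderiv ℝ (fderiv ℝ X) z v w⟫_ℝ +
      ⟪fderiv ℝ ν z v, fderiv ℝ X z w⟫_ℝ = 0 := by
    have hd3 : HasFDerivAt (fun y => fderiv ℝ X y w) ((fderiv ℝ (fderiv ℝ X) z).flip w) z := by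
      have := hd2.hasFDerivAt.clm_apply (hasFDerivAt_const w z)
      simpa using this
    have he : (fun y => ⟪ν y, fderiv ℝ X y w⟫_ℝ) =ᶠ[𝓝 z] fun _ => (0 : ℝ) := by
      filter_upwards [h.isOpen.mem_nhds hz] with y hy
      exact h.normal y hy w
    have h1 := fderiv_inner_apply ℝ hd hd3.differentiableAt v
    rw [he.fderiv_eq, hd3.fderiv] at h1
    simpa using h1.symm
  have h1 := key v w
  have h2 := key w v
  rw [s2.eq v w] at h1
  rw [real_inner_comm (fderiv ℝ ν z w)]
  linarith

/-- The Weingarten map and its tangential derivative satisfy the pointwise relations. -/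
lemma isCurvatureJet (h : IsLocalHypersurface Ω X ν) (hz : z ∈ Ω) :
    IsCurvatureJet (ν z) (grad X ν z) (grad X (grad X ν) z) := by
  have hsm := h.contDiffOn_grad h.smooth_normal
  have hd := h.differentiableAt_of_contDiffOn h.smooth_normal hz
  have hd1 := h.differentiableAt_of_contDiffOn hsm hz
  have symm : ∀ y ∈ Ω, ∀ a b, ⟪grad X ν y a, b⟫_ℝ = ⟪a, grad X ν y b⟫_ℝ := by
    intro y hy a b
    have e (a b : W) : ⟪grad X ν y a, b⟫_ℝ =
        ⟪fderiv ℝ ν y (pinv (fderiv ℝ X y) a), fderiv ℝ X y (pinv (fderiv ℝ X y) b)⟫_ℝ := by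
      rw [h.apply_pinv hy, inner_sub_right, inner_smul_right, real_inner_comm (ν y),
        h.inner_normal_fderiv_normal hy, mul_zero, sub_zero]
      rfl
    rw [e, h.inner_fderiv_normal_symm hy, real_inner_comm, ← e, real_inner_comm]
  refine ⟨h.unit z hz, symm z hz, h.grad_normal hz, fun a v w => ?_, fun a => ?_, h.grad_normal hz⟩
  · set x := pinv (fderiv ℝ X z) a with hx
    have hv (v : W) : HasFDerivAt (fun y => grad X ν y v) ((fderiv ℝ (grad X ν) z).flip v) z := by
      have := hd1.hasFDerivAt.clm_apply (hasFDerivAt_const v z)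
      simpa using this
    have he : (fun y => ⟪grad X ν y v, w⟫_ℝ) =ᶠ[𝓝 z] fun y => ⟪v, grad X ν y w⟫_ℝ := by
      filter_upwards [h.isOpen.mem_nhds hz] with y hy
      exact symm y hy v w
    have h1 := fderiv_inner_apply ℝ (hv v).differentiableAt (differentiableAt_const w) x
    have h2 := fderiv_inner_apply ℝ (differentiableAt_const v) (hv w).differentiableAt x
    rw [he.fderiv_eq, h2, (hv v).fderiv, (hv w).fderiv] at h1
    simp only [inner_zero_right, inner_zero_left, add_zero, zero_add, flip_apply,
      fderiv_fun_const, Pi.zero_apply, zero_apply] at h1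
    exact h1.symm
  · set x := pinv (fderiv ℝ X z) a with hx
    have he : (fun y => grad X ν y (ν y)) =ᶠ[𝓝 z] fun _ => 0 := by
      filter_upwards [h.isOpen.mem_nhds hz] with y hy
      exact h.grad_normal hy
    have h1 := (hd1.hasFDerivAt.clm_apply hd.hasFDerivAt).fderiv
    rw [he.fderiv_eq] at h1
    have h2 := congrArg (fun T => T x) h1
    simp at h2
    rw [eq_neg_iff_add_eq_zero, add_comm]
    exact h2.symm

/-! #### The divergence of the test field -/

/-- A symmetric operator may be moved between the two slots of the trace of a bilinear form. -/
lemma sum_inner_symm {ι : Type*} [Fintype ι] (E : OrthonormalBasis ι ℝ W) (S : W →L[ℝ] W)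
    (hS : ∀ v w, ⟪S v, w⟫_ℝ = ⟪v, S w⟫_ℝ) (B : W →L[ℝ] W →L[ℝ] ℝ) :
    ∑ a, B (E a) (S (E a)) = ∑ a, B (S (E a)) (E a) := by
  have e (a : ι) : S (E a) = ∑ b, ⟪E b, S (E a)⟫_ℝ • E b := (E.sum_repr' _).symm
  have h1 : ∑ a, B (E a) (S (E a)) = ∑ a, ∑ b, ⟪E b, S (E a)⟫_ℝ * B (E a) (E b) := by
    refine Finset.sum_congr rfl fun a _ => ?_
    conv_lhs => rw [e a]
    simp
  have h2 : ∑ a, B (S (E a)) (E a) = ∑ a, ∑ b, ⟪E b, S (E a)⟫_ℝ * B (E b) (E a) := by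
    refine Finset.sum_congr rfl fun a _ => ?_
    conv_lhs => rw [e a]
    simp
  rw [h1, h2, Finset.sum_comm]
  refine Finset.sum_congr rfl fun b _ => Finset.sum_congr rfl fun a _ => ?_
  rw [← hS, real_inner_comm]

/-- The second derivatives of the Weingarten map cancel in the divergence of the test field: `H` is
the second derivative, symmetric in its first two arguments on tangent vectors, with values in
symmetric operators. -/
lemma sum_second_deriv_eq_zero {ι : Type*} [Fintype ι] (E : OrthonormalBasis ι ℝ W) {N : W}
    (S : W →L[ℝ] W) (hS : ∀ v w, ⟪S v, w⟫_ℝ = ⟪v, S w⟫_ℝ) (hN : ∀ v, ⟪N, S v⟫_ℝ = 0)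
    (H : W →L[ℝ] W →L[ℝ] W →L[ℝ] W)
    (hH : ∀ a b, ⟪N, a⟫_ℝ = 0 → ⟪N, b⟫_ℝ = 0 → H a b = H b a)
    (hH2 : ∀ a b v w, ⟪H a b v, w⟫_ℝ = ⟪v, H a b w⟫_ℝ) :
    ∑ a, ∑ b, ⟪E a, S (H (E a) (E b) (S (S (E b)))) - S (S (H (E a) (E b) (S (E b))))⟫_ℝ = 0 := by
  have hQ : ∀ v w, ⟪(S ∘L S) v, w⟫_ℝ = ⟪v, (S ∘L S) w⟫_ℝ := fun v w => by
    simp only [comp_apply, hS]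
  -- Move `P` and `R` into the slots of differentiation, so that the symmetry of `H` applies.
  have move (P R : W →L[ℝ] W) (hP : ∀ v w, ⟪P v, w⟫_ℝ = ⟪v, P w⟫_ℝ)
      (hR : ∀ v w, ⟪R v, w⟫_ℝ = ⟪v, R w⟫_ℝ) :
      ∑ a, ∑ b, ⟪P (E a), H (E a) (E b) (R (E b))⟫_ℝ =
        ∑ a, ∑ b, ⟪E a, H (P (E a)) (R (E b)) (E b)⟫_ℝ := by
    have h1 (a : ι) : ∑ b, ⟪P (E a), H (E a) (E b) (R (E b))⟫_ℝ =
        ∑ b, ⟪P (E a), H (E a) (R (E b)) (E b)⟫_ℝ :=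
      sum_inner_symm E R hR ((compL ℝ W W ℝ (innerSL ℝ (P (E a)))) ∘L (H (E a)))
    have h2 (b : ι) : ∑ a, ⟪P (E a), H (E a) (R (E b)) (E b)⟫_ℝ =
        ∑ a, ⟪E a, H (P (E a)) (R (E b)) (E b)⟫_ℝ := by
      have := sum_inner_symm E P hP
        ((innerSL ℝ (E := W)).flip ∘L ((H.flip (R (E b))).flip (E b)))
      simp only [comp_apply, flip_apply, innerSL_apply_apply] at this
      exact this
    rw [Finset.sum_congr rfl fun a _ => h1 a, Finset.sum_comm,
      Finset.sum_congr rfl fun b _ => h2 b, Finset.sum_comm]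
  have m1 := move S (S ∘L S) hS hQ
  have m2 := move (S ∘L S) S hQ hS
  simp only [comp_apply] at m1 m2
  have e : ∑ a, ∑ b, ⟪E a, H (S (E a)) (S (S (E b))) (E b)⟫_ℝ =
      ∑ a, ∑ b, ⟪E a, H (S (S (E a))) (S (E b)) (E b)⟫_ℝ := by
    rw [Finset.sum_comm]
    refine Finset.sum_congr rfl fun b _ => Finset.sum_congr rfl fun a _ => ?_
    rw [hH _ _ (hN _) (hN _), ← hH2, real_inner_comm]
  simp only [inner_sub_right, Finset.sum_sub_distrib]
  simp only [← hS]
  rw [m1, m2, e, sub_self]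

/-- The divergence of the test field is an expression in the Weingarten map and its first
derivative. -/
lemma grad_testField_trace (h : IsLocalHypersurface Ω X ν) {ι : Type*} [Fintype ι]
    (E : OrthonormalBasis ι ℝ W) (hz : z ∈ Ω) :
    ∑ a, ⟪E a, grad X (fun y => IsCurvatureJet.testField E (grad X ν y)
      (grad X (grad X ν) y)) z (E a)⟫_ℝ =
      IsCurvatureJet.divExpr E (grad X ν z) (grad X (grad X ν) z) := by
  have hsm := h.contDiffOn_grad h.smooth_normal
  have hsm2 := h.contDiffOn_grad hsm
  have hj := h.isCurvatureJet hz
  set S := grad X ν with hS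
  set D := grad X S with hD
  set H := grad X D with hH
  have dS := (h.differentiableAt_of_contDiffOn hsm hz).hasFDerivAt
  have dD := (h.differentiableAt_of_contDiffOn hsm2 hz).hasFDerivAt
  have hH1 : ∀ a b, ⟪ν z, a⟫_ℝ = 0 → ⟪ν z, b⟫_ℝ = 0 → H z a b = H z b a :=
    fun a b ha hb => h.grad_grad_symm hsm hz ha hb
  have hH2 : ∀ a b v w, ⟪H z a b v, w⟫_ℝ = ⟪v, H z a b w⟫_ℝ := by
    intro a b v w
    set x := pinv (fderiv ℝ X z) a with hx
    have hv (v : W) : HasFDerivAt (fun y => D y b v)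
        (((fderiv ℝ D z).flip b).flip v) z := by
      have := (dD.clm_apply (hasFDerivAt_const b z)).clm_apply (hasFDerivAt_const v z)
      simpa using this
    have he : (fun y => ⟪D y b v, w⟫_ℝ) =ᶠ[𝓝 z] fun y => ⟪v, D y b w⟫_ℝ := by
      filter_upwards [h.isOpen.mem_nhds hz] with y hy
      exact (h.isCurvatureJet hy).deriv_symm b v w
    have h1 := fderiv_inner_apply ℝ (hv v).differentiableAt (differentiableAt_const w) x
    have h2 := fderiv_inner_apply ℝ (differentiableAt_const v) (hv w).differentiableAt x
    rw [he.fderiv_eq, h2, (hv v).fderiv, (hv w).fderiv] at h1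
    simp only [inner_zero_right, inner_zero_left, add_zero, zero_add, flip_apply,
      fderiv_fun_const, Pi.zero_apply, zero_apply] at h1
    exact h1.symm
  have hU (a : W) : grad X (fun y => IsCurvatureJet.testField E (S y) (D y)) z a =
      ∑ b, (D z a (D z (E b) (S z (S z (E b))))
        + S z (D z (E b) (D z a (S z (E b)) + S z (D z a (E b))))
        - (D z a (S z (D z (E b) (S z (E b)))) + S z (D z a (D z (E b) (S z (E b)))))
        - S z (S z (D z (E b) (D z a (E b))))
        + (S z (H z a (E b) (S z (S z (E b)))) - S z (S z (H z a (E b) (S z (E b)))))) := by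
    set x := pinv (fderiv ℝ X z) a with hx
    have hSx : fderiv ℝ S z x = D z a := rfl
    have hDx : fderiv ℝ D z x = H z a := rfl
    have hd : HasFDerivAt (fun y => IsCurvatureJet.testField E (S y) (D y)) _ z :=
      HasFDerivAt.fun_sum fun b _ => (dS.clm_apply
        ((dD.clm_apply (hasFDerivAt_const (E b) z)).clm_apply
          (dS.clm_apply (dS.clm_apply (hasFDerivAt_const (E b) z))))).sub
        (dS.clm_apply (dS.clm_apply
          ((dD.clm_apply (hasFDerivAt_const (E b) z)).clm_apply
            (dS.clm_apply (hasFDerivAt_const (E b) z)))))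
    rw [grad, hd.fderiv, comp_apply, ← hx, sum_apply]
    refine Finset.sum_congr rfl fun b _ => ?_
    simp only [sub_apply, add_apply, comp_apply, flip_apply, zero_apply, map_zero, zero_add,
      hSx, hDx, map_add]
    abel
  simp only [hU, inner_sum]
  have h0 := sum_second_deriv_eq_zero E (S z) hj.symm hj.inner_normal_map (H z) hH1 hH2
  rw [IsCurvatureJet.divExpr, ← sub_eq_zero, ← h0, ← Finset.sum_sub_distrib]
  refine Finset.sum_congr rfl fun a _ => ?_
  rw [← Finset.sum_sub_distrib]
  refine Finset.sum_congr rfl fun b _ => ?_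
  rw [inner_add_right, add_sub_cancel_left]

/-! #### The divergence in coordinates -/

/-- In coordinates, the tangential divergence is `J⁻¹ ∑ ∂ᵢ(J cⁱ)`, with `J` the volume factor. -/
lemma sum_fderiv_normDet_mul (h : IsLocalHypersurface Ω X ν) {ι κ : Type*} [Fintype ι] [Fintype κ]
    (e : OrthonormalBasis ι ℝ V) (E : OrthonormalBasis κ ℝ W) {U : V → W}
    (hU : ContDiffOn ℝ ∞ U Ω) (hUν : ∀ y ∈ Ω, ⟪ν y, U y⟫_ℝ = 0) (hz : z ∈ Ω) :
    ∑ i, fderiv ℝ (fun y => (fderiv ℝ X y).toLinearMap.normDet *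
      ⟪e i, pinv (fderiv ℝ X y) (U y)⟫_ℝ) z (e i) =
      (fderiv ℝ X z).toLinearMap.normDet * ∑ a, ⟪E a, grad X U z (E a)⟫_ℝ := by
  set A := fderiv ℝ X with hA
  set c : V → V := fun y => pinv (A y) (U y) with hc
  set J : V → ℝ := fun y => (A y).toLinearMap.normDet with hJ
  have dA : HasFDerivAt A (fderiv ℝ A z) z :=
    ((contDiffAt_fderiv_of_isOpen h.isOpen h.smooth hz).differentiableAt (by simp)).hasFDerivAt
  have dc : HasFDerivAt c (fderiv ℝ c z) z :=
    (((h.contDiffAt_pinv hz).clm_apply (hU.contDiffAt (h.isOpen.mem_nhds hz))).differentiableAt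
      (by simp)).hasFDerivAt
  have dJ : HasFDerivAt J
      (fderiv ℝ (fun A : V →L[ℝ] W => A.toLinearMap.normDet) (A z) ∘L fderiv ℝ A z) z :=
    HasFDerivAt.comp z (g := fun A : V →L[ℝ] W => A.toLinearMap.normDet)
      (((contDiffAt_normDet (h.injective z hz) (k := 1)).differentiableAt (by simp)).hasFDerivAt) dA
  have s2 : IsSymmSndFDerivAt ℝ X z := (h.contDiffAt hz).isSymmSndFDerivAt
    minSmoothness_two_le
  -- the coordinate divergence, by the product rule and Jacobi's formula
  have h1 (i : ι) : fderiv ℝ (fun y => J y * ⟪e i, c y⟫_ℝ) z (e i) =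
      ⟪e i, c z⟫_ℝ * fderiv ℝ J z (e i) + J z * ⟪e i, fderiv ℝ c z (e i)⟫_ℝ := by
    have hd := ((hasFDerivAt_const (e i) z).inner ℝ dc)
    have := (dJ.mul hd).fderiv
    have h2 : fderiv ℝ (fun y => J y * ⟪e i, c y⟫_ℝ) z = _ := this
    rw [h2, dJ.fderiv]
    simp [fderivInnerCLM_apply]
    ring
  have h2 : ∑ i, ⟪e i, c z⟫_ℝ * fderiv ℝ J z (e i) =
      J z * LinearMap.trace ℝ V (pinv (A z) ∘L fderiv ℝ A z (c z)).toLinearMap := by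
    have e1 : ∑ i, ⟪e i, c z⟫_ℝ * fderiv ℝ J z (e i) = fderiv ℝ J z (c z) := by
      conv_rhs => rw [← e.sum_repr' (c z)]
      simp
    rw [e1, dJ.fderiv, comp_apply, fderiv_normDet (h.injective z hz)]
  -- the tangential divergence
  have h3 : ∑ a, ⟪E a, grad X U z (E a)⟫_ℝ =
      LinearMap.trace ℝ V (pinv (A z) ∘L fderiv ℝ U z).toLinearMap := by
    have := LinearMap.trace_eq_sum_inner (grad X U z).toLinearMap E
    simp only [coe_coe] at this
    rw [← this, grad, toLinearMap_comp, toLinearMap_comp, LinearMap.trace_comp_comm']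
  have h4 : pinv (A z) ∘L fderiv ℝ U z =
      pinv (A z) ∘L fderiv ℝ A z (c z) + fderiv ℝ c z := by
    have he : U =ᶠ[𝓝 z] fun y => A y (c y) := by
      filter_upwards [h.isOpen.mem_nhds hz] with y hy
      have := h.apply_pinv hy (U y)
      rw [hUν y hy, zero_smul, sub_zero] at this
      exact this.symm
    have h5 := (dA.clm_apply dc).fderiv
    rw [he.fderiv_eq]
    ext v : 1
    rw [comp_apply, h5]
    simp only [add_apply, comp_apply, flip_apply, map_add]
    rw [pinv_apply_apply (h.injective z hz), hA, s2.eq v (c z), add_comm]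
  rw [Finset.sum_congr rfl fun i _ => h1 i, Finset.sum_add_distrib, h2, h3, h4, toLinearMap_add,
    map_add, mul_add, LinearMap.trace_eq_sum_inner (fderiv ℝ c z).toLinearMap e, Finset.mul_sum]
  rfl

end IsLocalHypersurface

end Local

/-! ### Tangential derivatives on an immersed hypersurface -/

section Hypersurface

open ContinuousLinearMap Topology Filter
open scoped InnerProductSpace

variable {n : ℕ} {M : Type*} [TopologicalSpace M] [ChartedSpace (E n) M]
  {Y : Type*} [NormedAddCommGroup Y] [NormedSpace ℝ Y]

/-- The differential at `x` of a map from `M` to a normed space. -/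
def diffAt (f : M → Y) (x : M) : E n →L[ℝ] Y := mfderiv (𝓡 n) 𝓘(ℝ, Y) f x

/-- The tangential derivative of `f` along the immersion `X`, as a linear map on the ambient space
that is zero on normal vectors. -/
def tgrad (X : M → E (n + 1)) (f : M → Y) (x : M) : E (n + 1) →L[ℝ] Y :=
  diffAt f x ∘L pinv (diff X x)

/-- The representation of a function in the preferred chart at `p`. -/
def inChart (p : M) (f : M → Y) (z : E n) : Y := f ((chartAt (E n) p).symm z)

variable [IsManifold (𝓡 n) ∞ M] {X ν : M → E (n + 1)} {f : M → Y} {p : M} {z : E n}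

lemma contMDiff_iff_inChart :
    ContMDiff (𝓡 n) 𝓘(ℝ, Y) ∞ f ↔
      ∀ p : M, ContDiffOn ℝ ∞ (inChart p f) (chartAt (E n) p).target := by
  constructor
  · intro hf p
    have h := hf.comp_contMDiffOn (contMDiffOn_chart_symm (I := 𝓡 n) (n := ∞) (x := p))
    exact contMDiffOn_iff_contDiffOn.1 h
  · intro hf x
    have h1 : ContMDiffOn (𝓡 n) 𝓘(ℝ, Y) ∞ (inChart x f) (chartAt (E n) x).target :=
      contMDiffOn_iff_contDiffOn.2 (hf x)
    have h2 := h1.comp (contMDiffOn_chart (I := 𝓡 n) (n := ∞) (x := x))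
      fun y hy => (chartAt (E n) x).map_source hy
    have hx : (chartAt (E n) x).source ∈ 𝓝 x := (chartAt (E n) x).open_source.mem_nhds
      (mem_chart_source _ x)
    refine ContMDiffAt.congr_of_eventuallyEq (h2.contMDiffAt hx) ?_
    filter_upwards [hx] with y hy
    simp only [inChart, Function.comp_apply]
    rw [(chartAt (E n) x).left_inv hy]

/-- The differential at `z` of the inverse of the preferred chart at `p`. -/
def chartSymmDiff (p : M) (z : E n) : E n →L[ℝ] E n :=
  mfderiv (𝓡 n) (𝓡 n) (chartAt (E n) p).symm z

lemma bijective_chartSymmDiff (hz : z ∈ (chartAt (E n) p).target) :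
    Function.Bijective (chartSymmDiff p z) :=
  (mdifferentiable_chart (I := 𝓡 n) p).symm.mfderiv_bijective hz

/-- The differential on `M` and the derivative in coordinates. -/
lemma diffAt_comp_chartSymmDiff (hf : ContMDiff (𝓡 n) 𝓘(ℝ, Y) ∞ f)
    (hz : z ∈ (chartAt (E n) p).target) :
    diffAt f ((chartAt (E n) p).symm z) ∘L chartSymmDiff p z = fderiv ℝ (inChart p f) z := by
  have hc := (mdifferentiable_chart (I := 𝓡 n) p).symm
  have h1 : MDifferentiableAt (𝓡 n) 𝓘(ℝ, Y) f ((chartAt (E n) p).symm z) :=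
    (hf _).mdifferentiableAt (by simp)
  have h2 := mfderiv_comp z h1 (hc.mdifferentiableAt hz)
  have h3 : mfderiv (𝓡 n) 𝓘(ℝ, Y) (f ∘ (chartAt (E n) p).symm) z =
    fderiv ℝ (inChart p f) z := mfderiv_eq_fderiv
  exact (h3.symm.trans h2).symm

lemma diff_comp_chartSymmDiff (hX : ContMDiff (𝓡 n) 𝓘(ℝ, E (n + 1)) ∞ X)
    (hz : z ∈ (chartAt (E n) p).target) :
    diff X ((chartAt (E n) p).symm z) ∘L chartSymmDiff p z = fderiv ℝ (param X p) z :=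
  diffAt_comp_chartSymmDiff hX hz

lemma IsHypersurface.isLocalHypersurface (h : IsHypersurface X ν) (p : M) :
    IsLocalHypersurface (chartAt (E n) p).target (param X p) (inChart p ν) where
  isOpen := (chartAt (E n) p).open_target
  smooth := contMDiff_iff_inChart.1 h.smooth p
  smooth_normal := contMDiff_iff_inChart.1 h.smooth_normal p
  injective := fun z hz => by
    rw [← diff_comp_chartSymmDiff h.smooth hz]
    exact (h.immersion _).comp (bijective_chartSymmDiff hz).1
  unit := fun z _ => h.unit _
  normal := fun z hz v => by
    rw [← diff_comp_chartSymmDiff h.smooth hz]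
    exact h.normal _ _
  finrank := by simp

lemma tgrad_symm (h : IsHypersurface X ν) (hf : ContMDiff (𝓡 n) 𝓘(ℝ, Y) ∞ f) (p : M)
    (hz : z ∈ (chartAt (E n) p).target) :
    tgrad X f ((chartAt (E n) p).symm z) = grad (param X p) (inChart p f) z := by
  rw [tgrad, grad, ← diffAt_comp_chartSymmDiff hf hz, ← diff_comp_chartSymmDiff h.smooth hz,
    comp_assoc, comp_pinv_comp (h.immersion _) _ (bijective_chartSymmDiff hz)]

lemma inChart_tgrad (h : IsHypersurface X ν) (hf : ContMDiff (𝓡 n) 𝓘(ℝ, Y) ∞ f) (p : M) :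
    Set.EqOn (inChart p (tgrad X f)) (grad (param X p) (inChart p f)) (chartAt (E n) p).target :=
  fun _ hz => tgrad_symm h hf p hz

lemma contMDiff_tgrad (h : IsHypersurface X ν) (hf : ContMDiff (𝓡 n) 𝓘(ℝ, Y) ∞ f) :
    ContMDiff (𝓡 n) 𝓘(ℝ, E (n + 1) →L[ℝ] Y) ∞ (tgrad X f) :=
  contMDiff_iff_inChart.2 fun p =>
    ((h.isLocalHypersurface p).contDiffOn_grad (contMDiff_iff_inChart.1 hf p)).congr
      (inChart_tgrad h hf p)

lemma grad_congr {V W : Type*} [NormedAddCommGroup V] [InnerProductSpace ℝ V]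
    [CompleteSpace V] [NormedAddCommGroup W] [InnerProductSpace ℝ W]
    [CompleteSpace W] {Ω : Set V} (hΩ : IsOpen Ω) {X : V → W} {f g : V → Y}
    (hfg : Set.EqOn f g Ω) {z : V} (hz : z ∈ Ω) : grad X f z = grad X g z := by
  have : f =ᶠ[𝓝 z] g := by filter_upwards [hΩ.mem_nhds hz] with y hy using hfg hy
  rw [grad, grad, this.fderiv_eq]

lemma tgrad_tgrad_symm (h : IsHypersurface X ν) (hf : ContMDiff (𝓡 n) 𝓘(ℝ, Y) ∞ f) (p : M)
    (hz : z ∈ (chartAt (E n) p).target) :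
    tgrad X (tgrad X f) ((chartAt (E n) p).symm z) =
      grad (param X p) (grad (param X p) (inChart p f)) z := by
  rw [tgrad_symm h (contMDiff_tgrad h hf) p hz]
  exact grad_congr (chartAt (E n) p).open_target (inChart_tgrad h hf p) hz

lemma symm_chartAt (x : M) : (chartAt (E n) x).symm (chartAt (E n) x x) = x :=
  (chartAt (E n) x).left_inv (mem_chart_source _ x)

lemma chartAt_mem_target (x : M) : chartAt (E n) x x ∈ (chartAt (E n) x).target :=
  (chartAt (E n) x).map_source (mem_chart_source _ x)

lemma IsHypersurface.isCurvatureJet (h : IsHypersurface X ν) (x : M) :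
    IsCurvatureJet (ν x) (tgrad X ν x) (tgrad X (tgrad X ν) x) := by
  have hj := (h.isLocalHypersurface x).isCurvatureJet (chartAt_mem_target x)
  rw [← tgrad_symm h h.smooth_normal x (chartAt_mem_target x),
    ← tgrad_tgrad_symm h h.smooth_normal x (chartAt_mem_target x)] at hj
  simpa only [inChart, symm_chartAt] using hj

lemma tgrad_apply_diff (h : IsHypersurface X ν) (x : M) (v : E n) :
    tgrad X f x (diff X x v) = diffAt f x v := by
  rw [tgrad, comp_apply, pinv_apply_apply (h.immersion x)]

lemma pinv_diff_eq_sum (h : IsHypersurface X ν) {x : M} {b : Fin n → E n} (hb : IsFrame X x b)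
    (a : E (n + 1)) : pinv (diff X x) a = ∑ k, ⟪diff X x (b k), a⟫_ℝ • b k := by
  set L : E (n + 1) →L[ℝ] E n := ∑ k, (innerSL ℝ (diff X x (b k))).smulRight (b k) with hL
  have hLa (a : E (n + 1)) : L a = ∑ k, ⟪diff X x (b k), a⟫_ℝ • b k := by
    simp [hL]
  have hb' : LinearIndependent ℝ b :=
    LinearIndependent.of_comp (diff X x).toLinearMap (Orthonormal.linearIndependent hb)
  have hspan : Submodule.span ℝ (Set.range b) = ⊤ :=
    hb'.span_eq_top_of_card_eq_finrank' (by simp)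
  have h1 : ∀ v, L (diff X x v) = v := by
    intro v
    have hv : v ∈ Submodule.span ℝ (Set.range b) := by rw [hspan]; trivial
    induction hv using Submodule.span_induction with
    | mem v hv =>
      obtain ⟨j, rfl⟩ := hv
      rw [hLa, Finset.sum_eq_single j]
      · rw [real_inner_self_eq_norm_sq, hb.1 j]; simp
      · intro k _ hk; rw [hb.2 hk, zero_smul]
      · simp
    | zero => simp
    | add v w _ _ hv hw => rw [map_add, map_add, hv, hw]
    | smul c v _ hv => rw [map_smul, map_smul, hv]
  have h2 : L = pinv (diff X x) := eq_pinv (h.immersion x) h1 fun a ha => by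
    rw [hLa]
    refine Finset.sum_eq_zero fun k _ => ?_
    rw [real_inner_comm, ha, zero_smul]
  rw [← h2, hLa]

lemma isFrame_frame (h : IsHypersurface X ν) (x : M) : IsFrame X x (frame X x) :=
  Classical.epsilon_spec (exists_isFrame X x (h.immersion x))

lemma ambientWeingarten_eq (h : IsHypersurface X ν) : ambientWeingarten X ν = tgrad X ν := by
  ext1 x
  ext1 a
  rw [tgrad, comp_apply, pinv_diff_eq_sum h (isFrame_frame h x), map_sum, ambientWeingarten]
  simp only [sum_apply, smulRight_apply, innerSL_apply_apply, map_smul]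
  rfl

lemma secondForm_eq (h : IsHypersurface X ν) (x : M) (v w : E n) :
    secondForm X ν x v w = ⟪tgrad X ν x (diff X x v), diff X x w⟫_ℝ := by
  rw [tgrad_apply_diff h]; rfl

lemma covDerivA_eq (h : IsHypersurface X ν) (x : M) (u v w : E n) :
    covDerivA X ν x u v w =
      ⟪tgrad X (tgrad X ν) x (diff X x u) (diff X x v), diff X x w⟫_ℝ := by
  rw [tgrad_apply_diff h, covDerivA, ambientWeingarten_eq h]; rfl

/-! #### Adapted orthonormal bases -/

/-- The orthonormal basis of the ambient space formed by an orthonormal basis of the tangent space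
and the normal. -/
lemma exists_adapted_basis (h : IsHypersurface X ν) {x : M} {b : Fin n → E n}
    (hb : IsFrame X x b) : ∃ e : OrthonormalBasis (Fin n ⊕ Unit) ℝ (E (n + 1)),
      (∀ k, e (Sum.inl k) = diff X x (b k)) ∧ e (Sum.inr ()) = ν x := by
  set v : Fin n ⊕ Unit → E (n + 1) := Sum.elim (fun k => diff X x (b k)) fun _ => ν x with hv
  have ho : Orthonormal ℝ v := by
    constructor
    · rintro (k | _)
      · exact hb.1 k
      · exact h.unit x
    · rintro (k | _) (l | _) hkl
      · exact hb.2 fun hh => hkl (by rw [hh])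
      · simp only [hv, Sum.elim_inl, Sum.elim_inr]
        rw [real_inner_comm]; exact h.normal x _
      · exact h.normal x _
      · exact absurd rfl hkl
  refine ⟨OrthonormalBasis.mk ho ?_, fun k => by simp [hv], by simp [hv]⟩
  rw [ho.linearIndependent.span_eq_top_of_card_eq_finrank' (by simp)]

lemma sum_inner_eq_of_normal (h : IsHypersurface X ν) {x : M} {b : Fin n → E n}
    (hb : IsFrame X x b) {ι : Type*} [Fintype ι] (e : OrthonormalBasis ι ℝ (E (n + 1)))
    (T : E (n + 1) →L[ℝ] E (n + 1)) (hT : T (ν x) = 0) :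
    ∑ a, ⟪e a, T (e a)⟫_ℝ = ∑ k, ⟪diff X x (b k), T (diff X x (b k))⟫_ℝ := by
  obtain ⟨e', h1, h2⟩ := exists_adapted_basis h hb
  have h3 := LinearMap.trace_eq_sum_inner T.toLinearMap e
  rw [LinearMap.trace_eq_sum_inner T.toLinearMap e', Fintype.sum_sum_type] at h3
  simp only [coe_coe, h1, h2, hT, inner_zero_right, Finset.univ_unique, Finset.sum_const_zero,
    add_zero, PUnit.default_eq_unit] at h3
  exact h3.symm

lemma eq_sum_of_tangent (h : IsHypersurface X ν) {x : M} {b : Fin n → E n}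
    (hb : IsFrame X x b) {a : E (n + 1)} (ha : ⟪ν x, a⟫_ℝ = 0) :
    a = ∑ k, ⟪diff X x (b k), a⟫_ℝ • diff X x (b k) := by
  obtain ⟨e', h1, h2⟩ := exists_adapted_basis h hb
  have h3 := (e'.sum_repr' a).symm
  rw [Fintype.sum_sum_type] at h3
  simpa [h1, h2, ha] using h3

lemma inner_eq_sum_of_tangent (h : IsHypersurface X ν) {x : M} {b : Fin n → E n}
    (hb : IsFrame X x b) {a : E (n + 1)} (ha : ⟪ν x, a⟫_ℝ = 0) (c : E (n + 1)) :
    ⟪a, c⟫_ℝ = ∑ k, ⟪diff X x (b k), a⟫_ℝ * ⟪diff X x (b k), c⟫_ℝ := by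
  conv_lhs => rw [eq_sum_of_tangent h hb ha]
  simp [sum_inner, inner_smul_left]

lemma sum_sq_inner_le {x : M} {b : Fin n → E n}
    (hb : IsFrame X x b) (a : E (n + 1)) : ∑ k, ⟪diff X x (b k), a⟫_ℝ ^ 2 ≤ ‖a‖ ^ 2 := by
  have := Orthonormal.sum_inner_products_le (x := a) (s := Finset.univ) hb
  simpa using this

/-- A linear function of tangent vectors that is extended by zero to normal vectors is bounded by
its values on an orthonormal basis of the tangent space. -/
lemma norm_sq_le_of_eq_sum {x : M} {b : Fin n → E n}
    (hb : IsFrame X x b) (L : E (n + 1) → Y) (a : E (n + 1))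
    (hL : L a = ∑ k, ⟪diff X x (b k), a⟫_ℝ • L (diff X x (b k))) :
    ‖L a‖ ^ 2 ≤ (∑ k, ‖L (diff X x (b k))‖ ^ 2) * ‖a‖ ^ 2 := by
  have h1 : ‖L a‖ ≤ ∑ k, |⟪diff X x (b k), a⟫_ℝ| * ‖L (diff X x (b k))‖ := by
    rw [hL]
    refine (norm_sum_le _ _).trans (le_of_eq (Finset.sum_congr rfl fun k _ => ?_))
    rw [norm_smul, Real.norm_eq_abs]
  calc ‖L a‖ ^ 2 ≤ (∑ k, |⟪diff X x (b k), a⟫_ℝ| * ‖L (diff X x (b k))‖) ^ 2 := by gcongr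
    _ ≤ (∑ k, |⟪diff X x (b k), a⟫_ℝ| ^ 2) * ∑ k, ‖L (diff X x (b k))‖ ^ 2 :=
      Finset.sum_mul_sq_le_sq_mul_sq _ _ _
    _ = (∑ k, ⟪diff X x (b k), a⟫_ℝ ^ 2) * ∑ k, ‖L (diff X x (b k))‖ ^ 2 := by
      simp only [sq_abs]
    _ ≤ ‖a‖ ^ 2 * ∑ k, ‖L (diff X x (b k))‖ ^ 2 := by
      gcongr; exact sum_sq_inner_le hb a
    _ = _ := mul_comm _ _

section Frame

variable (h : IsHypersurface X ν) {x : M} {b : Fin n → E n} (hb : IsFrame X x b)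
include h hb

lemma map_frame_eq_sum (k : Fin n) : tgrad X ν x (diff X x (b k)) =
    ∑ j, curvatureMatrix X ν x b k j • diff X x (b j) := by
  have hj := h.isCurvatureJet x
  conv_lhs => rw [eq_sum_of_tangent h hb (hj.inner_normal_map (diff X x (b k)))]
  refine Finset.sum_congr rfl fun j _ => ?_
  rw [curvatureMatrix, Matrix.of_apply, secondForm_eq h, real_inner_comm]

lemma map_map_frame_eq_sum (k : Fin n) : tgrad X ν x (tgrad X ν x (diff X x (b k))) =
    ∑ j, (curvatureMatrix X ν x b * curvatureMatrix X ν x b) k j • diff X x (b j) := by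
  rw [map_frame_eq_sum h hb, map_sum]
  simp only [map_smul, map_frame_eq_sum h hb, Finset.smul_sum, smul_smul, Matrix.mul_apply,
    Finset.sum_smul]
  rw [Finset.sum_comm]

lemma inner_sum_frame (α β : Fin n → ℝ) :
    ⟪∑ j, α j • diff X x (b j), ∑ j, β j • diff X x (b j)⟫_ℝ = ∑ j, α j * β j := by
  rw [Orthonormal.inner_sum hb]; simp

lemma sum_inner_map_eq_curvatureMatrix {ι : Type*} [Fintype ι]
    (e : OrthonormalBasis ι ℝ (E (n + 1))) :
    ∑ a, ⟪tgrad X ν x (e a), tgrad X ν x (e a)⟫_ℝ = ∑ i, ∑ j, curvatureMatrix X ν x b i j ^ 2 := by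
  have hj := h.isCurvatureJet x
  have s2 (v : E (n + 1)) : ⟪v, tgrad X ν x (tgrad X ν x v)⟫_ℝ =
      ⟪tgrad X ν x v, tgrad X ν x v⟫_ℝ := (hj.symm _ _).symm
  have := sum_inner_eq_of_normal h hb e (tgrad X ν x ∘L tgrad X ν x) (by simp [hj.map_normal])
  simp only [comp_apply, s2] at this
  rw [this]
  refine Finset.sum_congr rfl fun k _ => ?_
  rw [map_frame_eq_sum h hb, inner_sum_frame h hb]
  simp only [sq]

/-- The traces of the powers of the ambient Weingarten map, in terms of the matrix of `A`. -/
lemma sum_inner_eq_curvatureMatrix {ι : Type*} [Fintype ι]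
    (e : OrthonormalBasis ι ℝ (E (n + 1))) :
    (∑ a, ⟪tgrad X ν x (e a), tgrad X ν x (e a)⟫_ℝ) *
        (∑ a, ⟪tgrad X ν x (tgrad X ν x (e a)), tgrad X ν x (tgrad X ν x (e a))⟫_ℝ)
        - (∑ a, ⟪tgrad X ν x (tgrad X ν x (e a)), tgrad X ν x (e a)⟫_ℝ) ^ 2 =
      discr (curvatureMatrix X ν x b) := by
  have hj := h.isCurvatureJet x
  set S := tgrad X ν x with hS
  have s3 (v : E (n + 1)) : ⟪v, S (S (S v))⟫_ℝ = ⟪S (S v), S v⟫_ℝ := by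
    rw [← hj.symm, ← hj.symm]
  have s4 (v : E (n + 1)) : ⟪v, S (S (S (S v)))⟫_ℝ = ⟪S (S v), S (S v)⟫_ℝ := by
    rw [← hj.symm, ← hj.symm]
  have e2 := sum_inner_map_eq_curvatureMatrix h hb e
  have e3 : ∑ a, ⟪S (S (e a)), S (e a)⟫_ℝ = ∑ i, ∑ j,
      (curvatureMatrix X ν x b * curvatureMatrix X ν x b) i j * curvatureMatrix X ν x b i j := by
    have := sum_inner_eq_of_normal h hb e (S ∘L S ∘L S) (by simp [hj.map_normal])
    simp only [comp_apply, s3] at this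
    rw [this]
    refine Finset.sum_congr rfl fun k _ => ?_
    rw [hS, map_map_frame_eq_sum h hb, map_frame_eq_sum h hb, inner_sum_frame h hb]
  have e4 : ∑ a, ⟪S (S (e a)), S (S (e a))⟫_ℝ = ∑ i, ∑ j,
      (curvatureMatrix X ν x b * curvatureMatrix X ν x b) i j ^ 2 := by
    have := sum_inner_eq_of_normal h hb e (S ∘L S ∘L S ∘L S) (by simp [hj.map_normal])
    simp only [comp_apply, s4] at this
    rw [this]
    refine Finset.sum_congr rfl fun k _ => ?_
    rw [hS, map_map_frame_eq_sum h hb, inner_sum_frame h hb]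
    simp only [sq]
  rw [e2, e3, e4, discr]

lemma trace_curvatureMatrix_eq {ι : Type*} [Fintype ι] (e : OrthonormalBasis ι ℝ (E (n + 1))) :
    ∑ a, ⟪e a, tgrad X ν x (e a)⟫_ℝ = (curvatureMatrix X ν x b).trace := by
  rw [sum_inner_eq_of_normal h hb e _ (h.isCurvatureJet x).map_normal, Matrix.trace]
  refine Finset.sum_congr rfl fun k _ => ?_
  rw [Matrix.diag, curvatureMatrix, Matrix.of_apply, secondForm_eq h, real_inner_comm]

lemma norm_map_le (v : E (n + 1)) : ‖tgrad X ν x v‖ ≤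
    Real.sqrt (∑ i, ∑ j, curvatureMatrix X ν x b i j ^ 2) * ‖v‖ := by
  have hj := h.isCurvatureJet x
  have h1 := norm_sq_le_of_eq_sum hb (fun v => tgrad X ν x v) v (by
    obtain ⟨e', h1, h2⟩ := exists_adapted_basis h hb
    have h3 := congrArg (tgrad X ν x) (e'.sum_repr' v).symm
    rw [Fintype.sum_sum_type, map_add, map_sum, map_sum] at h3
    simpa [h1, h2, hj.map_normal] using h3)
  have h2 : ∑ k, ‖tgrad X ν x (diff X x (b k))‖ ^ 2 =
      ∑ i, ∑ j, curvatureMatrix X ν x b i j ^ 2 := by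
    refine Finset.sum_congr rfl fun k _ => ?_
    rw [← real_inner_self_eq_norm_sq, map_frame_eq_sum h hb, inner_sum_frame h hb]
    simp only [sq]
  rw [h2] at h1
  refine abs_le_of_sq_le_sq' ?_ (by positivity) |>.2
  rw [mul_pow, Real.sq_sqrt (by positivity)]
  exact h1

/-- The covariant derivative of the second fundamental form bounds `covPart`. -/
lemma norm_covPart_le (a v : E (n + 1)) :
    ‖covPart (ν x) (tgrad X ν x) (tgrad X (tgrad X ν) x) a v‖ ≤
      Real.sqrt (∑ k, ∑ i, ∑ j, covDerivA X ν x (b k) (b i) (b j) ^ 2) * ‖a‖ * ‖v‖ := by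
  have hj := h.isCurvatureJet x
  set S := tgrad X ν x with hS
  set D := tgrad X (tgrad X ν) x with hD
  set w := covPart (ν x) S D with hw
  obtain ⟨e', h1, h2⟩ := exists_adapted_basis h hb
  have hsmul1 (c : ℝ) (a v : E (n + 1)) : w (c • a) v = c • w a v := by
    simp only [hw, covPart, map_smul, smul_apply, inner_smul_left, smul_add]
    simp [smul_smul, mul_comm]
  have hadd1 (a a' v : E (n + 1)) : w (a + a') v = w a v + w a' v := by
    simp only [hw, covPart, map_add, add_apply, inner_add_left, smul_add, add_smul]
    abel
  have hsmul2 (c : ℝ) (a v : E (n + 1)) : w a (c • v) = c • w a v := by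
    simp only [hw, covPart, map_smul, inner_smul_right, smul_add, smul_smul]
  have hadd2 (a v v' : E (n + 1)) : w a (v + v') = w a v + w a v' := by
    simp only [hw, covPart, map_add, inner_add_right, add_smul]
    abel
  have hx1 : ∀ v, w a v = ∑ k, ⟪diff X x (b k), a⟫_ℝ • w (diff X x (b k)) v := by
    intro v
    let L : E (n + 1) →ₗ[ℝ] E (n + 1) :=
      { toFun := fun a => w a v, map_add' := fun a a' => hadd1 a a' v,
        map_smul' := fun c a => hsmul1 c a v }
    have h3 := congrArg L (e'.sum_repr' a).symm
    rw [Fintype.sum_sum_type, map_add, map_sum, map_sum] at h3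
    have h4 : L (ν x) = 0 := hj.covPart_normal_left v
    simp only [h1, h2, map_smul, h4, smul_zero, Finset.sum_const_zero, add_zero] at h3
    exact h3
  have hx2 : ∀ a, w a v = ∑ k, ⟪diff X x (b k), v⟫_ℝ • w a (diff X x (b k)) := by
    intro a
    let L : E (n + 1) →ₗ[ℝ] E (n + 1) :=
      { toFun := fun v => w a v, map_add' := fun v v' => hadd2 a v v',
        map_smul' := fun c v => hsmul2 c a v }
    have h3 := congrArg L (e'.sum_repr' v).symm
    rw [Fintype.sum_sum_type, map_add, map_sum, map_sum] at h3
    have h4 : L (ν x) = 0 := hj.covPart_normal a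
    simp only [h1, h2, map_smul, h4, smul_zero, Finset.sum_const_zero, add_zero] at h3
    exact h3
  have k1 := norm_sq_le_of_eq_sum hb (fun a => w a v) a (hx1 v)
  have k2 (k : Fin n) := norm_sq_le_of_eq_sum hb (fun v => w (diff X x (b k)) v) v
    (hx2 (diff X x (b k)))
  have k3 (k i : Fin n) : ‖w (diff X x (b k)) (diff X x (b i))‖ ^ 2 =
      ∑ j, covDerivA X ν x (b k) (b i) (b j) ^ 2 := by
    rw [← real_inner_self_eq_norm_sq, inner_eq_sum_of_tangent h hb (hj.inner_normal_covPart _ _)]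
    refine Finset.sum_congr rfl fun j _ => ?_
    rw [sq, covDerivA_eq h, ← hD, real_inner_comm]
    have : ⟪w (diff X x (b k)) (diff X x (b i)), diff X x (b j)⟫_ℝ =
        ⟪D (diff X x (b k)) (diff X x (b i)), diff X x (b j)⟫_ℝ := by
      simp only [hw, covPart, inner_add_left, inner_smul_left, h.normal]
      simp
    rw [this]
  simp only [k3] at k2
  refine abs_le_of_sq_le_sq' ?_ (by positivity) |>.2
  rw [mul_pow, mul_pow, Real.sq_sqrt (by positivity)]
  calc _ ≤ (∑ k, ‖w (diff X x (b k)) v‖ ^ 2) * ‖a‖ ^ 2 := k1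
    _ ≤ (∑ k, (∑ i, ∑ j, covDerivA X ν x (b k) (b i) (b j) ^ 2) * ‖v‖ ^ 2) * ‖a‖ ^ 2 := by
      gcongr with k _; exact k2 k
    _ = _ := by rw [← Finset.sum_mul]; ring

end Frame

end Hypersurface

/-! ### The induced measure in charts -/

section InducedMeasure

open ContinuousLinearMap Topology Filter
open scoped InnerProductSpace

variable {n : ℕ} {M : Type*} [TopologicalSpace M] [ChartedSpace (E n) M] [IsManifold (𝓡 n) ∞ M]
  [MeasurableSpace M] [BorelSpace M] {X ν : M → E (n + 1)}
  {Y : Type*} [NormedAddCommGroup Y] [NormedSpace ℝ Y]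

/-- The density of the induced measure in the preferred chart at `p`. -/
def density (X : M → E (n + 1)) (p : M) (z : E n) : ℝ :=
  (fderiv ℝ (param X p) z).toLinearMap.normDet

lemma sqrt_det_gram (X : M → E (n + 1)) (p : M) (z : E n) :
    Real.sqrt (gram X p z).det = density X p z := by
  have h := LinearMap.normDet_sq_eq_det_gram (fderiv ℝ (param X p) z).toLinearMap
    (EuclideanSpace.basisFun (Fin n) ℝ)
  have h2 : gram X p z = Matrix.gram ℝ
      (fun i => (fderiv ℝ (param X p) z).toLinearMap (EuclideanSpace.basisFun (Fin n) ℝ i)) := by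
    ext i j
    simp [gram, Matrix.gram]
  rw [h2, ← h]
  exact Real.sqrt_sq (LinearMap.normDet_nonneg _)

lemma density_nonneg (p : M) (z : E n) : 0 ≤ density X p z := LinearMap.normDet_nonneg _

lemma density_pos (h : IsHypersurface X ν) {p : M} {z : E n}
    (hz : z ∈ (chartAt (E n) p).target) : 0 < density X p z :=
  normDet_pos ((h.isLocalHypersurface p).injective z hz)

lemma contDiffOn_density (h : IsHypersurface X ν) (p : M) :
    ContDiffOn ℝ ∞ (density X p) (chartAt (E n) p).target := by
  have hl := h.isLocalHypersurface p
  intro z hz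
  exact (ContDiffAt.comp z (g := fun A : E n →L[ℝ] E (n + 1) => A.toLinearMap.normDet)
    (contDiffAt_normDet (hl.injective z hz))
    (contDiffAt_fderiv_of_isOpen hl.isOpen hl.smooth hz)).contDiffWithinAt

lemma measurableSet_target (p : M) : MeasurableSet (chartAt (E n) p).target :=
  (chartAt (E n) p).open_target.measurableSet

lemma aemeasurable_symm (p : M) :
    AEMeasurable (chartAt (E n) p).symm (volume.restrict (chartAt (E n) p).target) :=
  (chartAt (E n) p).continuousOn_symm.aemeasurable (measurableSet_target p)

lemma measurableSet_symm_preimage (p : M) {s : Set M} (hs : MeasurableSet s) :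
    MeasurableSet ((chartAt (E n) p).symm ⁻¹' s ∩ (chartAt (E n) p).target) := by
  have h1 : Measurable ((chartAt (E n) p).target.domRestrict (chartAt (E n) p).symm) :=
    (continuousOn_iff_continuous_domRestrict.1 (chartAt (E n) p).continuousOn_symm).measurable
  have h2 := (measurableSet_target p).subtype_image (h1 hs)
  convert h2 using 1
  ext z
  simp only [Set.mem_inter_iff, Set.mem_preimage, Set.mem_image, Set.domRestrict_apply,
    Subtype.exists, exists_and_right, exists_eq_right]
  tauto

/-- The measure of the chart at `p` before it is transported to `M`. -/
def coordMeasure (X : M → E (n + 1)) (p : M) : Measure (E n) :=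
  (volume.restrict (chartAt (E n) p).target).withDensity fun z => ENNReal.ofReal (density X p z)

lemma chartMeasure_eq (X : M → E (n + 1)) (p : M) :
    chartMeasure X p = Measure.map (chartAt (E n) p).symm (coordMeasure X p) := by
  simp only [chartMeasure, sqrt_det_gram, coordMeasure]

lemma aemeasurable_symm_coordMeasure (p : M) :
    AEMeasurable (chartAt (E n) p).symm (coordMeasure X p) :=
  (aemeasurable_symm p).mono_ac (withDensity_absolutelyContinuous _ _)

lemma chartMeasure_apply (p : M) {s : Set M} (hs : MeasurableSet s) :
    chartMeasure X p s = ∫⁻ z in (chartAt (E n) p).symm ⁻¹' s ∩ (chartAt (E n) p).target,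
      ENNReal.ofReal (density X p z) := by
  rw [chartMeasure_eq, Measure.map_apply_of_aemeasurable (aemeasurable_symm_coordMeasure p) hs,
    coordMeasure, withDensity_apply', Measure.restrict_restrict' (measurableSet_target p)]

lemma chartMeasure_inter_source (p : M) {s : Set M} (hs : MeasurableSet s) :
    chartMeasure X p (s ∩ (chartAt (E n) p).source) = chartMeasure X p s := by
  rw [chartMeasure_apply p hs,
    chartMeasure_apply p (hs.inter (chartAt (E n) p).open_source.measurableSet)]
  congr 2
  ext z
  simp only [Set.mem_inter_iff, Set.mem_preimage]
  constructor
  · rintro ⟨⟨h1, -⟩, h2⟩; exact ⟨h1, h2⟩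
  · rintro ⟨h1, h2⟩; exact ⟨⟨h1, (chartAt (E n) p).map_target h2⟩, h2⟩

/-- The measures defined in different charts agree on overlaps, by the change of variables
formula. -/
lemma chartMeasure_apply_of_subset (h : IsHypersurface X ν) (p q : M) {s : Set M}
    (hs : MeasurableSet s) (hp : s ⊆ (chartAt (E n) p).source)
    (hq : s ⊆ (chartAt (E n) q).source) : chartMeasure X q s = chartMeasure X p s := by
  set e := chartAt (E n) p with he
  set e' := chartAt (E n) q with he'
  set τ : E n → E n := fun z => e (e'.symm z) with hτ
  set Ω : Set (E n) := e'.target ∩ e'.symm ⁻¹' e.source with hΩdef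
  have hΩ : IsOpen Ω := e'.isOpen_inter_preimage_symm e.open_source
  have hτs : ContDiffOn ℝ ∞ τ Ω := by
    have h1 : ContMDiffOn (𝓡 n) (𝓡 n) ∞ (e ∘ e'.symm) Ω :=
      (contMDiffOn_chart (I := 𝓡 n) (n := ∞) (x := p)).comp
        ((contMDiffOn_chart_symm (I := 𝓡 n) (n := ∞) (x := q)).mono Set.inter_subset_left)
        fun z hz => hz.2
    exact contMDiffOn_iff_contDiffOn.1 h1
  have hτd (z) (hz : z ∈ Ω) : HasFDerivAt τ (fderiv ℝ τ z) z :=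
    ((hτs.contDiffAt (hΩ.mem_nhds hz)).differentiableAt (by simp)).hasFDerivAt
  set B : Set (E n) := e'.symm ⁻¹' s ∩ e'.target with hB
  have hBΩ : B ⊆ Ω := fun z hz => ⟨hz.2, hp hz.1⟩
  have himg : τ '' B = e.symm ⁻¹' s ∩ e.target := by
    ext y
    constructor
    · rintro ⟨z, hz, rfl⟩
      refine ⟨?_, e.map_source (hp hz.1)⟩
      simp only [Set.mem_preimage, hτ]
      rw [e.left_inv (hp hz.1)]; exact hz.1
    · rintro ⟨h1, h2⟩
      refine ⟨e' (e.symm y), ⟨?_, e'.map_source (hq h1)⟩, ?_⟩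
      · simp only [Set.mem_preimage]
        rw [e'.left_inv (hq h1)]; exact h1
      · simp only [hτ]
        rw [e'.left_inv (hq h1), e.right_inv h2]
  have hinj : Set.InjOn τ B := by
    intro z hz w hw hzw
    have h1 : e'.symm z = e'.symm w := e.injOn (hp hz.1) (hp hw.1) hzw
    exact e'.symm.injOn hz.2 hw.2 h1
  rw [chartMeasure_apply q hs, chartMeasure_apply p hs, ← he, ← he', ← himg,
    lintegral_image_eq_lintegral_abs_det_fderiv_mul volume (measurableSet_symm_preimage q hs)
      (fun z hz => (hτd z (hBΩ hz)).hasFDerivWithinAt) hinj]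
  refine setLIntegral_congr_fun (measurableSet_symm_preimage q hs) fun z hz => ?_
  have hzΩ := hBΩ hz
  have hτz : τ z ∈ e.target := e.map_source (hp hz.1)
  have h1 : param X q =ᶠ[𝓝 z] fun y => param X p (τ y) := by
    filter_upwards [hΩ.mem_nhds hzΩ] with y hy
    simp only [param, hτ, ← he, ← he']
    rw [e.left_inv hy.2]
  have h2 : HasFDerivAt (param X p) (fderiv ℝ (param X p) (τ z)) (τ z) :=
    (((h.isLocalHypersurface p).contDiffAt hτz).differentiableAt (by simp)).hasFDerivAt
  have h3 : fderiv ℝ (param X q) z = fderiv ℝ (param X p) (τ z) ∘L fderiv ℝ τ z := by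
    rw [h1.fderiv_eq]; exact (h2.comp z (hτd z hzΩ)).fderiv
  change ENNReal.ofReal (density X q z) = _
  rw [← ENNReal.ofReal_mul (abs_nonneg _), density, density, h3, toLinearMap_comp,
    LinearMap.normDet_comp_of_finrank_eq _ _ rfl, LinearMap.normDet_eq_abs_det, mul_comm]

/-- The induced measure is given by `chartMeasure X p` on the domain of the chart at `p`. -/
lemma inducedMeasure_restrict (h : IsHypersurface X ν) (p : M) :
    (inducedMeasure X).restrict (chartAt (E n) p).source = chartMeasure X p := by
  have hso : MeasurableSet (chartAt (E n) p).source := (chartAt (E n) p).open_source.measurableSet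
  -- a measure that dominates every `chartMeasure X q` and agrees with `chartMeasure X p` on the
  -- domain of the chart at `p`
  set ρ : Measure M := chartMeasure X p + (⊤ : Measure M).restrict (chartAt (E n) p).sourceᶜ with hρ
  have hle : inducedMeasure X ≤ ρ := by
    refine iSup_le fun q => Measure.le_iff.2 fun s hs => ?_
    rw [← measure_inter_add_sdiff s hso, hρ, Measure.add_apply, Measure.restrict_apply hs]
    refine add_le_add ?_ ?_
    · rw [← chartMeasure_inter_source q (hs.inter hso)]
      rw [chartMeasure_apply_of_subset h p q
        ((hs.inter hso).inter (chartAt (E n) q).open_source.measurableSet)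
        (fun x hx => hx.1.2) (fun x hx => hx.2)]
      exact measure_mono fun x hx => hx.1.1
    · exact (le_top : chartMeasure X q ≤ ⊤) _
  ext s hs
  rw [Measure.restrict_apply hs]
  refine le_antisymm ?_ ?_
  · refine (hle _).trans ?_
    rw [hρ, Measure.add_apply, Measure.restrict_apply (hs.inter hso), chartMeasure_inter_source p hs]
    have : s ∩ (chartAt (E n) p).source ∩ (chartAt (E n) p).sourceᶜ = ∅ := by
      ext x; simp
    rw [this, measure_empty, add_zero]
  · rw [← chartMeasure_inter_source p hs]
    exact (le_iSup (chartMeasure X) p) _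

lemma measurable_density (h : IsHypersurface X ν) (p : M) :
    AEMeasurable (fun z => ENNReal.ofReal (density X p z))
      (volume.restrict (chartAt (E n) p).target) :=
  ((contDiffOn_density h p).continuousOn.aemeasurable (measurableSet_target p)).ennreal_ofReal

/-- Integrals of functions supported in the domain of a chart. -/
lemma integral_eq_integral_inChart (h : IsHypersurface X ν) (p : M) {f : M → ℝ}
    (hf : AEStronglyMeasurable f (inducedMeasure X))
    (hs : ∀ x ∉ (chartAt (E n) p).source, f x = 0) :
    ∫ x, f x ∂(inducedMeasure X) =
      ∫ z in (chartAt (E n) p).target, density X p z * inChart p f z := by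
  rw [← setIntegral_eq_integral_of_forall_compl_eq_zero hs, inducedMeasure_restrict h,
    chartMeasure_eq, integral_map (aemeasurable_symm_coordMeasure p), coordMeasure,
    integral_withDensity_eq_integral_toReal_smul₀ (measurable_density h p)
      (ae_of_all _ fun _ => ENNReal.ofReal_lt_top)]
  · refine integral_congr_ae (ae_of_all _ fun z => ?_)
    simp only [smul_eq_mul, ENNReal.toReal_ofReal (density_nonneg p z)]
    rfl
  · rw [← chartMeasure_eq, ← inducedMeasure_restrict h]
    exact hf.restrict

lemma locallyIntegrableOn_inChart (h : IsHypersurface X ν) (p : M) {f : M → Y}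
    (hf : Integrable f (inducedMeasure X)) :
    LocallyIntegrableOn (inChart p f) (chartAt (E n) p).target volume := by
  have h1 : Integrable f (chartMeasure X p) := by
    rw [← inducedMeasure_restrict h]; exact hf.restrict
  rw [chartMeasure_eq] at h1
  have h2 := h1.comp_aemeasurable (aemeasurable_symm_coordMeasure p)
  rw [coordMeasure] at h2
  have h2' := (integrable_withDensity_iff_integrable_smul₀' (measurable_density h p)
    (ae_of_all _ fun _ => ENNReal.ofReal_lt_top)).1 h2
  have h3 : IntegrableOn (fun z => density X p z • inChart p f z) (chartAt (E n) p).target := by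
    refine h2'.congr (ae_of_all _ fun z => ?_)
    simp only [ENNReal.toReal_ofReal (density_nonneg p z)]
    rfl
  have hop := (chartAt (E n) p).open_target
  have h4 := h3.locallyIntegrableOn.continuousOn_smul hop.isLocallyClosed
    ((contDiffOn_density h p).continuousOn.inv₀ fun z hz => (density_pos h hz).ne')
  refine LocallyIntegrableOn.congr ?_ h4
  filter_upwards [ae_restrict_mem (measurableSet_target p)] with y hy
  rw [Pi.inv_apply, smul_smul, inv_mul_cancel₀ (density_pos h hy).ne', one_smul]

end InducedMeasure

/-! ### Integration by parts -/

section IntegrationByParts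

open ContinuousLinearMap Topology Filter
open scoped InnerProductSpace

variable {n : ℕ} {M : Type*} [TopologicalSpace M] [ChartedSpace (E n) M] [IsManifold (𝓡 n) ∞ M]
  {X ν : M → E (n + 1)}
  {Y : Type*} [NormedAddCommGroup Y] [NormedSpace ℝ Y]

/-- The divergence of a tangent field, as the trace of its tangential derivative in the ambient
space. -/
def tdiv (X V : M → E (n + 1)) (x : M) : ℝ :=
  ∑ a, ⟪EuclideanSpace.basisFun (Fin (n + 1)) ℝ a,
    tgrad X V x (EuclideanSpace.basisFun (Fin (n + 1)) ℝ a)⟫_ℝ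

lemma tgrad_congr {f g : M → Y} {x : M} (hfg : f =ᶠ[𝓝 x] g) : tgrad X f x = tgrad X g x := by
  rw [tgrad, tgrad, diffAt, diffAt, hfg.mfderiv_eq]

lemma tgrad_const (c : Y) (x : M) : tgrad X (fun _ => c) x = 0 := by
  have : diffAt (n := n) (fun _ : M => c) x = 0 := mfderiv_const
  rw [tgrad, this, zero_comp]

lemma tgrad_eq_fderiv_comp (h : IsHypersurface X ν) {f : M → Y}
    (hf : ContMDiff (𝓡 n) 𝓘(ℝ, Y) ∞ f) (x : M) :
    tgrad X f x = fderiv ℝ (inChart x f) (chartAt (E n) x x) ∘L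
      pinv (fderiv ℝ (param X x) (chartAt (E n) x x)) := by
  have := tgrad_symm h hf x (chartAt_mem_target x)
  rwa [symm_chartAt] at this

lemma differentiableAt_inChart {f : M → Y} (hf : ContMDiff (𝓡 n) 𝓘(ℝ, Y) ∞ f) (x : M) :
    DifferentiableAt ℝ (inChart x f) (chartAt (E n) x x) :=
  ((contMDiff_iff_inChart.1 hf x).contDiffAt
    ((chartAt (E n) x).open_target.mem_nhds (chartAt_mem_target x))).differentiableAt (by simp)

lemma tgrad_sum (h : IsHypersurface X ν) {ι : Type*} (T : Finset ι) {f : ι → M → Y}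
    (hf : ∀ i, ContMDiff (𝓡 n) 𝓘(ℝ, Y) ∞ (f i)) (x : M) :
    tgrad X (fun y => ∑ i ∈ T, f i y) x = ∑ i ∈ T, tgrad X (f i) x := by
  have hs : ContMDiff (𝓡 n) 𝓘(ℝ, Y) ∞ (fun y => ∑ i ∈ T, f i y) := contMDiff_finsetSum fun i _ => hf i
  rw [tgrad_eq_fderiv_comp h hs]
  have : inChart (n := n) x (fun y => ∑ i ∈ T, f i y) =
      fun z => ∑ i ∈ T, inChart (n := n) x (f i) z := rfl
  rw [this, fderiv_fun_sum fun i _ => differentiableAt_inChart (hf i) x]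
  ext a
  simp [tgrad_eq_fderiv_comp h (hf _)]

lemma continuous_tdiv (h : IsHypersurface X ν) {V : M → E (n + 1)}
    (hV : ContMDiff (𝓡 n) 𝓘(ℝ, E (n + 1)) ∞ V) : Continuous (tdiv X V) := by
  have := (contMDiff_tgrad h hV).continuous
  unfold tdiv
  fun_prop

lemma tdiv_eq_zero {V : M → E (n + 1)} {x : M} (hx : x ∉ tsupport V) : tdiv X V x = 0 := by
  have : V =ᶠ[𝓝 x] fun _ => 0 := notMem_tsupport_iff_eventuallyEq.1 hx
  simp [tdiv, tgrad_congr (X := X) this, tgrad_const]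

/-- Integration by parts for tangent fields supported in the domain of a chart. -/
lemma integral_mul_tdiv_of_tsupport_subset [T2Space M] [MeasurableSpace M] [BorelSpace M]
    (h : IsHypersurface X ν) {u : M → ℝ}
    {G : M → E (n + 1)} (hu : IsW11WithGradient X u G) {ψ : ℝ → ℝ} (hψ : ContDiff ℝ 1 ψ)
    {L : ℝ} (hL : ∀ t, |deriv ψ t| ≤ L) {V : M → E (n + 1)}
    (hV : ContMDiff (𝓡 n) 𝓘(ℝ, E (n + 1)) ∞ V) (hVν : ∀ x, ⟪ν x, V x⟫_ℝ = 0)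
    (hVc : HasCompactSupport V) (p : M) (hVp : tsupport V ⊆ (chartAt (E n) p).source) :
    ∫ x, ψ (u x) * tdiv X V x ∂(inducedMeasure X) =
      - ∫ x, deriv ψ (u x) * ⟪G x, V x⟫_ℝ ∂(inducedMeasure X) := by
  have hl := h.isLocalHypersurface p
  set e := chartAt (E n) p with he
  set b := EuclideanSpace.basisFun (Fin n) ℝ with hb
  set Ω := e.target with hΩ
  have hΩo : IsOpen Ω := e.open_target
  set A : E n → E n →L[ℝ] E (n + 1) := fderiv ℝ (param X p) with hA
  set J : E n → ℝ := fun z => (A z).toLinearMap.normDet with hJ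
  set c : E n → E n := fun z => pinv (A z) (inChart p V z) with hc
  have hVl : ContDiffOn ℝ ∞ (inChart p V) Ω := contMDiff_iff_inChart.1 hV p
  have hψ' : Continuous (deriv ψ) := hψ.continuous_deriv (by simp)
  -- the components of the coordinate vector field of `V`, multiplied by the density
  set η : Fin n → E n → ℝ := fun i => Ω.indicator fun z => J z * ⟪b i, c z⟫_ℝ with hη
  set K : Set (E n) := e '' tsupport V with hK
  have hKc : IsCompact K := hVc.isCompact.image_of_continuousOn (e.continuousOn.mono hVp)
  have hKΩ : K ⊆ Ω := by
    rintro _ ⟨x, hx, rfl⟩; exact e.map_source (hVp hx)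
  have hη0 (i) (z) (hz : z ∉ K) : η i z = 0 := by
    by_cases hzΩ : z ∈ Ω
    · have : inChart p V z = 0 := by
        exact image_eq_zero_of_notMem_tsupport (f := V) fun hz' => hz ⟨_, hz', e.right_inv hzΩ⟩
      simp [hη, hc, this]
    · simp [hη, hzΩ]
  have hηK (i) : tsupport (η i) ⊆ K :=
    closure_minimal (fun z hz => by by_contra hz'; exact hz (hη0 i z hz')) hKc.isClosed
  have hηc (i) : HasCompactSupport (η i) := hKc.of_isClosed_subset (isClosed_tsupport _) (hηK i)
  have hηev (i) (z) (hz : z ∈ Ω) : η i =ᶠ[𝓝 z] fun z => J z * ⟪b i, c z⟫_ℝ := by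
    filter_upwards [hΩo.mem_nhds hz] with y hy
    simp [hη, hy]
  have hηs (i) : ContDiff ℝ ∞ (η i) := by
    rw [contDiff_iff_contDiffAt]
    intro z
    by_cases hz : z ∈ Ω
    · refine ContDiffAt.congr_of_eventuallyEq ?_ (hηev i z hz)
      have h1 : ContDiffAt ℝ ∞ J z := (contDiffOn_density h p).contDiffAt (hΩo.mem_nhds hz)
      have h2 : ContDiffAt ℝ ∞ c z :=
        (hl.contDiffAt_pinv hz).clm_apply (hVl.contDiffAt (hΩo.mem_nhds hz))
      exact h1.mul (contDiffAt_const.inner ℝ h2)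
    · have : η i =ᶠ[𝓝 z] fun _ => 0 := by
        filter_upwards [hKc.isClosed.isOpen_compl.mem_nhds fun hz' => hz (hKΩ hz')] with y hy
        exact hη0 i y hy
      exact contDiffAt_const.congr_of_eventuallyEq this
  have hul : LocallyIntegrableOn (inChart p u) Ω volume := locallyIntegrableOn_inChart h p hu.integrable
  have hGl : LocallyIntegrableOn (inChart p G) Ω volume :=
    locallyIntegrableOn_inChart h p hu.integrable_grad
  have hAc : ContinuousOn A Ω := fun z hz =>
    (contDiffAt_fderiv_of_isOpen hl.isOpen hl.smooth hz).continuousAt.continuousWithinAt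
  have hgl (v : E n) : LocallyIntegrableOn (fun z => ⟪inChart p G z, A z v⟫_ℝ) Ω volume := by
    rw [locallyIntegrableOn_iff hΩo.isLocallyClosed] at hGl ⊢
    intro k hk hkc
    have hAv : ContinuousOn (fun z => A z v) k := (hAc.mono hk).clm_apply continuousOn_const
    obtain ⟨C, hC⟩ := hkc.exists_bound_of_continuousOn hAv
    refine Integrable.mono' ((hGl k hk hkc).norm.mul_const C)
      ((hGl k hk hkc).1.inner (hAv.aestronglyMeasurable hkc.measurableSet)) ?_
    filter_upwards [ae_restrict_mem hkc.measurableSet] with z hz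
    exact (norm_inner_le_norm _ _).trans (mul_le_mul_of_nonneg_left (hC z hz) (norm_nonneg _))
  have hlip (t : ℝ) : |ψ t| ≤ L * |t| + |ψ 0| := by
    have := Convex.norm_image_sub_le_of_norm_deriv_le (f := ψ) (C := L) (s := Set.univ)
      (fun x _ => hψ.differentiable (by simp) x) (fun x _ => hL x) convex_univ (Set.mem_univ 0)
      (Set.mem_univ t)
    simp only [Real.norm_eq_abs, sub_zero] at this
    have h2 := abs_sub_abs_le_abs_sub (ψ t) (ψ 0)
    linarith
  have hψl : LocallyIntegrableOn (fun z => ψ (inChart p u z)) Ω volume := by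
    rw [locallyIntegrableOn_iff hΩo.isLocallyClosed] at hul ⊢
    intro k hk hkc
    refine Integrable.mono' (((hul k hk hkc).abs.const_mul L).add
      (integrableOn_const (C := |ψ 0|) hkc.measure_lt_top.ne))
      (hψ.continuous.comp_aestronglyMeasurable (hul k hk hkc).1) (ae_of_all _ fun z => ?_)
    exact hlip _
  have hψ'l (v : E n) :
      LocallyIntegrableOn (fun z => deriv ψ (inChart p u z) * ⟪inChart p G z, A z v⟫_ℝ) Ω volume := by
    have hgv := hgl v
    rw [locallyIntegrableOn_iff hΩo.isLocallyClosed] at hul hgv ⊢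
    intro k hk hkc
    exact (hgv k hk hkc).bdd_mul (c := L)
      (hψ'.comp_aestronglyMeasurable (hul k hk hkc).1) (ae_of_all _ fun z => hL _)
  have wcr (i : Fin n) := weak_chain_rule hΩo hul (hgl (b i))
    (fun ζ h1 h2 h3 => hu.weak_deriv p ζ h1 h2 h3 (b i)) hψ hL (hηs i) (hηc i)
    ((hηK i).trans hKΩ)
  have hηvc (i) : HasCompactSupport fun z => fderiv ℝ (η i) z (b i) := (hηc i).fderiv_apply ℝ (b i)
  have hηvs (i) : tsupport (fun z => fderiv ℝ (η i) z (b i)) ⊆ Ω :=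
    (tsupport_fderiv_apply_subset ℝ (b i)).trans ((hηK i).trans hKΩ)
  have hηv (i) : Continuous fun z => fderiv ℝ (η i) z (b i) :=
    ((hηs i).continuous_fderiv (by simp)).clm_apply continuous_const
  have hsrc (x) (hx : x ∉ e.source) : x ∉ tsupport V := fun hx' => hx (hVp hx')
  rw [integral_eq_integral_inChart h p, integral_eq_integral_inChart h p]
  rotate_left
  · exact (hψ'.comp_aestronglyMeasurable hu.integrable.1).mul
      (hu.integrable_grad.1.inner hV.continuous.aestronglyMeasurable)
  · intro x hx
    simp [image_eq_zero_of_notMem_tsupport (hsrc x hx)]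
  · exact (hψ.continuous.comp_aestronglyMeasurable hu.integrable.1).mul
      (continuous_tdiv h hV).aestronglyMeasurable
  · intro x hx
    simp [tdiv_eq_zero (hsrc x hx)]
  have e1 : ∫ z in Ω, density X p z * inChart p (fun x => ψ (u x) * tdiv X V x) z =
      ∑ i, ∫ z, ψ (inChart p u z) * fderiv ℝ (η i) z (b i) := by
    rw [← integral_finsetSum _ fun i _ =>
      integrable_mul_of_tsupport_subset hψl (hηv i) (hηvc i) (hηvs i)]
    rw [← setIntegral_eq_integral_of_forall_compl_eq_zero (s := Ω) (f := fun z => ∑ i, ψ (inChart p u z) *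
      fderiv ℝ (η i) z (b i))]
    · refine setIntegral_congr_fun hΩo.measurableSet fun z hz => ?_
      have h1 := hl.sum_fderiv_normDet_mul b (EuclideanSpace.basisFun (Fin (n + 1)) ℝ) hVl
        (fun y hy => hVν _) hz
      have h2 : tdiv X V (e.symm z) = ∑ a, ⟪EuclideanSpace.basisFun (Fin (n + 1)) ℝ a,
          grad (param X p) (inChart p V) z (EuclideanSpace.basisFun (Fin (n + 1)) ℝ a)⟫_ℝ := by
        rw [tdiv, tgrad_symm h hV p hz]
      simp only [← Finset.mul_sum, (hηev _ z hz).fderiv_eq]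
      change density X p z * (ψ (u (e.symm z)) * tdiv X V (e.symm z)) = _
      rw [h2]
      change _ = ψ (u (e.symm z)) * _
      simp only [hJ, hc, hA]
      rw [h1, density]
      ring
    · intro z hz
      refine Finset.sum_eq_zero fun i _ => ?_
      rw [image_eq_zero_of_notMem_tsupport (f := fun z => fderiv ℝ (η i) z (b i))
        fun hz' => hz (hηvs i hz'), mul_zero]
  have e2 : ∫ z in Ω, density X p z * inChart p (fun x => deriv ψ (u x) * ⟪G x, V x⟫_ℝ) z =
      ∑ i, ∫ z, deriv ψ (inChart p u z) * ⟪inChart p G z, A z (b i)⟫_ℝ * η i z := by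
    rw [← integral_finsetSum _ fun i _ =>
      integrable_mul_of_tsupport_subset (hψ'l (b i)) (hηs i).continuous (hηc i) ((hηK i).trans hKΩ)]
    rw [← setIntegral_eq_integral_of_forall_compl_eq_zero (s := Ω) (f := fun z =>
      ∑ i, deriv ψ (inChart p u z) * ⟪inChart p G z, A z (b i)⟫_ℝ * η i z)]
    · refine setIntegral_congr_fun hΩo.measurableSet fun z hz => ?_
      have h1 : A z (c z) = inChart p V z := by
        rw [hc, hA, hl.apply_pinv hz]
        have : ⟪inChart p ν z, inChart p V z⟫_ℝ = 0 := hVν _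
        rw [this, zero_smul, sub_zero]
      have h2 : inChart p V z = ∑ i, ⟪b i, c z⟫_ℝ • A z (b i) := by
        rw [← h1]
        conv_lhs => rw [← b.sum_repr' (c z)]
        simp
      change density X p z * (deriv ψ (u (e.symm z)) * ⟪inChart p G z, inChart p V z⟫_ℝ) = _
      rw [h2, inner_sum, Finset.mul_sum, Finset.mul_sum]
      refine Finset.sum_congr rfl fun i _ => ?_
      rw [(hηev i z hz).self_of_nhds, inner_smul_right]
      change _ = deriv ψ (u (e.symm z)) * _ * (density X p z * _)
      ring
    · intro z hz
      refine Finset.sum_eq_zero fun i _ => ?_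
      simp [hη, hz]
  rw [e1, e2, ← Finset.sum_neg_distrib]
  exact Finset.sum_congr rfl fun i _ => wcr i

/-- A finite smooth partition of unity near a compact set, by functions with compact supports in the
domains of charts. -/
lemma exists_finite_partition [T2Space M] [SecondCountableTopology M] {K : Set M}
    (hK : IsCompact K) : ∃ (T : Finset M) (ρ : M → M → ℝ),
      (∀ p, ContMDiff (𝓡 n) 𝓘(ℝ, ℝ) ∞ (ρ p)) ∧ (∀ p, HasCompactSupport (ρ p)) ∧
      (∀ p, tsupport (ρ p) ⊆ (chartAt (E n) p).source) ∧
      ∀ x ∈ K, ∀ᶠ y in 𝓝 x, ∑ p ∈ T, ρ p y = 1 := by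
  have : LocallyCompactSpace M := ChartedSpace.locallyCompactSpace (E n) M
  obtain ⟨K₁, hK₁, h1⟩ := exists_compact_superset hK
  obtain ⟨K₂, hK₂, h2⟩ := exists_compact_superset hK₁
  obtain ⟨f, hf⟩ := SmoothPartitionOfUnity.exists_isSubordinate (𝓡 n) hK₁.isClosed
    (fun p : M => (chartAt (E n) p).source ∩ interior K₂)
    (fun p => (chartAt (E n) p).open_source.inter isOpen_interior)
    (fun x hx => Set.mem_iUnion.2 ⟨x, mem_chart_source _ x, h2 hx⟩)
  have hfin := f.locallyFinite.finite_nonempty_inter_compact hK₂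
  refine ⟨hfin.toFinset, fun p => f p, fun p => (f p).contMDiff, fun p => ?_,
    fun p => (hf p).trans Set.inter_subset_left, fun x hx => ?_⟩
  · exact hK₂.of_isClosed_subset (isClosed_tsupport _)
      ((hf p).trans (Set.inter_subset_right.trans interior_subset))
  · filter_upwards [mem_interior_iff_mem_nhds.1 (h1 hx)] with y hy
    rw [← f.sum_eq_one hy, finsum_eq_sum_of_support_subset]
    intro p hp
    rw [Set.Finite.coe_toFinset]
    exact ⟨y, hp, interior_subset (h2 hy)⟩

/-- Integration by parts: the weak divergence theorem for `ψ(u)` and a smooth tangent field. -/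
lemma integral_mul_tdiv [T2Space M] [SecondCountableTopology M] [MeasurableSpace M] [BorelSpace M]
    (h : IsHypersurface X ν) {u : M → ℝ} {G : M → E (n + 1)} (hu : IsW11WithGradient X u G)
    (huc : HasCompactSupport u) {ψ : ℝ → ℝ} (hψ : ContDiff ℝ 1 ψ)
    {L : ℝ} (hL : ∀ t, |deriv ψ t| ≤ L) (hψ0 : ψ 0 = 0) (hψ'0 : deriv ψ 0 = 0)
    {V : M → E (n + 1)}
    (hV : ContMDiff (𝓡 n) 𝓘(ℝ, E (n + 1)) ∞ V) (hVν : ∀ x, ⟪ν x, V x⟫_ℝ = 0) :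
    ∫ x, ψ (u x) * tdiv X V x ∂(inducedMeasure X) =
      - ∫ x, deriv ψ (u x) * ⟪G x, V x⟫_ℝ ∂(inducedMeasure X) := by
  obtain ⟨T, ρ, hρ, hρc, hρs, hρ1⟩ := exists_finite_partition (n := n) huc.isCompact
  have hψ' : Continuous (deriv ψ) := hψ.continuous_deriv (by simp)
  set W : M → M → E (n + 1) := fun p x => ρ p x • V x with hW
  have hWs (p) : ContMDiff (𝓡 n) 𝓘(ℝ, E (n + 1)) ∞ (W p) := (hρ p).smul hV
  have hWt (p) : tsupport (W p) ⊆ tsupport (ρ p) := tsupport_smul_subset_left _ _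
  have hWc (p) : HasCompactSupport (W p) := (hρc p).smul_right
  have hWν (p x) : ⟪ν x, W p x⟫_ℝ = 0 := by simp [hW, inner_smul_right, hVν]
  have ibp (p) := integral_mul_tdiv_of_tsupport_subset h hu hψ hL (hWs p) (hWν p) (hWc p) p
    ((hWt p).trans (hρs p))
  have hsum (x) (hx : x ∈ tsupport u) : V =ᶠ[𝓝 x] fun y => ∑ p ∈ T, W p y := by
    filter_upwards [hρ1 x hx] with y hy
    simp only [hW, ← Finset.sum_smul, hy, one_smul]
  have hdiv (x) (hx : x ∈ tsupport u) : tdiv X V x = ∑ p ∈ T, tdiv X (W p) x := by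
    simp only [tdiv]
    rw [Finset.sum_comm, tgrad_congr (hsum x hx), tgrad_sum h T hWs]
    simp [sum_apply, inner_sum]
  have hlip (t : ℝ) : |ψ t| ≤ L * |t| := by
    have := Convex.norm_image_sub_le_of_norm_deriv_le (f := ψ) (C := L) (s := Set.univ)
      (fun x _ => hψ.differentiable (by simp) x) (fun x _ => hL x) convex_univ (Set.mem_univ 0)
      (Set.mem_univ t)
    simpa [hψ0] using this
  have iψ : Integrable (fun x => ψ (u x)) (inducedMeasure X) :=
    Integrable.mono' (hu.integrable.abs.const_mul L)
      (hψ.continuous.comp_aestronglyMeasurable hu.integrable.1) (ae_of_all _ fun x => hlip _)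
  have i1 (p) : Integrable (fun x => ψ (u x) * tdiv X (W p) x) (inducedMeasure X) := by
    have hc : HasCompactSupport (tdiv X (W p)) :=
      HasCompactSupport.intro (hWc p) fun x hx => tdiv_eq_zero hx
    obtain ⟨C, hC⟩ := (continuous_tdiv h (hWs p)).bounded_above_of_compact_support hc
    exact iψ.mul_bdd (c := C) (continuous_tdiv h (hWs p)).aestronglyMeasurable (ae_of_all _ hC)
  have i2 (p) : Integrable (fun x => deriv ψ (u x) * ⟪G x, W p x⟫_ℝ) (inducedMeasure X) := by
    obtain ⟨C, hC⟩ := (hWs p).continuous.bounded_above_of_compact_support (hWc p)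
    refine Integrable.bdd_mul (c := L) ?_ (hψ'.comp_aestronglyMeasurable hu.integrable.1)
      (ae_of_all _ fun x => hL _)
    refine Integrable.mono' (hu.integrable_grad.norm.mul_const C)
      (hu.integrable_grad.1.inner (hWs p).continuous.aestronglyMeasurable) (ae_of_all _ fun x => ?_)
    exact (norm_inner_le_norm _ _).trans (mul_le_mul_of_nonneg_left (hC x) (norm_nonneg _))
  have e1 (x) : ψ (u x) * tdiv X V x = ∑ p ∈ T, ψ (u x) * tdiv X (W p) x := by
    by_cases hx : x ∈ tsupport u
    · rw [hdiv x hx, Finset.mul_sum]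
    · simp [image_eq_zero_of_notMem_tsupport hx, hψ0]
  have e2 (x) : deriv ψ (u x) * ⟪G x, V x⟫_ℝ = ∑ p ∈ T, deriv ψ (u x) * ⟪G x, W p x⟫_ℝ := by
    by_cases hx : x ∈ tsupport u
    · rw [(hsum x hx).self_of_nhds, inner_sum, Finset.mul_sum]
    · simp [image_eq_zero_of_notMem_tsupport hx, hψ'0]
  simp only [e1, e2]
  rw [integral_finsetSum _ fun p _ => i1 p, integral_finsetSum _ fun p _ => i2 p,
    ← Finset.sum_neg_distrib]
  exact Finset.sum_congr rfl fun p _ => ibp p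

end IntegrationByParts

/-! ### The weighted test field on an immersed hypersurface -/

section TestField

open ContinuousLinearMap Topology Filter
open scoped InnerProductSpace

variable {n : ℕ} {M : Type*} [TopologicalSpace M] [ChartedSpace (E n) M] [IsManifold (𝓡 n) ∞ M]
  {X ν : M → E (n + 1)}
  {Y Z : Type*} [NormedAddCommGroup Y] [NormedSpace ℝ Y] [NormedAddCommGroup Z] [NormedSpace ℝ Z]

lemma tgrad_clm_comp (h : IsHypersurface X ν) (L : Y →L[ℝ] Z) {f : M → Y}
    (hf : ContMDiff (𝓡 n) 𝓘(ℝ, Y) ∞ f) (x : M) :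
    tgrad X (fun y => L (f y)) x = L ∘L tgrad X f x := by
  have hs : ContMDiff (𝓡 n) 𝓘(ℝ, Z) ∞ (fun y => L (f y)) := L.contMDiff.comp hf
  rw [tgrad_eq_fderiv_comp h hs, tgrad_eq_fderiv_comp h hf]
  have : inChart (n := n) x (fun y => L (f y)) = L ∘ inChart (n := n) x f := rfl
  rw [this, ((L.hasFDerivAt).comp _ (differentiableAt_inChart hf x).hasFDerivAt).fderiv, comp_assoc]

lemma tgrad_real_comp (h : IsHypersurface X ν) {φ : ℝ → ℝ} (hφ : ContDiff ℝ ∞ φ) {f : M → ℝ}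
    (hf : ContMDiff (𝓡 n) 𝓘(ℝ, ℝ) ∞ f) (x : M) :
    tgrad X (fun y => φ (f y)) x = deriv φ (f x) • tgrad X f x := by
  have hs : ContMDiff (𝓡 n) 𝓘(ℝ, ℝ) ∞ (fun y => φ (f y)) := hφ.contMDiff.comp hf
  rw [tgrad_eq_fderiv_comp h hs, tgrad_eq_fderiv_comp h hf]
  have h1 := ((hφ.differentiable (by simp)) (inChart x f (chartAt (E n) x x))).hasDerivAt
  have h2 := (h1.comp_hasFDerivAt _ (differentiableAt_inChart hf x).hasFDerivAt).fderiv
  have : inChart (n := n) x (fun y => φ (f y)) = φ ∘ inChart (n := n) x f := rfl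
  rw [this, h2, smul_comp, inChart, symm_chartAt]

lemma tgrad_smul (h : IsHypersurface X ν) {f : M → ℝ} {U : M → Y}
    (hf : ContMDiff (𝓡 n) 𝓘(ℝ, ℝ) ∞ f) (hU : ContMDiff (𝓡 n) 𝓘(ℝ, Y) ∞ U) (x : M)
    (a : E (n + 1)) :
    tgrad X (fun y => f y • U y) x a = f x • tgrad X U x a + tgrad X f x a • U x := by
  have hs : ContMDiff (𝓡 n) 𝓘(ℝ, Y) ∞ (fun y => f y • U y) := hf.smul hU
  rw [tgrad_eq_fderiv_comp h hs, tgrad_eq_fderiv_comp h hf, tgrad_eq_fderiv_comp h hU]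
  have : inChart (n := n) x (fun y => f y • U y) =
      fun z => inChart (n := n) x f z • inChart (n := n) x U z := rfl
  rw [this, fderiv_fun_smul (differentiableAt_inChart hf x) (differentiableAt_inChart hU x)]
  simp [inChart]

lemma tdiv_smul (h : IsHypersurface X ν) {f : M → ℝ} {U : M → E (n + 1)}
    (hf : ContMDiff (𝓡 n) 𝓘(ℝ, ℝ) ∞ f) (hU : ContMDiff (𝓡 n) 𝓘(ℝ, E (n + 1)) ∞ U) (x : M) :
    tdiv X (fun y => f y • U y) x = f x * tdiv X U x + tgrad X f x (U x) := by
  simp only [tdiv, tgrad_smul h hf hU, inner_add_right, inner_smul_right, Finset.sum_add_distrib,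
    ← Finset.mul_sum]
  congr 1
  conv_rhs => rw [← (EuclideanSpace.basisFun (Fin (n + 1)) ℝ).sum_repr' (U x)]
  simp [mul_comm]

variable (X ν) in
/-- The vector field `∑ b, (S D_b S² - S² D_b S) e_b` along the hypersurface, where `S` is the
ambient Weingarten map and `e` the standard basis of `ℝⁿ⁺¹`. -/
def weingartenField (x : M) : E (n + 1) :=
  IsCurvatureJet.testField (EuclideanSpace.basisFun (Fin (n + 1)) ℝ) (tgrad X ν x)
    (tgrad X (tgrad X ν) x)

variable (X ν) in
/-- The trace of the ambient Weingarten map, which is the mean curvature. -/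
def ambientTrace (x : M) : ℝ :=
  ∑ a, ⟪EuclideanSpace.basisFun (Fin (n + 1)) ℝ a,
    tgrad X ν x (EuclideanSpace.basisFun (Fin (n + 1)) ℝ a)⟫_ℝ

lemma contMDiff_weingartenField (h : IsHypersurface X ν) :
    ContMDiff (𝓡 n) 𝓘(ℝ, E (n + 1)) ∞ (weingartenField X ν) := by
  have hS := contMDiff_tgrad h h.smooth_normal
  have hD := contMDiff_tgrad h hS
  unfold weingartenField IsCurvatureJet.testField
  refine contMDiff_finsetSum fun b _ => ContMDiff.sub ?_ ?_
  · exact hS.clm_apply ((hD.clm_apply contMDiff_const).clm_apply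
      (hS.clm_apply (hS.clm_apply contMDiff_const)))
  · exact hS.clm_apply (hS.clm_apply ((hD.clm_apply contMDiff_const).clm_apply
      (hS.clm_apply contMDiff_const)))

variable (n) in
/-- The trace of an endomorphism of `ℝⁿ⁺¹`, as a continuous linear map. -/
def traceCLM : (E (n + 1) →L[ℝ] E (n + 1)) →L[ℝ] ℝ :=
  ∑ a, innerSL ℝ (EuclideanSpace.basisFun (Fin (n + 1)) ℝ a) ∘L
    ContinuousLinearMap.apply ℝ (E (n + 1)) (EuclideanSpace.basisFun (Fin (n + 1)) ℝ a)

lemma traceCLM_apply (T : E (n + 1) →L[ℝ] E (n + 1)) :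
    traceCLM n T = ∑ a, ⟪EuclideanSpace.basisFun (Fin (n + 1)) ℝ a,
      T (EuclideanSpace.basisFun (Fin (n + 1)) ℝ a)⟫_ℝ := by
  simp [traceCLM]

lemma ambientTrace_eq : ambientTrace X ν = fun x => traceCLM n (tgrad X ν x) := by
  ext x; rw [traceCLM_apply, ambientTrace]

lemma contMDiff_ambientTrace (h : IsHypersurface X ν) :
    ContMDiff (𝓡 n) 𝓘(ℝ, ℝ) ∞ (ambientTrace X ν) := by
  rw [ambientTrace_eq]
  exact (traceCLM n).contMDiff.comp (contMDiff_tgrad h h.smooth_normal)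

lemma tgrad_ambientTrace (h : IsHypersurface X ν) (x : M) (a : E (n + 1)) :
    tgrad X (ambientTrace X ν) x a = ∑ b, ⟪EuclideanSpace.basisFun (Fin (n + 1)) ℝ b,
      tgrad X (tgrad X ν) x a (EuclideanSpace.basisFun (Fin (n + 1)) ℝ b)⟫_ℝ := by
  rw [ambientTrace_eq, tgrad_clm_comp h _ (contMDiff_tgrad h h.smooth_normal), comp_apply,
    traceCLM_apply]

lemma tdiv_weingartenField (h : IsHypersurface X ν) (x : M) :
    tdiv X (weingartenField X ν) x =
      IsCurvatureJet.divExpr (EuclideanSpace.basisFun (Fin (n + 1)) ℝ) (tgrad X ν x)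
        (tgrad X (tgrad X ν) x) := by
  have hx := chartAt_mem_target (n := n) x
  have e1 := tgrad_symm h (contMDiff_weingartenField h) x hx
  have e2 := tgrad_symm h h.smooth_normal x hx
  have e3 := tgrad_tgrad_symm h h.smooth_normal x hx
  rw [symm_chartAt] at e1 e2 e3
  rw [tdiv, e1, e2, e3, ← (h.isLocalHypersurface x).grad_testField_trace _ hx]
  have : Set.EqOn (inChart x (weingartenField X ν)) (fun y =>
      IsCurvatureJet.testField (EuclideanSpace.basisFun (Fin (n + 1)) ℝ)
        (grad (param X x) (inChart x ν) y) (grad (param X x) (grad (param X x) (inChart x ν)) y))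
      (chartAt (E n) x).target := fun y hy => by
    rw [inChart, weingartenField, tgrad_symm h h.smooth_normal x hy,
      tgrad_tgrad_symm h h.smooth_normal x hy]
  rw [grad_congr (chartAt (E n) x).open_target this hx]

lemma meanCurvature_eq (h : IsHypersurface X ν) (x : M) :
    meanCurvature X ν x = ambientTrace X ν x := by
  rw [ambientTrace, trace_curvatureMatrix_eq h (isFrame_frame h x)]
  rfl

lemma normSqA_eq (h : IsHypersurface X ν) (x : M) : normSqA X ν x =
    ∑ a, ⟪tgrad X ν x (EuclideanSpace.basisFun (Fin (n + 1)) ℝ a),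
      tgrad X ν x (EuclideanSpace.basisFun (Fin (n + 1)) ℝ a)⟫_ℝ := by
  rw [sum_inner_map_eq_curvatureMatrix h (isFrame_frame h x)]
  rfl

lemma continuous_normSqA (h : IsHypersurface X ν) : Continuous (normSqA X ν) := by
  have := (contMDiff_tgrad h h.smooth_normal).continuous
  simp only [funext (normSqA_eq h)]
  fun_prop

lemma continuous_meanCurvature (h : IsHypersurface X ν) : Continuous (meanCurvature X ν) := by
  rw [funext (meanCurvature_eq h)]
  exact (contMDiff_ambientTrace h).continuous

lemma normSqA_nonneg (x : M) : 0 ≤ normSqA X ν x := by unfold normSqA; positivity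

lemma normSqGradA_nonneg (x : M) : 0 ≤ normSqGradA X ν x := by unfold normSqGradA; positivity

lemma norm_weingartenField_le (h : IsHypersurface X ν) (x : M) :
    ‖weingartenField X ν x‖ ≤
      (n + 1) * (2 * (√(normSqGradA X ν x) * √(normSqA X ν x) ^ 3)) := by
  have hb := isFrame_frame h x
  have := (h.isCurvatureJet x).norm_testField_le (EuclideanSpace.basisFun (Fin (n + 1)) ℝ)
    (Real.sqrt_nonneg (normSqGradA X ν x)) (Real.sqrt_nonneg (normSqA X ν x))
    (fun a v ha => by
      have := norm_covPart_le h hb a v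
      rwa [ha, mul_one] at this)
    (norm_map_le h hb)
  simpa [weingartenField] using this

lemma abs_tdiv_weingartenField_sub_le (h : IsHypersurface X ν) (x : M) :
    |tdiv X (weingartenField X ν) x - discr (curvatureMatrix X ν x (frame X x))| ≤
      6 * (n + 1) ^ 2 * (normSqGradA X ν x * normSqA X ν x) := by
  have hb := isFrame_frame h x
  have := IsCurvatureJet.abs_covExpr_le (EuclideanSpace.basisFun (Fin (n + 1)) ℝ) (tgrad X ν x)
    (covPart (ν x) (tgrad X ν x) (tgrad X (tgrad X ν) x))
    (Real.sqrt_nonneg (normSqGradA X ν x)) (Real.sqrt_nonneg (normSqA X ν x))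
    (fun a v ha => by
      have := norm_covPart_le h hb a v
      rwa [ha, mul_one] at this)
    (norm_map_le h hb)
  rw [tdiv_weingartenField h, (h.isCurvatureJet x).divExpr_eq,
    sum_inner_eq_curvatureMatrix h hb, add_sub_cancel_left]
  rw [Real.sq_sqrt (normSqGradA_nonneg x), Real.sq_sqrt (normSqA_nonneg x)] at this
  simpa using this

lemma abs_tgrad_ambientTrace_le (h : IsHypersurface X ν) (x : M) (a : E (n + 1)) :
    |tgrad X (ambientTrace X ν) x a| ≤ (n + 1) * (√(normSqGradA X ν x) * ‖a‖) := by
  rw [tgrad_ambientTrace h]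
  have := (h.isCurvatureJet x).abs_sum_inner_deriv_le (EuclideanSpace.basisFun (Fin (n + 1)) ℝ)
    (c := √(normSqGradA X ν x)) (norm_covPart_le h (isFrame_frame h x)) a
  simpa using this

/-- The weight `t ↦ (t² + ε)⁻²`, which regularises `H⁻⁴`. -/
def weight (ε t : ℝ) : ℝ := ((t ^ 2 + ε) ^ 2)⁻¹

lemma contDiff_weight {ε : ℝ} (hε : 0 < ε) : ContDiff ℝ ∞ (weight ε) := by
  unfold weight
  exact ContDiff.inv (by fun_prop) fun t => by positivity

lemma deriv_weight {ε : ℝ} (hε : 0 < ε) (t : ℝ) :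
    deriv (weight ε) t = -(4 * t * ((t ^ 2 + ε) ^ 3)⁻¹) := by
  have h0 : t ^ 2 + ε ≠ 0 := by positivity
  have h1 : HasDerivAt (fun t : ℝ => (t ^ 2 + ε) ^ 2) (2 * (t ^ 2 + ε) * (2 * t)) t := by
    have := (((hasDerivAt_id t).pow 2).add_const ε).pow 2
    simpa [Pi.pow_def] using this
  have h2 : HasDerivAt (weight ε) _ t := h1.inv (pow_ne_zero 2 h0)
  rw [h2.deriv]
  field_simp
  ring

variable (X ν) in
/-- The field used in the integration by parts: the Weingarten field with the weight
`(H² + ε)⁻²`. -/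
def weightedField (ε : ℝ) (x : M) : E (n + 1) :=
  weight ε (ambientTrace X ν x) • weingartenField X ν x

lemma contMDiff_weight_ambientTrace (h : IsHypersurface X ν) {ε : ℝ} (hε : 0 < ε) :
    ContMDiff (𝓡 n) 𝓘(ℝ, ℝ) ∞ (fun x => weight ε (ambientTrace X ν x)) :=
  (contDiff_weight hε).contMDiff.comp (contMDiff_ambientTrace h)

lemma contMDiff_weightedField (h : IsHypersurface X ν) {ε : ℝ} (hε : 0 < ε) :
    ContMDiff (𝓡 n) 𝓘(ℝ, E (n + 1)) ∞ (weightedField X ν ε) :=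
  (contMDiff_weight_ambientTrace h hε).smul (contMDiff_weingartenField h)

lemma inner_normal_weightedField (h : IsHypersurface X ν) (ε : ℝ) (x : M) :
    ⟪ν x, weightedField X ν ε x⟫_ℝ = 0 := by
  rw [weightedField, inner_smul_right, weingartenField,
    (h.isCurvatureJet x).inner_normal_testField, mul_zero]

lemma tdiv_weightedField (h : IsHypersurface X ν) {ε : ℝ} (hε : 0 < ε) (x : M) :
    tdiv X (weightedField X ν ε) x =
      weight ε (ambientTrace X ν x) * tdiv X (weingartenField X ν) x
      - 4 * ambientTrace X ν x * ((ambientTrace X ν x ^ 2 + ε) ^ 3)⁻¹ *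
        tgrad X (ambientTrace X ν) x (weingartenField X ν x) := by
  unfold weightedField
  rw [tdiv_smul h (contMDiff_weight_ambientTrace h hε) (contMDiff_weingartenField h),
    tgrad_real_comp h (contDiff_weight hε) (contMDiff_ambientTrace h), smul_apply,
    deriv_weight hε, smul_eq_mul]
  ring

/-- Where the mean curvature controls the second fundamental form, the weighted field is bounded by
`|∇A| / H`. Where `H = 0`, the second fundamental form and hence the field vanish, in agreement with
the convention `x / 0 = 0`. -/
lemma norm_weightedField_le (h : IsHypersurface X ν) {ε C : ℝ} (hε : 0 < ε) (hC : 0 < C) {x : M}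
    (hH : 0 ≤ meanCurvature X ν x) (hA : normSqA X ν x ≤ (C * meanCurvature X ν x) ^ 2) :
    ‖weightedField X ν ε x‖ ≤
      2 * (n + 1) * C ^ 3 * (√(normSqGradA X ν x) / meanCurvature X ν x) := by
  have hU := norm_weingartenField_le h x
  rw [weightedField, norm_smul, ← meanCurvature_eq h]
  set H := meanCurvature X ν x
  set g := √(normSqGradA X ν x)
  have hg : 0 ≤ g := Real.sqrt_nonneg _
  have hs : √(normSqA X ν x) ≤ C * H := Real.sqrt_le_iff.2 ⟨by positivity, hA⟩
  have hU' : ‖weingartenField X ν x‖ ≤ (n + 1) * (2 * (g * (C * H) ^ 3)) :=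
    hU.trans (by gcongr)
  rcases hH.eq_or_lt with h0 | h0
  · rw [← h0] at hU' ⊢
    have : ‖weingartenField X ν x‖ = 0 := le_antisymm (by simpa using hU') (norm_nonneg _)
    simp [this]
  · have hw : ‖weight ε H‖ ≤ (H ^ 4)⁻¹ := by
      rw [weight, Real.norm_of_nonneg (by positivity)]
      gcongr
      nlinarith [sq_nonneg H]
    calc _ ≤ (H ^ 4)⁻¹ * ((n + 1) * (2 * (g * (C * H) ^ 3))) := by gcongr
      _ = _ := by field_simp

/-- The lower bound of the divergence of the weighted field. The derivative of the weight contributes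
an error of the same type as `covExpr`. Where `H = 0`, every term on the left is zero. -/
lemma le_tdiv_weightedField (h : IsHypersurface X ν) {ε c C : ℝ} (hε : 0 < ε) (hC : 0 < C) {x : M}
    (hH : 0 ≤ meanCurvature X ν x) (hA : normSqA X ν x ≤ (C * meanCurvature X ν x) ^ 2)
    (hd : c * normSqA X ν x * meanCurvature X ν x ^ 4 ≤
      discr (curvatureMatrix X ν x (frame X x))) :
    c * normSqA X ν x * meanCurvature X ν x ^ 4 * weight ε (meanCurvature X ν x)
      - (n + 1) ^ 2 * (6 * C ^ 2 + 8 * C ^ 3) *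
        (normSqGradA X ν x / meanCurvature X ν x ^ 2) ≤ tdiv X (weightedField X ν ε) x := by
  have hU := norm_weingartenField_le h x
  have hT := abs_tgrad_ambientTrace_le h x (weingartenField X ν x)
  have hcov := abs_tdiv_weingartenField_sub_le h x
  rw [tdiv_weightedField h hε, ← meanCurvature_eq h]
  set H := meanCurvature X ν x
  set q := normSqGradA X ν x with hq
  set g := √q
  have hg : 0 ≤ g := Real.sqrt_nonneg _
  have hq0 : 0 ≤ q := normSqGradA_nonneg x
  have hgq : g * g = q := Real.mul_self_sqrt hq0
  have hs : √(normSqA X ν x) ≤ C * H := Real.sqrt_le_iff.2 ⟨by positivity, hA⟩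
  set d := tdiv X (weingartenField X ν) x
  set T := tgrad X (ambientTrace X ν) x (weingartenField X ν x)
  have hT' : |T| ≤ (n + 1) ^ 2 * 2 * C ^ 3 * (q * H ^ 3) := by
    calc |T| ≤ (n + 1) * (g * ((n + 1) * (2 * (g * (C * H) ^ 3)))) :=
          hT.trans (by gcongr; exact hU.trans (by gcongr))
      _ = _ := by rw [← hgq]; ring
  have hd' : c * normSqA X ν x * H ^ 4 - 6 * (n + 1) ^ 2 * C ^ 2 * (q * H ^ 2) ≤ d := by
    have : 6 * ((n : ℝ) + 1) ^ 2 * (q * normSqA X ν x) ≤ 6 * (n + 1) ^ 2 * (q * (C * H) ^ 2) := by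
      gcongr
    have h3 := (abs_le.1 hcov).1
    nlinarith
  have hw0 : 0 ≤ weight ε H := by rw [weight]; positivity
  have hk0 : 0 ≤ 4 * H * ((H ^ 2 + ε) ^ 3)⁻¹ := by positivity
  have k1 := mul_le_mul_of_nonneg_left hd' hw0
  have k2 := mul_le_mul_of_nonneg_left ((le_abs_self T).trans hT') hk0
  have k3 : weight ε H * (q * H ^ 2) ≤ q / H ^ 2 := by
    rcases hH.eq_or_lt with h0 | h0
    · simp [← h0]
    · rw [weight, div_eq_mul_inv, mul_comm, mul_assoc]
      gcongr
      rw [← div_eq_mul_inv, div_le_iff₀ (by positivity), inv_mul_eq_div, le_div_iff₀ (by positivity)]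
      nlinarith [sq_nonneg H]
  have k4 : H * ((H ^ 2 + ε) ^ 3)⁻¹ * (q * H ^ 3) ≤ q / H ^ 2 := by
    rcases hH.eq_or_lt with h0 | h0
    · simp [← h0]
    · have : H * ((H ^ 2 + ε) ^ 3)⁻¹ * (q * H ^ 3) = q * (H ^ 4 / (H ^ 2 + ε) ^ 3) := by
        rw [div_eq_mul_inv]; ring
      rw [this, div_eq_mul_inv q]
      refine mul_le_mul_of_nonneg_left ?_ hq0
      rw [div_le_iff₀ (by positivity), inv_mul_eq_div, le_div_iff₀ (by positivity)]
      calc H ^ 4 * H ^ 2 = (H ^ 2 + 0) ^ 3 := by ring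
        _ ≤ _ := by gcongr
  have m1 : 0 ≤ 6 * ((n : ℝ) + 1) ^ 2 * C ^ 2 := by positivity
  have m2 : 0 ≤ 8 * ((n : ℝ) + 1) ^ 2 * C ^ 3 := by positivity
  have k5 := mul_le_mul_of_nonneg_left k3 m1
  have k6 := mul_le_mul_of_nonneg_left k4 m2
  linarith

end TestField

/-! ### Regularisation and passage to the limit -/

section Limit

open Topology Filter
open scoped InnerProductSpace

/-- An inequality between lower integrals that follows from an identity between integrals. No
measurability of `P` or `Q` is needed, because the negative part of `T` is moved to the left before
the lower integrals are split. -/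
lemma lintegral_le_of_integral_eq_neg {α : Type*} [MeasurableSpace α] {μ : Measure α}
    {T Z P Q : α → ℝ} (hT : Integrable T μ) (hZ : Integrable Z μ)
    (hTZ : ∫ x, T x ∂μ = - ∫ x, Z x ∂μ) (hP : ∀ x, 0 ≤ P x) (hPQ : ∀ x, P x ≤ T x + Q x) :
    ∫⁻ x, ENNReal.ofReal (P x) ∂μ ≤
      ∫⁻ x, ENNReal.ofReal (Q x) ∂μ + ∫⁻ x, ENNReal.ofReal |Z x| ∂μ := by
  have hn : ∫⁻ x, ENNReal.ofReal (-T x) ∂μ ≠ ⊤ := by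
    have := hT.neg.lintegral_lt_top; exact this.ne
  have hp : ∫⁻ x, ENNReal.ofReal (T x) ∂μ ≠ ⊤ := hT.lintegral_lt_top.ne
  have hz : ∫⁻ x, ENNReal.ofReal |Z x| ∂μ ≠ ⊤ := hZ.abs.lintegral_lt_top.ne
  have h1 : ∫⁻ x, ENNReal.ofReal (P x) ∂μ + ∫⁻ x, ENNReal.ofReal (-T x) ∂μ ≤
      ∫⁻ x, ENNReal.ofReal (T x) ∂μ + ∫⁻ x, ENNReal.ofReal (Q x) ∂μ := by
    have hm : AEMeasurable (fun x => ENNReal.ofReal (-T x)) μ := hT.aemeasurable.neg.ennreal_ofReal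
    rw [← lintegral_add_right' _ hm, ← lintegral_add_left' hT.aemeasurable.ennreal_ofReal]
    refine lintegral_mono fun x => ?_
    have h2 := hPQ x
    rcases le_total 0 (T x) with h | h
    · rw [ENNReal.ofReal_of_nonpos (p := -T x) (by linarith), add_zero]
      exact (ENNReal.ofReal_le_ofReal h2).trans ENNReal.ofReal_add_le
    · rw [ENNReal.ofReal_of_nonpos h, zero_add, ← ENNReal.ofReal_add (hP x) (by linarith)]
      exact ENNReal.ofReal_le_ofReal (by linarith)
  have h2 : ∫⁻ x, ENNReal.ofReal (T x) ∂μ ≤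
      ∫⁻ x, ENNReal.ofReal (-T x) ∂μ + ∫⁻ x, ENNReal.ofReal |Z x| ∂μ := by
    have e1 := integral_eq_lintegral_pos_part_sub_lintegral_neg_part hT
    have e2 : ∫ x, |Z x| ∂μ = (∫⁻ x, ENNReal.ofReal |Z x| ∂μ).toReal :=
      integral_eq_lintegral_of_nonneg_ae (ae_of_all _ fun x => abs_nonneg _) hZ.abs.1
    have e3 := abs_integral_le_integral_abs (μ := μ) (f := Z)
    rw [← ENNReal.toReal_le_toReal hp (ENNReal.add_ne_top.2 ⟨hn, hz⟩), ENNReal.toReal_add hn hz]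
    linarith [neg_abs_le (∫ x, Z x ∂μ)]
  have h3 := h1.trans (add_le_add_left h2 _)
  rw [add_comm, add_assoc] at h3
  rw [add_comm (∫⁻ x, ENNReal.ofReal (Q x) ∂μ)]
  exact (ENNReal.add_le_add_iff_left hn).1 h3

/-- A regularisation of `t ↦ t²` with bounded derivative. -/
def cutSq (ε t : ℝ) : ℝ := (t / (1 + ε * t ^ 2)) ^ 2

variable {ε : ℝ}

lemma contDiff_cutSq (hε : 0 < ε) : ContDiff ℝ 1 (cutSq ε) := by
  unfold cutSq
  exact (ContDiff.div contDiff_id (by fun_prop) fun t => by positivity).pow 2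

lemma deriv_cutSq (hε : 0 < ε) (t : ℝ) :
    deriv (cutSq ε) t = 2 * (t / (1 + ε * t ^ 2)) * ((1 - ε * t ^ 2) / (1 + ε * t ^ 2) ^ 2) := by
  have h0 : 1 + ε * t ^ 2 ≠ 0 := by positivity
  have h1 : HasDerivAt (fun t : ℝ => 1 + ε * t ^ 2) (ε * (2 * t)) t := by
    simpa using (((hasDerivAt_id t).pow 2).const_mul ε).const_add 1
  have h2 : HasDerivAt (cutSq ε) _ t := ((hasDerivAt_id t).div h1 h0).pow 2
  rw [h2.deriv]
  simp only [Pi.div_apply, id_eq]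
  push_cast
  ring

lemma abs_deriv_cutSq_le (hε : 0 < ε) (t : ℝ) :
    |deriv (cutSq ε) t| ≤ 2 * |t / (1 + ε * t ^ 2)| := by
  have h0 : 0 < 1 + ε * t ^ 2 := by positivity
  rw [deriv_cutSq hε, abs_mul, abs_mul, abs_two]
  refine mul_le_of_le_one_right (by positivity) ?_
  rw [abs_div, abs_of_pos (pow_pos h0 2), div_le_one (pow_pos h0 2), abs_le]
  have : 0 ≤ ε * t ^ 2 := by positivity
  constructor <;> nlinarith

lemma abs_div_le_inv (hε : 0 < ε) (hε1 : ε ≤ 1) (t : ℝ) : |t / (1 + ε * t ^ 2)| ≤ ε⁻¹ := by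
  have h0 : 0 < 1 + ε * t ^ 2 := by positivity
  rw [abs_div, abs_of_pos h0, div_le_iff₀ h0, inv_mul_eq_div, le_div_iff₀ hε]
  have h1 : |t| ≤ 1 + t ^ 2 := by nlinarith [sq_abs t, sq_nonneg (|t| - 1), abs_nonneg t]
  nlinarith

lemma abs_div_le (hε : 0 < ε) (t : ℝ) : |t / (1 + ε * t ^ 2)| ≤ |t| := by
  rw [abs_div]
  refine div_le_self (abs_nonneg t) ?_
  rw [abs_of_pos (by positivity)]
  nlinarith [mul_nonneg hε.le (sq_nonneg t)]

lemma cutSq_nonneg (t : ℝ) : 0 ≤ cutSq ε t := sq_nonneg _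

lemma cutSq_le (hε : 0 < ε) (t : ℝ) : cutSq ε t ≤ t ^ 2 := by
  exact sq_le_sq.2 (abs_div_le hε t)

lemma abs_cutSq_le (hε : 0 < ε) (hε1 : ε ≤ 1) (t : ℝ) : |cutSq ε t| ≤ ε⁻¹ * |t| := by
  rw [abs_of_nonneg (cutSq_nonneg t), cutSq, ← sq_abs, sq]
  exact mul_le_mul (abs_div_le_inv hε hε1 t) (abs_div_le hε t) (abs_nonneg _) (by positivity)

variable {n : ℕ} {M : Type*} [TopologicalSpace M] [ChartedSpace (E n) M] [IsManifold (𝓡 n) ∞ M]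
  {X ν : M → E (n + 1)} [T2Space M] [SecondCountableTopology M] [MeasurableSpace M] [BorelSpace M]

/-- The inequality for the regularised integrand. -/
lemma lintegral_cutSq_le (h : IsHypersurface X ν) {u : M → ℝ} {G : M → E (n + 1)}
    (hu : IsW11WithGradient X u G) (huc : HasCompactSupport u) {c C r : ℝ} (hc : 0 < c)
    (hC : 0 < C) (hr : 0 < r) (hε : 0 < ε) (hε1 : ε ≤ 1)
    (hH : ∀ x, u x ≠ 0 → 0 ≤ meanCurvature X ν x)
    (hA : ∀ x, u x ≠ 0 → normSqA X ν x ≤ (C * meanCurvature X ν x) ^ 2)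
    (hd : ∀ x, u x ≠ 0 → c * normSqA X ν x * meanCurvature X ν x ^ 4 ≤
      discr (curvatureMatrix X ν x (frame X x))) :
    ∫⁻ x, ENNReal.ofReal (cutSq ε (u x) * (c * normSqA X ν x * meanCurvature X ν x ^ 4 *
        weight ε (meanCurvature X ν x))) ∂(inducedMeasure X) ≤
      ENNReal.ofReal ((n + 1) ^ 2 * (6 * C ^ 2 + 8 * C ^ 3) + 2 * (n + 1) * C ^ 3) *
        (ENNReal.ofReal r⁻¹ * ∫⁻ x, ENNReal.ofReal (‖G x‖ ^ 2) ∂(inducedMeasure X) +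
          ENNReal.ofReal (1 + r) * ∫⁻ x, ENNReal.ofReal (u x ^ 2 * (normSqGradA X ν x /
            meanCurvature X ν x ^ 2)) ∂(inducedMeasure X)) := by
  set μ := inducedMeasure X with hμ
  set V := weightedField X ν ε with hV
  set k₁ : ℝ := (n + 1) ^ 2 * (6 * C ^ 2 + 8 * C ^ 3) with hk₁
  set k₂ : ℝ := 2 * (n + 1) * C ^ 3 with hk₂
  have hk₁0 : 0 ≤ k₁ := by positivity
  have hk₂0 : 0 ≤ k₂ := by positivity
  set β : M → ℝ := fun x => u x ^ 2 * (normSqGradA X ν x / meanCurvature X ν x ^ 2) with hβ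
  have hβ0 (x) : 0 ≤ β x := by
    have := normSqGradA_nonneg (X := X) (ν := ν) x
    positivity
  have hVs : ContMDiff (𝓡 n) 𝓘(ℝ, E (n + 1)) ∞ V := contMDiff_weightedField h hε
  have hψ := contDiff_cutSq hε
  have hψ' : Continuous (deriv (cutSq ε)) := hψ.continuous_deriv (by simp)
  have hL (t) : |deriv (cutSq ε) t| ≤ 2 * ε⁻¹ :=
    (abs_deriv_cutSq_le hε t).trans (by gcongr; exact abs_div_le_inv hε hε1 t)
  have hψ0 : cutSq ε 0 = 0 := by simp [cutSq]
  have hψ'0 : deriv (cutSq ε) 0 = 0 := by simp [deriv_cutSq hε]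
  have ibp := integral_mul_tdiv h hu huc hψ hL hψ0 hψ'0 hVs (inner_normal_weightedField h ε)
  have iT : Integrable (fun x => cutSq ε (u x) * tdiv X V x) μ := by
    obtain ⟨B, hB⟩ := huc.isCompact.exists_bound_of_continuousOn
      (continuous_tdiv h hVs).continuousOn
    refine Integrable.mono' (hu.integrable.abs.const_mul (ε⁻¹ * B))
      ((hψ.continuous.comp_aestronglyMeasurable hu.integrable.1).mul
        (continuous_tdiv h hVs).aestronglyMeasurable) (ae_of_all _ fun x => ?_)
    by_cases hx : x ∈ tsupport u
    · rw [norm_mul]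
      calc _ ≤ (ε⁻¹ * |u x|) * B := mul_le_mul (abs_cutSq_le hε hε1 _) (hB x hx)
            (norm_nonneg _) (by positivity)
        _ = _ := by ring
    · simp [image_eq_zero_of_notMem_tsupport hx, hψ0]
  have iZ : Integrable (fun x => deriv (cutSq ε) (u x) * ⟪G x, V x⟫_ℝ) μ := by
    obtain ⟨B, hB⟩ := huc.isCompact.exists_bound_of_continuousOn hVs.continuous.continuousOn
    refine Integrable.mono' (hu.integrable_grad.norm.mul_const (2 * ε⁻¹ * |B|))
      ((hψ'.comp_aestronglyMeasurable hu.integrable.1).mul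
        (hu.integrable_grad.1.inner hVs.continuous.aestronglyMeasurable))
      (ae_of_all _ fun x => ?_)
    by_cases hx : x ∈ tsupport u
    · rw [norm_mul]
      calc _ ≤ (2 * ε⁻¹) * (‖G x‖ * |B|) := mul_le_mul (hL _)
            ((norm_inner_le_norm _ _).trans (mul_le_mul_of_nonneg_left
              ((hB x hx).trans (le_abs_self B)) (norm_nonneg _)))
            (norm_nonneg _) (by positivity)
        _ = _ := by ring
    · rw [image_eq_zero_of_notMem_tsupport hx, hψ'0, zero_mul, norm_zero]
      positivity
  have main := lintegral_le_of_integral_eq_neg iT iZ ibp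
    (P := fun x => cutSq ε (u x) * (c * normSqA X ν x * meanCurvature X ν x ^ 4 *
        weight ε (meanCurvature X ν x))) (Q := fun x => k₁ * β x)
    (fun x => by
      have h1 := normSqA_nonneg (X := X) (ν := ν) x
      have h2 := cutSq_nonneg (ε := ε) (u x)
      have h3 : 0 ≤ weight ε (meanCurvature X ν x) := by rw [weight]; positivity
      positivity)
    (fun x => by
      rcases eq_or_ne (u x) 0 with hx | hx
      · simp [hβ, hx, hψ0]
      · have h1 := le_tdiv_weightedField h hε hC (hH x hx) (hA x hx) (hd x hx)
        have h2 := mul_le_mul_of_nonneg_left h1 (cutSq_nonneg (ε := ε) (u x))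
        have h3 : 0 ≤ k₁ * (normSqGradA X ν x / meanCurvature X ν x ^ 2) := by
          have := normSqGradA_nonneg (X := X) (ν := ν) x
          positivity
        have h4 := mul_le_mul_of_nonneg_right (cutSq_le hε (u x)) h3
        simp only [hβ]
        linarith)
  have hZ (x) : |deriv (cutSq ε) (u x) * ⟪G x, V x⟫_ℝ| ≤
      k₂ * (r⁻¹ * ‖G x‖ ^ 2 + r * β x) := by
    have hβx := hβ0 x
    rcases eq_or_ne (u x) 0 with hx | hx
    · rw [hx, hψ'0, zero_mul, abs_zero]; positivity
    · have h1 := norm_weightedField_le h hε hC (hH x hx) (hA x hx)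
      set a := |u x / (1 + ε * u x ^ 2)| with ha
      set w := √(normSqGradA X ν x) / meanCurvature X ν x with hw
      have hw0 : 0 ≤ w := div_nonneg (Real.sqrt_nonneg _) (hH x hx)
      have hβw : β x = (|u x| * w) ^ 2 := by
        rw [mul_pow, hw, div_pow, Real.sq_sqrt (normSqGradA_nonneg x), sq_abs]
      have ha0 : 0 ≤ a := abs_nonneg _
      have haw : a * w ≤ |u x| * w := mul_le_mul_of_nonneg_right (abs_div_le hε _) hw0
      rw [abs_mul]
      calc _ ≤ (2 * a) * (‖G x‖ * (k₂ * w)) := mul_le_mul (abs_deriv_cutSq_le hε _)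
            ((abs_real_inner_le_norm _ _).trans (mul_le_mul_of_nonneg_left h1 (norm_nonneg _)))
            (abs_nonneg _) (by positivity)
        _ = k₂ * (2 * ‖G x‖ * (a * w)) := by ring
        _ ≤ k₂ * (2 * ‖G x‖ * (|u x| * w)) := by gcongr
        _ ≤ _ := by
          rw [hβw]
          refine mul_le_mul_of_nonneg_left ?_ hk₂0
          set y := |u x| * w
          -- Young's inequality
          have h2 : r⁻¹ * ‖G x‖ ^ 2 + r * y ^ 2 - 2 * ‖G x‖ * y = r⁻¹ * (‖G x‖ - r * y) ^ 2 := by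
            field_simp; ring
          have h3 : 0 ≤ r⁻¹ * (‖G x‖ - r * y) ^ 2 := by positivity
          linarith
  refine main.trans ?_
  set I := ∫⁻ x, ENNReal.ofReal (‖G x‖ ^ 2) ∂μ with hI
  set J := ∫⁻ x, ENNReal.ofReal (β x) ∂μ with hJ
  have b1 : ∫⁻ x, ENNReal.ofReal (k₁ * β x) ∂μ = ENNReal.ofReal k₁ * J := by
    simp only [ENNReal.ofReal_mul hk₁0]
    rw [lintegral_const_mul' _ _ ENNReal.ofReal_ne_top]
  have b2 : ∫⁻ x, ENNReal.ofReal |deriv (cutSq ε) (u x) * ⟪G x, V x⟫_ℝ| ∂μ ≤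
      ENNReal.ofReal k₂ * (ENNReal.ofReal r⁻¹ * I + ENNReal.ofReal r * J) := by
    refine (lintegral_mono fun x => ENNReal.ofReal_le_ofReal (hZ x)).trans (le_of_eq ?_)
    have e (x) : ENNReal.ofReal (k₂ * (r⁻¹ * ‖G x‖ ^ 2 + r * β x)) = ENNReal.ofReal k₂ *
        (ENNReal.ofReal r⁻¹ * ENNReal.ofReal (‖G x‖ ^ 2) +
          ENNReal.ofReal r * ENNReal.ofReal (β x)) := by
      have := hβ0 x
      rw [ENNReal.ofReal_mul hk₂0, ENNReal.ofReal_add (by positivity) (by positivity),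
        ENNReal.ofReal_mul (inv_nonneg.2 hr.le), ENNReal.ofReal_mul hr.le]
    simp only [e]
    rw [lintegral_const_mul' _ _ ENNReal.ofReal_ne_top, lintegral_add_left',
      lintegral_const_mul' _ _ ENNReal.ofReal_ne_top, lintegral_const_mul' _ _ ENNReal.ofReal_ne_top]
    exact ((hu.integrable_grad.1.norm.aemeasurable.pow_const 2).ennreal_ofReal).const_mul _
  rw [b1, ENNReal.ofReal_add hk₁0 hk₂0, add_mul]
  refine add_le_add (mul_le_mul_right ?_ _) (b2.trans (mul_le_mul_right ?_ _))
  · refine le_add_left ?_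
    calc J = 1 * J := (one_mul J).symm
      _ ≤ _ := by
        gcongr
        rw [← ENNReal.ofReal_one]
        exact ENNReal.ofReal_le_ofReal (by linarith)
  · gcongr
    linarith

/-- The inequality for a hypersurface whose curvature satisfies the bounds that the cone provides,
by Fatou's lemma. -/
lemma lintegral_sq_mul_normSqA_le (h : IsHypersurface X ν) {u : M → ℝ} {G : M → E (n + 1)}
    (hu : IsW11WithGradient X u G) (huc : HasCompactSupport u) {c C r : ℝ} (hc : 0 < c)
    (hC : 0 < C) (hr : 0 < r)
    (hH : ∀ x, u x ≠ 0 → 0 ≤ meanCurvature X ν x)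
    (hA : ∀ x, u x ≠ 0 → normSqA X ν x ≤ (C * meanCurvature X ν x) ^ 2)
    (hd : ∀ x, u x ≠ 0 → c * normSqA X ν x * meanCurvature X ν x ^ 4 ≤
      discr (curvatureMatrix X ν x (frame X x))) :
    ENNReal.ofReal c * ∫⁻ x, ENNReal.ofReal (u x ^ 2 * normSqA X ν x) ∂(inducedMeasure X) ≤
      ENNReal.ofReal ((n + 1) ^ 2 * (6 * C ^ 2 + 8 * C ^ 3) + 2 * (n + 1) * C ^ 3) *
        (ENNReal.ofReal r⁻¹ * ∫⁻ x, ENNReal.ofReal (‖G x‖ ^ 2) ∂(inducedMeasure X) +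
          ENNReal.ofReal (1 + r) * ∫⁻ x, ENNReal.ofReal (u x ^ 2 * (normSqGradA X ν x /
            meanCurvature X ν x ^ 2)) ∂(inducedMeasure X)) := by
  set δ : ℕ → ℝ := fun k => 1 / ((k : ℝ) + 1) with hδ
  have hδ0 (k) : 0 < δ k := by simp only [hδ]; positivity
  have hδ1 (k) : δ k ≤ 1 := by
    simp only [hδ]
    rw [div_le_one (by positivity)]
    have : (0 : ℝ) ≤ k := by positivity
    linarith
  have hδt : Tendsto δ atTop (𝓝 0) := tendsto_one_div_add_atTop_nhds_zero_nat
  set P : ℝ → M → ℝ := fun ε x => cutSq ε (u x) * (c * normSqA X ν x *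
    meanCurvature X ν x ^ 4 * weight ε (meanCurvature X ν x)) with hP
  -- The limit is attained pointwise: where `u ≠ 0` and `H = 0`, the second fundamental form is zero.
  have hlim (x) : ENNReal.ofReal (c * (u x ^ 2 * normSqA X ν x)) ≤
      liminf (fun k => ENNReal.ofReal (P (δ k) x)) atTop := by
    rcases eq_or_ne (c * (u x ^ 2 * normSqA X ν x)) 0 with h0 | h0
    · rw [h0]; simp
    have hux : u x ≠ 0 := fun hx => h0 (by simp [hx])
    have hHx : meanCurvature X ν x ≠ 0 := fun hx => h0 (by
      have h1 := hA x hux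
      rw [hx] at h1
      have : normSqA X ν x = 0 := le_antisymm (by simpa using h1) (normSqA_nonneg x)
      simp [this])
    have hcont : ContinuousAt (fun ε => P ε x) 0 := by
      simp only [hP, cutSq, weight]
      refine ContinuousAt.mul (ContinuousAt.pow (ContinuousAt.div (by fun_prop) (by fun_prop)
        (by simp)) 2) (ContinuousAt.mul (by fun_prop) (ContinuousAt.inv₀ (by fun_prop) ?_))
      simpa using hHx
    have hP0 : P 0 x = c * (u x ^ 2 * normSqA X ν x) := by
      simp only [hP, cutSq, weight]
      field_simp
      ring
    have := (ENNReal.continuous_ofReal.tendsto _).comp (hcont.tendsto.comp hδt)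
    rw [hP0] at this
    exact this.liminf_eq.ge
  have hmeas (k) : AEMeasurable (fun x => ENNReal.ofReal (P (δ k) x)) (inducedMeasure X) := by
    have h1 := continuous_normSqA h
    have h2 := continuous_meanCurvature h
    have h3 := (contDiff_weight (hδ0 k)).continuous.comp h2
    refine AEMeasurable.ennreal_ofReal (AEMeasurable.mul ?_ ?_)
    · exact ((contDiff_cutSq (hδ0 k)).continuous.comp_aestronglyMeasurable
        hu.integrable.1).aemeasurable
    · exact (((continuous_const.mul h1).mul (h2.pow 4)).mul h3).aemeasurable
  rw [← lintegral_const_mul' _ _ ENNReal.ofReal_ne_top]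
  simp only [← ENNReal.ofReal_mul hc.le]
  refine (lintegral_mono hlim).trans ((lintegral_liminf_le' hmeas).trans ?_)
  refine liminf_le_of_frequently_le' (Frequently.of_forall fun k => ?_)
  exact lintegral_cutSq_le h hu huc hc hC hr (hδ0 k) (hδ1 k) hH hA hd

end Limit

end HypersurfacePoincare

end

theorem proposition2p6 (n : ℕ) (Γ : Set (HypersurfacePoincare.SymMat n))
    (hopen : IsOpen Γ)
    (hinv : HypersurfacePoincare.IsOrthogonallyInvariant Γ)
    (hcone : HypersurfacePoincare.IsCone Γ)
    (htr : closure Γ \ {0} ⊆ {W | 0 < HypersurfacePoincare.tr W})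
    (hcyl : closure Γ ∩ HypersurfacePoincare.Cyl n = ∅) :
    ∃ γ : ℝ, 0 < γ ∧
      ∀ (M : Type*) [TopologicalSpace M] [T2Space M] [SecondCountableTopology M]
        [ChartedSpace (HypersurfacePoincare.E n) M] [IsManifold (𝓡 n) ∞ M]
        [MeasurableSpace M] [BorelSpace M]
        (X ν : M → HypersurfacePoincare.E (n + 1)),
        HypersurfacePoincare.IsHypersurface X ν →
      ∀ (u : M → ℝ) (G : M → HypersurfacePoincare.E (n + 1)),
        HypersurfacePoincare.IsW11WithGradient X u G →
        HasCompactSupport u →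
        IsCompact (closure (HypersurfacePoincare.curvatureSet X ν {x | u x ≠ 0})) →
        HypersurfacePoincare.curvatureSet X ν {x | u x ≠ 0} ⊆ Subtype.val '' Γ →
      ∀ r : ℝ, 0 < r →
        ENNReal.ofReal γ *
            ∫⁻ x, ENNReal.ofReal (u x ^ 2 * HypersurfacePoincare.normSqA X ν x)
              ∂(HypersurfacePoincare.inducedMeasure X)
          ≤ ENNReal.ofReal r⁻¹ *
              ∫⁻ x, ENNReal.ofReal (‖G x‖ ^ 2) ∂(HypersurfacePoincare.inducedMeasure X)
            + ENNReal.ofReal (1 + r) *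
              ∫⁻ x, ENNReal.ofReal (u x ^ 2 * (HypersurfacePoincare.normSqGradA X ν x /
                  HypersurfacePoincare.meanCurvature X ν x ^ 2))
                ∂(HypersurfacePoincare.inducedMeasure X) := by
  obtain ⟨c, C, hc, hC, hΓ⟩ := HypersurfacePoincare.exists_cone_bounds Γ hcone htr hcyl
  set k : ℝ := (n + 1) ^ 2 * (6 * C ^ 2 + 8 * C ^ 3) + 2 * (n + 1) * C ^ 3 with hk
  have hk0 : 0 < k := by positivity
  refine ⟨c / k, by positivity, ?_⟩
  intro M _ _ _ _ _ _ _ X ν h u G hu huc _ hcurv r hr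
  have hb (x : M) (hx : u x ≠ 0) : 0 ≤ HypersurfacePoincare.meanCurvature X ν x ∧
      HypersurfacePoincare.normSqA X ν x ≤ (C * HypersurfacePoincare.meanCurvature X ν x) ^ 2 ∧
      c * HypersurfacePoincare.normSqA X ν x * HypersurfacePoincare.meanCurvature X ν x ^ 4 ≤
        HypersurfacePoincare.discr (HypersurfacePoincare.curvatureMatrix X ν x
          (HypersurfacePoincare.frame X x)) := by
    obtain ⟨W, hW, hWx⟩ := hcurv ⟨x, hx, _, HypersurfacePoincare.isFrame_frame h x, rfl⟩
    have := hΓ W hW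
    rw [HypersurfacePoincare.tr, hWx] at this
    exact this
  have main := HypersurfacePoincare.lintegral_sq_mul_normSqA_le h hu huc hc hC hr
    (fun x hx => (hb x hx).1) (fun x hx => (hb x hx).2.1) (fun x hx => (hb x hx).2.2)
  have e : ENNReal.ofReal c = ENNReal.ofReal k * ENNReal.ofReal (c / k) := by
    rw [← ENNReal.ofReal_mul hk0.le, mul_div_cancel₀ _ hk0.ne']
  rw [e, mul_assoc] at main
  exact (ENNReal.mul_le_mul_iff_right (by simpa using hk0) ENNReal.ofReal_ne_top).1 main
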